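/- **Setting.** Let $d,n\ge 1$ be integers and let $X$ be a random vector in $\mathbb{R}^d$. Write $\phi(z)=\mathbb{E}\,e^{z\cdot X}$ for its moment generating function, $\varphi(\tau)=\log\phi(\tau)$ for real $\tau$, and $\varphi(z)=\operatorname{Log}\phi(z)=\log|\phi(z)|+i\,\mathrm{Arg}\,\phi(z)$ (principal branch) for complex $z$. Put $H=H(\tau)=\nabla^2\varphi(\tau)$ and $\varepsilon=d^2/n$. Let $\kappa,\delta>0$ and let $V\subset\mathbb{R}^d$ be an open neighbourhood of the origin. Assume: 1. $\sup_{\tau\in V}\mathbb{E}\big(\|X\|^4e^{\tau\cdot X}\big)<\infty$. 2. $H(\tau)$ is positive definite for all $\tau\in V$, and $\sup_{\tau\in V}\|H(\tau)^{-1}\|<\infty$. 3. For all $\tau\in V$ and all $t\in\mathbb{R}^d$ with $\|t\|\ge 2.5(d/n)^{1/2}$, $$\left|\frac{\phi(\tau+iH^{-1/2}t)}{\phi(\tau)}\right|\le\max\Big(e^{-(d/n)^{1/2}\|t\|},\ (1+\|t\|)^{-\kappa/d^{1/2}}\Big).$$ 4. For all $\tau\in V$ and all $t\in\mathbb{R}^d$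 with $\|t\|\le 2.5(d/n)^{1/2}$, $\ |\mathrm{Arg}\,\phi(\tau+iH^{-1/2}t)|\le\pi-\delta$ and $|\phi(\tau+iH^{-1/2}t)|\ge\delta$. Define, with operator norms of tensors, $$c_3=\sup_{\tau\in V,\ \|t\|<2.5(d/n)^{1/2}}\big\|\nabla_t^3\,\mathrm{Im}\,\varphi(\tau+iH^{-1/2}t)\big\|,\qquad c_4=\sup_{\tau\in V,\ \|t\|<2.5(d/n)^{1/2}}\big\|\nabla_t^4\,\mathrm{Re}\,\varphi(\tau+iH^{-1/2}t)\big\|.$$ For $a\in U=\nabla\varphi(V)$, let $\tau\in V$ satisfy $\nabla\varphi(\tau)=a$ and set $$I(a)=\frac{n^{d/2}}{(2\pi)^{d/2}}\int_{\mathbb{R}^d}\left[\frac{\phi(\tau+iH^{-1/2}t)}{\phi(\tau)}\right]^n e^{-in\langle H^{-1/2}t,a\rangle}\,dt .$$ **Theorem.** There is an absolute constant $C>0$, and for every $\kappa>0$ there is $\varepsilon_0>0$ depending only on $\kappa$, such that the following holds for all $d$, $n$, $\delta$, $V$ and $X$ as above. If $\varepsilon=d^2/n\le\varepsilon_0$,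 then $c_3,c_4<\infty$, and for every $a\in U$ the integral defining $I(a)$ converges absolutely and $$|I(a)-1|\le C\left[\exp(40\,c_4\,\varepsilon)\,(c_3^2+c_4)\,\varepsilon+e^{-d}+\Big(\frac{e}{\kappa^2}\,\varepsilon\Big)^{d/2}\right].$$ -/

import Mathlib

open MeasureTheory
open scoped RealInnerProductSpace

namespace SPA

/-- `d`-dimensional Euclidean space. -/
abbrev Vec (d : ℕ) : Type := EuclideanSpace ℝ (Fin d)

noncomputable section

/-- The moment generating function `φ(τ) = E exp(τ · X)` of a random vector `X` with law `μ`. -/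
def mgf {d : ℕ} (μ : Measure (Vec d)) (τ : Vec d) : ℝ :=
  ∫ x, Real.exp ⟪τ, x⟫ ∂μ

/-- The cumulant generating function `log φ(τ)`. -/
def cgf {d : ℕ} (μ : Measure (Vec d)) (τ : Vec d) : ℝ :=
  Real.log (mgf μ τ)

/-- The moment generating function at the complex point `τ + i s`, that is
`φ(τ + i s) = E exp((τ + i s) · X)`. -/
def mgfC {d : ℕ} (μ : Measure (Vec d)) (τ s : Vec d) : ℂ :=
  ∫ x, Complex.exp ((⟪τ, x⟫ : ℂ) + Complex.I * (⟪s, x⟫ : ℂ)) ∂μ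

/-- The cumulant generating function at the complex point `τ + i s`, as the principal logarithm of
`φ(τ + i s)`. Its real part is `log |φ(τ + i s)|` and its imaginary part is `Arg φ(τ + i s)`. -/
def cgfC {d : ℕ} (μ : Measure (Vec d)) (τ s : Vec d) : ℂ :=
  Complex.log (mgfC μ τ s)

/-- The Hessian matrix `H(τ)` of the cumulant generating function at the real point `τ`. -/
def hess {d : ℕ} (μ : Measure (Vec d)) (τ : Vec d) : Matrix (Fin d) (Fin d) ℝ :=
  Matrix.of fun i j => iteratedFDeriv ℝ 2 (cgf μ) τ
    ![EuclideanSpace.single i (1 : ℝ), EuclideanSpace.single j (1 : ℝ)]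

/-- `A ^ (-1/2)` for a symmetric positive definite matrix `A` (by functional calculus). -/
def invSqrt {d : ℕ} (A : Matrix (Fin d) (Fin d) ℝ) : Matrix (Fin d) (Fin d) ℝ :=
  cfc (fun x : ℝ => (Real.sqrt x)⁻¹) A

/-- The vector `H(τ)^(-1/2) t`. -/
def whiten {d : ℕ} (μ : Measure (Vec d)) (τ t : Vec d) : Vec d :=
  Matrix.toEuclideanCLM (n := Fin d) (𝕜 := ℝ) (invSqrt (hess μ τ)) t

/-- The radius `2.5 (d / n)^(1/2)`. -/
def radius (d n : ℕ) : ℝ := (5 / 2) * Real.sqrt ((d : ℝ) / (n : ℝ))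

/-- The assumption on the law `μ` of `X`, on the set `V`, on the sample size `n`, and on the
constants `κ` and `δ`. -/
structure Regular {d : ℕ} (μ : Measure (Vec d)) (V : Set (Vec d)) (n : ℕ) (κ δ : ℝ) : Prop where
  /-- `V` is an (open) neighbourhood of the origin -/
  isOpen : IsOpen V
  zero_mem : (0 : Vec d) ∈ V
  /-- `sup_{τ ∈ V} E (‖X‖⁴ exp(τ · X)) < ∞` -/
  moments : (⨆ τ ∈ V, ∫⁻ x, ENNReal.ofReal (‖x‖ ^ 4 * Real.exp ⟪τ, x⟫) ∂μ) < ⊤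
  /-- `H(τ)` is positive definite on `V` -/
  posDef : ∀ τ ∈ V, (hess μ τ).PosDef
  /-- `sup_{τ ∈ V} ‖H(τ)⁻¹‖ < ∞` for the Euclidean operator norm -/
  inv_bdd : BddAbove
    ((fun τ => ‖Matrix.toEuclideanCLM (n := Fin d) (𝕜 := ℝ) (hess μ τ)⁻¹‖) '' V)
  /-- decay of `|φ(τ + i H^(-1/2) t) / φ(τ)|` outside of the ball -/
  decay : ∀ τ ∈ V, ∀ t : Vec d, radius d n ≤ ‖t‖ →
    ‖mgfC μ τ (whiten μ τ t) / (mgf μ τ : ℂ)‖ ≤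
      max (Real.exp (-(Real.sqrt ((d : ℝ) / (n : ℝ)) * ‖t‖)))
        ((1 + ‖t‖) ^ (-(κ / Real.sqrt (d : ℝ))))
  /-- control of the phase in the ball -/
  phase : ∀ τ ∈ V, ∀ t : Vec d, ‖t‖ ≤ radius d n →
    |Complex.arg (mgfC μ τ (whiten μ τ t))| ≤ Real.pi - δ
  /-- control of the modulus in the ball -/
  modulus : ∀ τ ∈ V, ∀ t : Vec d, ‖t‖ ≤ radius d n →
    δ ≤ ‖mgfC μ τ (whiten μ τ t)‖

/-- The values `‖∇_t³ Im cgf(τ + i H^(-1/2) t)‖` for `τ ∈ V`, `‖t‖ < 2.5 (d / n)^(1/2)`. -/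
def thirdDerivNorms {d : ℕ} (μ : Measure (Vec d)) (V : Set (Vec d)) (n : ℕ) : Set ℝ :=
  {r | ∃ τ ∈ V, ∃ t : Vec d, ‖t‖ < radius d n ∧
    r = ‖iteratedFDeriv ℝ 3 (fun u : Vec d => (cgfC μ τ (whiten μ τ u)).im) t‖}

/-- The values `‖∇_t⁴ Re cgf(τ + i H^(-1/2) t)‖` for `τ ∈ V`, `‖t‖ < 2.5 (d / n)^(1/2)`. -/
def fourthDerivNorms {d : ℕ} (μ : Measure (Vec d)) (V : Set (Vec d)) (n : ℕ) : Set ℝ :=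
  {r | ∃ τ ∈ V, ∃ t : Vec d, ‖t‖ < radius d n ∧
    r = ‖iteratedFDeriv ℝ 4 (fun u : Vec d => (cgfC μ τ (whiten μ τ u)).re) t‖}

/-- The constant `c₃`. -/
def c3 {d : ℕ} (μ : Measure (Vec d)) (V : Set (Vec d)) (n : ℕ) : ℝ :=
  sSup (thirdDerivNorms μ V n)

/-- The constant `c₄`. -/
def c4 {d : ℕ} (μ : Measure (Vec d)) (V : Set (Vec d)) (n : ℕ) : ℝ :=
  sSup (fourthDerivNorms μ V n)

/-- The integrand `[φ(τ + i H^(-1/2) t) / φ(τ)]ⁿ exp(-i n ⟨H^(-1/2) t, a⟩)`. -/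
def integrand {d : ℕ} (μ : Measure (Vec d)) (n : ℕ) (τ a t : Vec d) : ℂ :=
  (mgfC μ τ (whiten μ τ t) / (mgf μ τ : ℂ)) ^ n *
    Complex.exp (-(Complex.I * (n : ℂ) * (⟪whiten μ τ t, a⟫ : ℂ)))

/-- The normalized Laplace inversion integral `I(a)`, where `τ` is the saddle point of `a`. -/
def saddleIntegral {d : ℕ} (μ : Measure (Vec d)) (n : ℕ) (τ a : Vec d) : ℂ :=
  (((n : ℝ) ^ ((d : ℝ) / 2) / (2 * Real.pi) ^ ((d : ℝ) / 2) : ℝ) : ℂ) *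
    ∫ t : Vec d, integrand μ n τ a t

end

end SPA

/-!
Let `ν` be the law of `X` tilted by `exp ⟪τ, x⟫`, pushed forward by `H(τ) ^ (-1/2)`. Then
`φ(τ + i H ^ (-1/2) t) / φ(τ)` is the characteristic function of `ν` at `t`
(`mgfC_whiten_eq`), the covariance of `ν` is the identity, and its mean `m` satisfies
`⟪m, t⟫ = ⟪H ^ (-1/2) t, a⟫` when `τ` is the saddle point of `a`. The integrand of `I(a)` is therefore
`(charFun ν t * exp (-i ⟪m, t⟫)) ^ n`.

On the ball of radius `5 / 2 * √(d / n)` the function `log (charFun ν t) - i ⟪m, t⟫` has an even real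
part `-‖t‖² / 2 + r t` and an odd imaginary part `v t`. Parity kills the cubic term of the real part
and the quadratic term of the imaginary part, so that `|r t| ≤ c₄ ‖t‖⁴`
(`abs_re_log_charFun_add_le`) and `‖∇ v t‖ ≤ c₃ ‖t‖²` (`norm_fderiv_im_log_charFun_sub_le`).
The structure `NearGaussian` records this situation.

Since the integrand is Hermitian, its integral over a centred ball is real, and the phase only enters
through `cos (n v)`, hence through `n² v²`. With respect to the Gaussian law `γ` of covariance `1 / n`,
the fourth moment of `‖t‖` is of order `d² / n²`, which controls the contribution of `r`. For `v`, the
pointwise bound `c₃ ‖t‖³` would give `d³ / n³` for the second moment; the estimate `d² / n³` that is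
needed is a Poincaré inequality for odd functions, `lintegral_sq_le_of_odd`. It is proved by rotating
pairs `(x, y)` of independent Gaussian vectors: `v x` is half of the integral of the derivative
of `v` along the half circle from `-x` to `x` through `y`, rotations preserve `γ × γ`, and the average
over `y` of `(∇ v x · y)²` is `‖∇ v x‖² / n`. As `v` is only controlled on a ball, the pairs are
restricted to the rotation invariant set `‖x‖² + ‖y‖² < R²`.

Outside of the ball of radius `√(5 d / n)` the mass of `γ` is at most `exp (-d)`
(`gaussianLaw_five_le`), and the decay assumption bounds the remaining tails by radial integrals
(`lintegral_tail_exp_le`, `lintegral_tail_pow_le`).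

Finiteness of `c₃` and `c₄` is a compactness argument (`exists_bound_iteratedFDeriv`): the moment
assumption bounds the derivatives of the characteristic function, the phase and modulus conditions
keep its values in a compact sector on which the logarithm is smooth, and the moment generating
function is bounded above and below on `V`.
-/

namespace SPA

/-! ### Gaussian laws on Euclidean spaces -/

section Gaussian

open Module

variable {E : Type*} [NormedAddCommGroup E] [InnerProductSpace ℝ E]

/-- The density of the centred Gaussian law with covariance `N⁻¹ • 1`. -/
noncomputable def gaussianWeight (N : ℝ) (t : E) : ℝ :=
  (N / (2 * Real.pi)) ^ ((finrank ℝ E : ℝ) / 2) * Real.exp (-(N / 2) * ‖t‖ ^ 2)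

lemma gaussianWeight_nonneg {N : ℝ} (hN : 0 < N) (t : E) : 0 ≤ gaussianWeight N t := by
  unfold gaussianWeight; positivity

lemma continuous_gaussianWeight (N : ℝ) : Continuous (gaussianWeight N : E → ℝ) := by
  unfold gaussianWeight; fun_prop

lemma sq_le_exp_add_exp_neg (x : ℝ) : x ^ 2 ≤ 2 * (Real.exp x + Real.exp (-x)) := by
  rcases le_total 0 x with h | h
  · have := Real.quadratic_le_exp_of_nonneg h
    nlinarith [Real.exp_pos (-x)]
  · have := Real.quadratic_le_exp_of_nonneg (neg_nonneg.mpr h)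
    nlinarith [Real.exp_pos x]

/-- The centred Gaussian law with covariance `N⁻¹ • 1`, given by its density. -/
noncomputable def gaussianLaw (E : Type*) [NormedAddCommGroup E] [InnerProductSpace ℝ E]
    [FiniteDimensional ℝ E] [MeasurableSpace E] [BorelSpace E] (N : ℝ) : Measure E :=
  volume.withDensity fun t => ENNReal.ofReal (gaussianWeight N t)

variable [FiniteDimensional ℝ E] [MeasurableSpace E] [BorelSpace E]

/-- The Laplace transform of a Gaussian density, from the complex formula at real parameters. -/
lemma integral_exp_neg_sq_add_inner {b : ℝ} (hb : 0 < b) (w : E) :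
    Integrable (fun t : E => Real.exp (-b * ‖t‖ ^ 2 + ⟪w, t⟫)) ∧
    ∫ t : E, Real.exp (-b * ‖t‖ ^ 2 + ⟪w, t⟫) =
      (Real.pi / b) ^ ((finrank ℝ E : ℝ) / 2) * Real.exp (‖w‖ ^ 2 / (4 * b)) := by
  have hb' : 0 < (b : ℂ).re := by simpa
  have hc : ∀ t : E, Complex.exp (-(b : ℂ) * (‖t‖ : ℂ) ^ 2 + 1 * (⟪w, t⟫ : ℂ)) =
      ((Real.exp (-b * ‖t‖ ^ 2 + ⟪w, t⟫) : ℝ) : ℂ) := by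
    intro t; push_cast; ring_nf
  have h1 := GaussianFourier.integrable_cexp_neg_mul_sq_norm_add (V := E) hb' 1 w
  have h2 := GaussianFourier.integral_cexp_neg_mul_sq_norm_add (V := E) hb' 1 w
  simp_rw [hc] at h1 h2
  refine ⟨h1.re.congr (Filter.Eventually.of_forall fun t => Complex.ofReal_re _), ?_⟩
  rw [integral_complex_ofReal] at h2
  have h3 : (((Real.pi / b) ^ ((finrank ℝ E : ℝ) / 2) * Real.exp (‖w‖ ^ 2 / (4 * b)) : ℝ) : ℂ) =
      ((Real.pi : ℂ) / b) ^ ((finrank ℝ E : ℂ) / 2) *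
        Complex.exp (1 ^ 2 * (‖w‖ : ℂ) ^ 2 / (4 * b)) := by
    push_cast
    rw [Complex.ofReal_cpow (by positivity)]
    push_cast
    ring_nf
  rw [← h3] at h2
  exact_mod_cast h2

lemma lintegral_gaussianLaw (N : ℝ) (f : E → ENNReal) (hf : Measurable f) :
    ∫⁻ t, f t ∂(gaussianLaw E N) = ∫⁻ t, ENNReal.ofReal (gaussianWeight N t) * f t := by
  rw [gaussianLaw, lintegral_withDensity_eq_lintegral_mul _ _ hf]
  · rfl
  · exact (continuous_gaussianWeight N).measurable.ennreal_ofReal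

/-- All moment bounds for the Gaussian law below come from this joint exponential moment. -/
lemma lintegral_gaussianLaw_exp {N : ℝ} (hN : 0 < N) {c : ℝ} (hc : c < 1 / 2) (w : E) :
    ∫⁻ t, ENNReal.ofReal (Real.exp (c * N * ‖t‖ ^ 2 + ⟪w, t⟫)) ∂(gaussianLaw E N) =
      ENNReal.ofReal ((1 - 2 * c) ^ (-((finrank ℝ E : ℝ) / 2)) *
        Real.exp (‖w‖ ^ 2 / (2 * N * (1 - 2 * c)))) := by
  have hc' : 0 < 1 - 2 * c := by linarith
  have hb : 0 < N / 2 * (1 - 2 * c) := by positivity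
  obtain ⟨h1, h2⟩ := integral_exp_neg_sq_add_inner (E := E) hb w
  rw [lintegral_gaussianLaw _ _ (by fun_prop)]
  have h3 : ∀ t : E, ENNReal.ofReal (gaussianWeight N t) *
      ENNReal.ofReal (Real.exp (c * N * ‖t‖ ^ 2 + ⟪w, t⟫)) =
      ENNReal.ofReal ((N / (2 * Real.pi)) ^ ((finrank ℝ E : ℝ) / 2) *
        Real.exp (-(N / 2 * (1 - 2 * c)) * ‖t‖ ^ 2 + ⟪w, t⟫)) := by
    intro t
    rw [← ENNReal.ofReal_mul (gaussianWeight_nonneg hN t), gaussianWeight, mul_assoc,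
      ← Real.exp_add]
    ring_nf
  simp_rw [h3]
  rw [← ofReal_integral_eq_lintegral_ofReal (h1.const_mul _)
    (Filter.Eventually.of_forall fun t => by positivity), integral_const_mul, h2, ← mul_assoc,
    ← Real.mul_rpow (by positivity) (by positivity)]
  congr 2
  · rw [Real.rpow_neg hc'.le, ← Real.inv_rpow hc'.le]
    congr 1
    field_simp
  · congr 1
    field_simp
    norm_num

lemma lintegral_gaussianLaw_exp_sq {N : ℝ} (hN : 0 < N) {c : ℝ} (hc : c < 1 / 2) :
    ∫⁻ t, ENNReal.ofReal (Real.exp (c * N * ‖t‖ ^ 2)) ∂(gaussianLaw E N) =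
      ENNReal.ofReal ((1 - 2 * c) ^ (-((finrank ℝ E : ℝ) / 2))) := by
  simpa using lintegral_gaussianLaw_exp (E := E) hN hc 0

lemma lintegral_gaussianLaw_exp_inner {N : ℝ} (hN : 0 < N) (w : E) :
    ∫⁻ t, ENNReal.ofReal (Real.exp ⟪w, t⟫) ∂(gaussianLaw E N) =
      ENNReal.ofReal (Real.exp (‖w‖ ^ 2 / (2 * N))) := by
  simpa using lintegral_gaussianLaw_exp (E := E) hN (c := 0) (by norm_num) w

lemma isProbabilityMeasure_gaussianLaw {N : ℝ} (hN : 0 < N) :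
    IsProbabilityMeasure (gaussianLaw E N) := by
  constructor
  simpa using lintegral_gaussianLaw_exp_sq (E := E) hN (c := 0) (by norm_num)

/-- The fourth moment of the norm is at most a constant times `d² / N²`; bounding the fourth power
by an exponential of the square avoids computing it. -/
lemma lintegral_gaussianLaw_norm_pow_four_le {N : ℝ} (hN : 0 < N) (hd : 1 ≤ finrank ℝ E) :
    ∫⁻ t, ENNReal.ofReal (‖t‖ ^ 4) ∂(gaussianLaw E N) ≤
      ENNReal.ofReal (64 * (finrank ℝ E : ℝ) ^ 2 / N ^ 2) := by
  set d : ℝ := (finrank ℝ E : ℝ) with hdd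
  have hd1 : (1 : ℝ) ≤ d := by rw [hdd]; exact_mod_cast hd
  have hd0 : 0 < d := by linarith
  have hc : 1 / (4 * d) < 1 / 2 := by
    rw [div_lt_div_iff₀ (by positivity) (by norm_num)]; linarith
  have key : ∀ t : E, ENNReal.ofReal (‖t‖ ^ 4) ≤
      ENNReal.ofReal (32 * d ^ 2 / N ^ 2) *
        ENNReal.ofReal (Real.exp (1 / (4 * d) * N * ‖t‖ ^ 2)) := by
    intro t
    rw [← ENNReal.ofReal_mul (by positivity)]
    apply ENNReal.ofReal_le_ofReal
    set y := 1 / (4 * d) * N * ‖t‖ ^ 2 with hy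
    have hy0 : 0 ≤ y := by positivity
    have h1 : y ^ 2 / 2 ≤ Real.exp y := by
      have := Real.quadratic_le_exp_of_nonneg hy0; linarith
    have h2 : ‖t‖ ^ 4 = 32 * d ^ 2 / N ^ 2 * (y ^ 2 / 2) := by
      rw [hy]; field_simp; ring
    rw [h2]; gcongr
  refine (lintegral_mono key).trans ?_
  rw [lintegral_const_mul _ (by fun_prop), lintegral_gaussianLaw_exp_sq hN hc,
    ← ENNReal.ofReal_mul (by positivity)]
  apply ENNReal.ofReal_le_ofReal
  have hx : 0 ≤ 1 - 2 * (1 / (4 * d)) := by linarith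
  have hb : (1 : ℝ) / 2 ≤ (1 - 2 * (1 / (4 * d))) ^ d := by
    have := one_add_mul_self_le_rpow_one_add (s := -(2 * (1 / (4 * d)))) (by linarith) hd1
    have h3 : 1 + d * -(2 * (1 / (4 * d))) = 1 / 2 := by field_simp; norm_num
    rw [h3] at this
    simpa [sub_eq_add_neg] using this
  have h4 : (1 - 2 * (1 / (4 * d))) ^ (-(d / 2)) ≤ 2 := by
    rw [Real.rpow_neg hx, show d / 2 = d * (1 / 2) by ring, Real.rpow_mul hx]
    apply inv_le_of_inv_le₀ (by norm_num)
    calc (2 : ℝ)⁻¹ ≤ (1 / 2 : ℝ) ^ (1 / 2 : ℝ) := by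
          have := Real.rpow_le_rpow_of_exponent_ge (x := 1 / 2) (by norm_num) (by norm_num)
            (show (1 / 2 : ℝ) ≤ 1 by norm_num)
          simpa using this
      _ ≤ _ := by gcongr
  calc 32 * d ^ 2 / N ^ 2 * (1 - 2 * (1 / (4 * d))) ^ (-(d / 2))
      ≤ 32 * d ^ 2 / N ^ 2 * 2 := by gcongr
    _ = _ := by ring

lemma lintegral_gaussianLaw_inner_sq_le {N : ℝ} (hN : 0 < N) (a : E) :
    ∫⁻ t, ENNReal.ofReal (⟪a, t⟫ ^ 2) ∂(gaussianLaw E N) ≤ ENNReal.ofReal (8 * ‖a‖ ^ 2 / N) := by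
  by_cases ha : a = 0
  · simp [ha]
  have ha' : 0 < ‖a‖ := norm_pos_iff.mpr ha
  set r := Real.sqrt N / ‖a‖ with hr
  have hr0 : 0 < r := by positivity
  have hw : ‖r • a‖ ^ 2 = N := by
    rw [norm_smul, Real.norm_of_nonneg hr0.le, hr, div_mul_cancel₀ _ ha'.ne', Real.sq_sqrt hN.le]
  have key : ∀ t : E, ENNReal.ofReal (⟪a, t⟫ ^ 2) ≤ ENNReal.ofReal (2 * ‖a‖ ^ 2 / N) *
      (ENNReal.ofReal (Real.exp ⟪r • a, t⟫) + ENNReal.ofReal (Real.exp ⟪-(r • a), t⟫)) := by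
    intro t
    rw [← ENNReal.ofReal_add (by positivity) (by positivity), ← ENNReal.ofReal_mul (by positivity)]
    apply ENNReal.ofReal_le_ofReal
    have h1 := sq_le_exp_add_exp_neg ⟪r • a, t⟫
    have h2 : ⟪a, t⟫ ^ 2 = ‖a‖ ^ 2 / N * ⟪r • a, t⟫ ^ 2 := by
      rw [real_inner_smul_left, hr]
      field_simp
      rw [Real.sq_sqrt hN.le]
    rw [h2, inner_neg_left, show 2 * ‖a‖ ^ 2 / N = ‖a‖ ^ 2 / N * 2 by ring, mul_assoc]
    gcongr
  refine (lintegral_mono key).trans ?_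
  rw [lintegral_const_mul _ (by fun_prop), lintegral_add_left (by fun_prop),
    lintegral_gaussianLaw_exp_inner hN, lintegral_gaussianLaw_exp_inner hN, norm_neg, hw,
    ← ENNReal.ofReal_add (by positivity) (by positivity), ← ENNReal.ofReal_mul (by positivity)]
  apply ENNReal.ofReal_le_ofReal
  have h5 : Real.exp (N / (2 * N)) ≤ 2 := by
    rw [show N / (2 * N) = 1 / 2 by field_simp]
    have h := Real.exp_one_lt_d9
    have h6 : Real.exp (1 / 2) ^ 2 = Real.exp 1 := by rw [← Real.exp_nat_mul]; norm_num
    nlinarith [Real.exp_pos (1 / 2)]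
  calc _ ≤ 2 * ‖a‖ ^ 2 / N * (2 + 2) := by gcongr
    _ = _ := by ring

/-- Chernoff's bound for the norm of a Gaussian vector. -/
lemma gaussianLaw_le_norm_sq_le {N : ℝ} (hN : 0 < N) {c : ℝ} (hc0 : 0 ≤ c) (hc : c < 1 / 2)
    (s : ℝ) :
    gaussianLaw E N {t | s * finrank ℝ E / N ≤ ‖t‖ ^ 2} ≤
      ENNReal.ofReal (((Real.sqrt (1 - 2 * c))⁻¹ * Real.exp (-(c * s))) ^ finrank ℝ E) := by
  have hc' : 0 < 1 - 2 * c := by linarith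
  have h := mul_meas_ge_le_lintegral (μ := gaussianLaw E N)
    (f := fun t => ENNReal.ofReal (Real.exp (c * N * ‖t‖ ^ 2))) (by fun_prop)
    (ENNReal.ofReal (Real.exp (c * s * finrank ℝ E)))
  rw [lintegral_gaussianLaw_exp_sq hN hc] at h
  have hsub : {t : E | s * finrank ℝ E / N ≤ ‖t‖ ^ 2} ⊆
      {t | ENNReal.ofReal (Real.exp (c * s * finrank ℝ E)) ≤
        ENNReal.ofReal (Real.exp (c * N * ‖t‖ ^ 2))} := by
    intro t ht
    simp only [Set.mem_ofPred_eq] at ht ⊢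
    apply ENNReal.ofReal_le_ofReal
    apply Real.exp_le_exp.mpr
    rw [div_le_iff₀ hN] at ht
    nlinarith [mul_le_mul_of_nonneg_left ht hc0]
  have h2 : gaussianLaw E N {t | s * finrank ℝ E / N ≤ ‖t‖ ^ 2} =
      ENNReal.ofReal (Real.exp (-(c * s * finrank ℝ E))) *
      (ENNReal.ofReal (Real.exp (c * s * finrank ℝ E)) *
        gaussianLaw E N {t | s * finrank ℝ E / N ≤ ‖t‖ ^ 2}) := by
    rw [← mul_assoc, ← ENNReal.ofReal_mul (by positivity), ← Real.exp_add]
    simp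
  rw [h2]
  refine (mul_le_mul_right ((mul_le_mul_right (measure_mono hsub) _).trans h) _).trans ?_
  rw [← ENNReal.ofReal_mul (by positivity)]
  apply ENNReal.ofReal_le_ofReal
  apply le_of_eq
  rw [mul_pow, inv_pow, Real.sqrt_eq_rpow, ← Real.exp_nat_mul, ← Real.rpow_natCast,
    ← Real.rpow_mul hc'.le, Real.rpow_neg hc'.le]
  rw [mul_comm]
  congr 2 <;> ring_nf

/-- The complement of the ball of radius `√(5 d / N)` has mass at most `exp (-d)`. -/
lemma gaussianLaw_five_le {N : ℝ} (hN : 0 < N) :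
    gaussianLaw E N {t | 5 * finrank ℝ E / N ≤ ‖t‖ ^ 2} ≤
      ENNReal.ofReal (Real.exp (-(finrank ℝ E : ℝ))) := by
  -- `c = 2 / 5` is the optimal exponent for `s = 5`
  refine (gaussianLaw_le_norm_sq_le hN (c := 2 / 5) (by norm_num) (by norm_num) 5).trans ?_
  apply ENNReal.ofReal_le_ofReal
  rw [← mul_neg_one (finrank ℝ E : ℝ), Real.exp_nat_mul]
  gcongr
  rw [show (1 : ℝ) - 2 * (2 / 5) = 5⁻¹ by norm_num, Real.sqrt_inv, inv_inv]
  have h1 : Real.sqrt 5 ≤ Real.exp 1 := by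
    apply Real.sqrt_le_iff.mpr ⟨by positivity, ?_⟩
    have := Real.exp_one_gt_d9
    nlinarith
  calc Real.sqrt 5 * Real.exp (-(2 / 5 * 5)) ≤ Real.exp 1 * Real.exp (-(2 / 5 * 5)) := by gcongr
    _ = Real.exp (-1) := by rw [← Real.exp_add]; norm_num

/-- The ball of radius `√(5 d / (4 N))`, slightly larger than the typical norm, carries a positive
fraction of the mass uniformly in the dimension. -/
lemma one_le_gaussianLaw_norm_sq_lt {N : ℝ} (hN : 0 < N) (hd : 1 ≤ finrank ℝ E) :
    1 ≤ 100 * gaussianLaw E N {t | ‖t‖ ^ 2 < 5 / 4 * finrank ℝ E / N} := by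
  have := isProbabilityMeasure_gaussianLaw (E := E) hN
  have hq : (Real.sqrt (1 - 2 * (1 / 10)))⁻¹ * Real.exp (-(1 / 10 * (5 / 4))) ≤ 99 / 100 := by
    rw [inv_mul_le_iff₀ (by apply Real.sqrt_pos.mpr; norm_num)]
    have h0 : 0 ≤ Real.sqrt (1 - 2 * (1 / 10)) * (99 / 100) := by positivity
    refine abs_le_of_sq_le_sq' ?_ h0 |>.2
    rw [mul_pow, Real.sq_sqrt (by norm_num), ← Real.exp_nat_mul]
    have h1 := Real.quadratic_le_exp_of_nonneg (show (0 : ℝ) ≤ 1 / 4 by norm_num)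
    rw [show (((2 : ℕ) : ℝ) * -(1 / 10 * (5 / 4))) = -(1 / 4) by norm_num, Real.exp_neg]
    rw [inv_le_iff_one_le_mul₀ (by positivity)]
    nlinarith
  have h := gaussianLaw_le_norm_sq_le (E := E) hN (c := 1 / 10) (by norm_num) (by norm_num) (5 / 4)
  have h2 : gaussianLaw E N {t | 5 / 4 * finrank ℝ E / N ≤ ‖t‖ ^ 2} ≤ ENNReal.ofReal (99 / 100) := by
    refine h.trans (ENNReal.ofReal_le_ofReal ?_)
    refine (pow_le_of_le_one (by positivity) (hq.trans (by norm_num)) (by omega)).trans hq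
  have hm : MeasurableSet {t : E | ‖t‖ ^ 2 < 5 / 4 * finrank ℝ E / N} :=
    measurableSet_lt (by fun_prop) (by fun_prop)
  have h3 := prob_add_prob_compl (μ := gaussianLaw E N) hm
  have h4 : {t : E | ‖t‖ ^ 2 < 5 / 4 * finrank ℝ E / N}ᶜ =
      {t | 5 / 4 * finrank ℝ E / N ≤ ‖t‖ ^ 2} := by
    ext t; simp
  rw [h4] at h3
  set A := gaussianLaw E N {t : E | ‖t‖ ^ 2 < 5 / 4 * finrank ℝ E / N}
  set B := gaussianLaw E N {t : E | 5 / 4 * finrank ℝ E / N ≤ ‖t‖ ^ 2}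
  have hA : A ≠ ⊤ := measure_ne_top _ _
  have hB : B ≠ ⊤ := measure_ne_top _ _
  have h5 : A.toReal + B.toReal = 1 := by
    rw [← ENNReal.toReal_add hA hB, h3]; rfl
  have h6 : B.toReal ≤ 99 / 100 := ENNReal.toReal_le_of_le_ofReal (by norm_num) h2
  rw [← ENNReal.ofReal_toReal hA, ← ENNReal.ofReal_one,
    show (100 : ENNReal) = ENNReal.ofReal 100 by simp, ← ENNReal.ofReal_mul (by norm_num)]
  apply ENNReal.ofReal_le_ofReal
  linarith

end Gaussian

/-! ### Rotations of pairs and a Poincaré inequality for odd functions -/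

section Rotation

open Module

variable {E : Type*} [NormedAddCommGroup E] [InnerProductSpace ℝ E]

/-- The rotation by the angle `θ` of pairs of vectors. -/
noncomputable def rot (θ : ℝ) (p : E × E) : E × E :=
  (Real.cos θ • p.1 + Real.sin θ • p.2, -Real.sin θ • p.1 + Real.cos θ • p.2)

lemma norm_sq_rot (θ : ℝ) (p : E × E) :
    ‖(rot θ p).1‖ ^ 2 + ‖(rot θ p).2‖ ^ 2 = ‖p.1‖ ^ 2 + ‖p.2‖ ^ 2 := by
  simp only [rot, norm_add_sq_real, norm_smul, mul_pow, Real.norm_eq_abs, sq_abs, abs_neg,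
    real_inner_smul_left, real_inner_smul_right]
  linear_combination (‖p.1‖ ^ 2 + ‖p.2‖ ^ 2) * Real.sin_sq_add_cos_sq θ

lemma rot_add (θ : ℝ) (p q : E × E) : rot θ (p + q) = rot θ p + rot θ q := by
  simp only [rot, Prod.fst_add, Prod.snd_add, smul_add, Prod.mk_add_mk, Prod.mk.injEq]
  constructor <;> abel

lemma rot_smul (θ c : ℝ) (p : E × E) : rot θ (c • p) = c • rot θ p := by
  simp only [rot, Prod.smul_fst, Prod.smul_snd, Prod.smul_mk, smul_add, smul_comm c]

lemma continuous_rot : Continuous fun q : ℝ × (E × E) => rot q.1 q.2 := by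
  unfold rot; fun_prop

lemma hasDerivAt_rot_fst (p : E × E) (θ : ℝ) :
    HasDerivAt (fun θ => (rot θ p).1) (rot θ p).2 θ := by
  unfold rot
  exact ((Real.hasDerivAt_cos θ).smul_const p.1).add ((Real.hasDerivAt_sin θ).smul_const p.2)

variable [FiniteDimensional ℝ E] [MeasurableSpace E] [BorelSpace E]

/-- Rotations preserve the product volume, being isometries of the `L²` product. -/
lemma measurePreserving_rot (θ : ℝ) :
    MeasurePreserving (rot θ : E × E → E × E) := by
  let l : WithLp 2 (E × E) →ₗᵢ[ℝ] WithLp 2 (E × E) :=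
    { toFun := fun p => WithLp.toLp 2 (rot θ (WithLp.ofLp p))
      map_add' := fun p q => congrArg (WithLp.toLp 2) (rot_add θ (WithLp.ofLp p) (WithLp.ofLp q))
      map_smul' := fun c p => congrArg (WithLp.toLp 2) (rot_smul θ c (WithLp.ofLp p))
      norm_map' := fun p => by
        have h : ‖WithLp.toLp 2 (rot θ (WithLp.ofLp p))‖ ^ 2 = ‖p‖ ^ 2 := by
          rw [WithLp.prod_norm_sq_eq_of_L2, WithLp.prod_norm_sq_eq_of_L2]
          exact norm_sq_rot θ _
        exact (pow_left_inj₀ (norm_nonneg _) (norm_nonneg _) two_ne_zero).mp h }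
  have h := (l.toLinearIsometryEquiv rfl).measurePreserving
  exact (WithLp.volume_preserving_ofLp E E).comp (h.comp (WithLp.volume_preserving_toLp E E))

lemma lintegral_gaussianLaw_prod_rot {N : ℝ} (hN : 0 < N) (θ : ℝ) {F : E × E → ENNReal}
    (hF : Measurable F) :
    ∫⁻ p, F (rot θ p) ∂((gaussianLaw E N).prod (gaussianLaw E N)) =
      ∫⁻ p, F p ∂((gaussianLaw E N).prod (gaussianLaw E N)) := by
  have hw : Measurable fun t : E => ENNReal.ofReal (gaussianWeight N t) :=
    (continuous_gaussianWeight N).measurable.ennreal_ofReal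
  have hw2 : Measurable fun p : E × E => ENNReal.ofReal (gaussianWeight N p.1) *
      ENNReal.ofReal (gaussianWeight N p.2) :=
    (hw.comp measurable_fst).mul (hw.comp measurable_snd)
  have hinv : ∀ p : E × E, ENNReal.ofReal (gaussianWeight N p.1) *
      ENNReal.ofReal (gaussianWeight N p.2) = ENNReal.ofReal (gaussianWeight N (rot θ p).1) *
      ENNReal.ofReal (gaussianWeight N (rot θ p).2) := by
    intro p
    rw [← ENNReal.ofReal_mul (gaussianWeight_nonneg hN _),
      ← ENNReal.ofReal_mul (gaussianWeight_nonneg hN _)]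
    simp only [gaussianWeight]
    rw [mul_mul_mul_comm, mul_mul_mul_comm _ (Real.exp _), ← Real.exp_add, ← Real.exp_add,
      ← mul_add, ← mul_add, norm_sq_rot]
  have hrot : Measurable (rot θ : E × E → E × E) := (measurePreserving_rot θ).measurable
  unfold gaussianLaw
  have h1 := lintegral_withDensity_eq_lintegral_mul (volume.prod volume) hw2 (hF.comp hrot)
  simp only [Function.comp_apply] at h1
  rw [prod_withDensity hw hw, h1, lintegral_withDensity_eq_lintegral_mul _ hw2 hF]
  simp only [Pi.mul_apply, Function.comp_apply]
  rw [lintegral_congr fun p => congrArg (· * F (rot θ p)) (hinv p)]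
  exact (measurePreserving_rot θ).lintegral_comp (hw2.mul hF)

end Rotation

section Poincare

open Module

lemma sq_intervalIntegral_le {a b : ℝ} (hab : a < b) {h : ℝ → ℝ} (hh : Continuous h) :
    (∫ θ in a..b, h θ) ^ 2 ≤ (b - a) * ∫ θ in a..b, h θ ^ 2 := by
  set m := (∫ θ in a..b, h θ) / (b - a) with hm
  have hba : 0 < b - a := by linarith
  have h1 : 0 ≤ ∫ θ in a..b, (h θ - m) ^ 2 :=
    intervalIntegral.integral_nonneg hab.le fun θ _ => sq_nonneg _
  have h2 : ∫ θ in a..b, (h θ - m) ^ 2 =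
      (∫ θ in a..b, h θ ^ 2) - (2 * m) * (∫ θ in a..b, h θ) + (b - a) * m ^ 2 := by
    have : ∀ θ, (h θ - m) ^ 2 = h θ ^ 2 - 2 * m * h θ + m ^ 2 := fun θ => by ring
    simp_rw [this]
    rw [intervalIntegral.integral_add, intervalIntegral.integral_sub,
      intervalIntegral.integral_const_mul, intervalIntegral.integral_const, smul_eq_mul]
    all_goals exact Continuous.intervalIntegrable (by fun_prop) _ _
  have h3 : ∫ θ in a..b, h θ = (b - a) * m := by rw [hm]; field_simp
  rw [h2, h3] at h1
  rw [h3]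
  nlinarith

variable {E : Type*} [NormedAddCommGroup E] [InnerProductSpace ℝ E]

/-- If `v` takes opposite values at the end points of a path, then the integral of its derivative
along the path is twice a value of `v`; conclude by the Cauchy-Schwarz inequality. -/
lemma sq_le_integral_fderiv_of_path {U : Set E} (hU : IsOpen U) {v : E → ℝ}
    (hv : ContDiffOn ℝ 1 v U) {c c' : ℝ → E} (hc : ∀ θ, HasDerivAt c (c' θ) θ)
    (hc' : Continuous c') (hmem : ∀ θ, c θ ∈ U) (hend : v (c Real.pi) = -v (c 0)) :
    ENNReal.ofReal (v (c 0) ^ 2) ≤ ENNReal.ofReal (Real.pi / 4) *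
      ∫⁻ θ in Set.Ioc 0 Real.pi, ENNReal.ofReal (fderiv ℝ v (c θ) (c' θ) ^ 2) := by
  have hcc : Continuous c := continuous_iff_continuousAt.mpr fun θ => (hc θ).continuousAt
  have hdc : ContinuousOn (fderiv ℝ v) U := hv.continuousOn_fderiv_of_isOpen hU le_rfl
  have hhc : Continuous fun θ => fderiv ℝ v (c θ) (c' θ) :=
    (hdc.comp_continuous hcc hmem).clm_apply hc'
  have hderiv : ∀ θ, HasDerivAt (fun θ => v (c θ)) (fderiv ℝ v (c θ) (c' θ)) θ := by
    intro θ
    have h1 : HasFDerivAt v (fderiv ℝ v (c θ)) (c θ) :=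
      ((hv.contDiffAt (hU.mem_nhds (hmem θ))).differentiableAt one_ne_zero).hasFDerivAt
    exact h1.comp_hasDerivAt θ (hc θ)
  have hint : ∫ θ in (0 : ℝ)..Real.pi, fderiv ℝ v (c θ) (c' θ) = v (c Real.pi) - v (c 0) :=
    intervalIntegral.integral_eq_sub_of_hasDerivAt (fun θ _ => hderiv θ)
      (hhc.intervalIntegrable _ _)
  rw [hend] at hint
  have h4 := sq_intervalIntegral_le Real.pi_pos hhc
  rw [hint] at h4
  have h5 : v (c 0) ^ 2 ≤ Real.pi / 4 * ∫ θ in (0 : ℝ)..Real.pi, fderiv ℝ v (c θ) (c' θ) ^ 2 := by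
    have h6 : (-v (c 0) - v (c 0)) ^ 2 = 4 * v (c 0) ^ 2 := by ring
    linarith
  refine (ENNReal.ofReal_le_ofReal h5).trans ?_
  rw [ENNReal.ofReal_mul (by positivity), intervalIntegral.integral_of_le Real.pi_pos.le,
    ofReal_integral_eq_lintegral_ofReal]
  · exact ((hhc.pow 2).integrableOn_Ioc)
  · exact Filter.Eventually.of_forall fun θ => sq_nonneg _

/-- An odd function is controlled by its derivative along the half circle from `p.1` to `-p.1`
through `p.2`. -/
lemma sq_le_integral_fderiv_rot {R : ℝ} (hR : 0 < R) {v : E → ℝ}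
    (hv : ContDiffOn ℝ 1 v (Metric.ball 0 R))
    (hodd : ∀ t ∈ Metric.ball (0 : E) R, v (-t) = -v t) {p : E × E}
    (hp : ‖p.1‖ ^ 2 + ‖p.2‖ ^ 2 < R ^ 2) :
    ENNReal.ofReal (v p.1 ^ 2) ≤ ENNReal.ofReal (Real.pi / 4) *
      ∫⁻ θ in Set.Ioc 0 Real.pi, ENNReal.ofReal (fderiv ℝ v (rot θ p).1 (rot θ p).2 ^ 2) := by
  have hmem : ∀ θ, (rot θ p).1 ∈ Metric.ball (0 : E) R := by
    intro θ
    rw [mem_ball_zero_iff]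
    refine lt_of_pow_lt_pow_left₀ 2 hR.le ?_
    have h1 := norm_sq_rot θ p
    have h2 := sq_nonneg ‖(rot θ p).2‖
    linarith
  have h0 : (rot 0 p).1 = p.1 := by simp [rot]
  have hpi : (rot Real.pi p).1 = -p.1 := by simp [rot]
  have hrc : Continuous fun θ => rot θ p :=
    continuous_rot.comp (continuous_id.prodMk continuous_const)
  have hend : v (rot Real.pi p).1 = -v (rot 0 p).1 := by
    have h3 := hmem 0
    rw [h0] at h3
    rw [hpi, h0, hodd _ h3]
  have h := sq_le_integral_fderiv_of_path Metric.isOpen_ball hv (hasDerivAt_rot_fst p) hrc.snd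
    hmem hend
  rwa [h0] at h

variable [FiniteDimensional ℝ E] [MeasurableSpace E] [BorelSpace E]

lemma measurable_fderiv_uncurry (v : E → ℝ) :
    Measurable fun p : E × E => fderiv ℝ v p.1 p.2 := by
  have h1 : Measurable fun p : E × E => fderiv ℝ v p.1 := (measurable_fderiv ℝ v).comp measurable_fst
  exact isBoundedBilinearMap_apply.continuous.measurable.comp (h1.prodMk measurable_snd)

/-- A Poincaré inequality for odd functions that are only defined on a ball. The set of pairs is
rotation invariant and all rotated pairs have their first component in the ball. -/
lemma lintegral_sq_le_lintegral_fderiv_sq {N : ℝ} (hN : 0 < N) {R : ℝ} (hR : 0 < R) {v : E → ℝ}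
    (hv : ContDiffOn ℝ 1 v (Metric.ball 0 R))
    (hodd : ∀ t ∈ Metric.ball (0 : E) R, v (-t) = -v t) :
    ∫⁻ p in {p : E × E | ‖p.1‖ ^ 2 + ‖p.2‖ ^ 2 < R ^ 2}, ENNReal.ofReal (v p.1 ^ 2)
        ∂((gaussianLaw E N).prod (gaussianLaw E N)) ≤
      ENNReal.ofReal (Real.pi ^ 2 / 4) *
        ∫⁻ p in {p : E × E | ‖p.1‖ ^ 2 + ‖p.2‖ ^ 2 < R ^ 2}, ENNReal.ofReal (fderiv ℝ v p.1 p.2 ^ 2)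
        ∂((gaussianLaw E N).prod (gaussianLaw E N)) := by
  have := isProbabilityMeasure_gaussianLaw (E := E) hN
  set G : Set (E × E) := {p : E × E | ‖p.1‖ ^ 2 + ‖p.2‖ ^ 2 < R ^ 2} with hG
  have hGm : MeasurableSet G := measurableSet_lt (by fun_prop) (by fun_prop)
  set Φ : E × E → ENNReal := G.indicator fun p => ENNReal.ofReal (fderiv ℝ v p.1 p.2 ^ 2) with hΦ
  have hΦm : Measurable Φ :=
    (((measurable_fderiv_uncurry v).pow_const 2).ennreal_ofReal).indicator hGm
  rw [← lintegral_indicator hGm, ← lintegral_indicator hGm]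
  have hpt : ∀ p : E × E, G.indicator (fun p => ENNReal.ofReal (v p.1 ^ 2)) p ≤
      ENNReal.ofReal (Real.pi / 4) * ∫⁻ θ in Set.Ioc 0 Real.pi, Φ (rot θ p) := by
    intro p
    by_cases hp : p ∈ G
    · rw [Set.indicator_of_mem hp]
      refine (sq_le_integral_fderiv_rot hR hv hodd hp).trans (le_of_eq ?_)
      congr 1
      refine lintegral_congr fun θ => ?_
      have : rot θ p ∈ G := by
        simp only [hG, Set.mem_ofPred_eq]; rw [norm_sq_rot]; exact hp
      rw [hΦ, Set.indicator_of_mem this]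
    · rw [Set.indicator_of_notMem hp]; exact zero_le
  refine (lintegral_mono hpt).trans ?_
  have hjm : Measurable fun q : (E × E) × ℝ => Φ (rot q.2 q.1) :=
    hΦm.comp (continuous_rot.comp (by fun_prop : Continuous fun q : (E × E) × ℝ => (q.2, q.1))).measurable
  rw [lintegral_const_mul' _ _ ENNReal.ofReal_ne_top, lintegral_lintegral_swap hjm.aemeasurable]
  simp_rw [lintegral_gaussianLaw_prod_rot hN _ hΦm]
  rw [lintegral_const, Measure.restrict_apply_univ, Real.volume_Ioc, mul_comm (lintegral _ _),
    ← mul_assoc, ← ENNReal.ofReal_mul (by positivity)]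
  apply le_of_eq
  congr 2
  ring

lemma lintegral_gaussianLaw_dual_sq_le {N : ℝ} (hN : 0 < N) (l : E →L[ℝ] ℝ) :
    ∫⁻ t, ENNReal.ofReal (l t ^ 2) ∂(gaussianLaw E N) ≤ ENNReal.ofReal (8 * ‖l‖ ^ 2 / N) := by
  have h := lintegral_gaussianLaw_inner_sq_le hN ((InnerProductSpace.toDual ℝ E).symm l)
  simpa using h

/-- The second moment, on the bulk of the Gaussian law, of an odd function with quadratically
bounded derivative. The point is the power `d²` of the dimension; the bound `|v t| ≤ c ‖t‖³` alone
gives `d³`. -/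
lemma lintegral_sq_le_of_odd {N : ℝ} (hN : 0 < N) (hd : 1 ≤ finrank ℝ E) {R c : ℝ} (hR : 0 < R)
    (hRN : R ^ 2 = 25 / 4 * finrank ℝ E / N) {v : E → ℝ}
    (hv : ContDiffOn ℝ 1 v (Metric.ball 0 R)) (hvm : Measurable v)
    (hodd : ∀ t ∈ Metric.ball (0 : E) R, v (-t) = -v t)
    (hbd : ∀ t ∈ Metric.ball (0 : E) R, ‖fderiv ℝ v t‖ ≤ c * ‖t‖ ^ 2) :
    ∫⁻ t in {t | ‖t‖ ^ 2 < 5 * finrank ℝ E / N}, ENNReal.ofReal (v t ^ 2) ∂(gaussianLaw E N) ≤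
      ENNReal.ofReal (128000 * c ^ 2 * (finrank ℝ E : ℝ) ^ 2 / N ^ 3) := by
  have := isProbabilityMeasure_gaussianLaw (E := E) hN
  set γ := gaussianLaw E N with hγ
  set d : ℝ := (finrank ℝ E : ℝ) with hdd
  set B : Set E := {t | ‖t‖ ^ 2 < 5 * d / N} with hB
  set B' : Set E := {t | ‖t‖ ^ 2 < 5 / 4 * d / N} with hB'
  set G : Set (E × E) := {p : E × E | ‖p.1‖ ^ 2 + ‖p.2‖ ^ 2 < R ^ 2} with hG
  have hGm : MeasurableSet G := measurableSet_lt (by fun_prop) (by fun_prop)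
  have hBm : MeasurableSet B := measurableSet_lt (by fun_prop) (by fun_prop)
  have hsub : B ×ˢ B' ⊆ G := by
    rintro ⟨x, y⟩ ⟨hx, hy⟩
    simp only [hB, hB', hG, Set.mem_ofPred_eq] at hx hy ⊢
    rw [hRN]
    calc ‖x‖ ^ 2 + ‖y‖ ^ 2 < 5 * d / N + 5 / 4 * d / N := add_lt_add hx hy
      _ = _ := by ring
  have hvm2 : Measurable fun t : E => ENNReal.ofReal (v t ^ 2) := (hvm.pow_const 2).ennreal_ofReal
  -- a second independent component of norm at most `√(5 d / (4 N))` keeps the pair in `G`, as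
  -- `5 + 5 / 4 = 25 / 4`
  have h1 : ∫⁻ t in B, ENNReal.ofReal (v t ^ 2) ∂γ ≤
      100 * ∫⁻ p in G, ENNReal.ofReal (v p.1 ^ 2) ∂(γ.prod γ) := by
    calc ∫⁻ t in B, ENNReal.ofReal (v t ^ 2) ∂γ
        ≤ (∫⁻ t in B, ENNReal.ofReal (v t ^ 2) ∂γ) * (100 * γ B') := by
          conv_lhs => rw [← mul_one (∫⁻ t in B, ENNReal.ofReal (v t ^ 2) ∂γ)]
          exact mul_le_mul_right (one_le_gaussianLaw_norm_sq_lt hN hd) _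
      _ = 100 * ∫⁻ p in B ×ˢ B', ENNReal.ofReal (v p.1 ^ 2) ∂(γ.prod γ) := by
          rw [← Measure.prod_restrict]
          have h := lintegral_prod_mul (μ := γ.restrict B) (ν := γ.restrict B')
            (f := fun t : E => ENNReal.ofReal (v t ^ 2)) (g := fun _ => 1)
            hvm2.aemeasurable aemeasurable_const
          simp only [mul_one, lintegral_one, Measure.restrict_apply_univ] at h
          rw [h]; ring
      _ ≤ _ := mul_le_mul_right (lintegral_mono_set hsub) _
  -- integrating the second component first costs no factor of the dimension
  have h2 : ∫⁻ p in G, ENNReal.ofReal (fderiv ℝ v p.1 p.2 ^ 2) ∂(γ.prod γ) ≤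
      ENNReal.ofReal (8 * c ^ 2 / N) * ENNReal.ofReal (64 * d ^ 2 / N ^ 2) := by
    have hsub2 : G ⊆ Metric.ball 0 R ×ˢ Set.univ := by
      rintro ⟨x, y⟩ hx
      refine ⟨?_, trivial⟩
      simp only [hG, Set.mem_ofPred_eq] at hx
      rw [mem_ball_zero_iff]
      exact lt_of_pow_lt_pow_left₀ 2 hR.le (by nlinarith [sq_nonneg ‖y‖])
    refine (lintegral_mono_set hsub2).trans ?_
    rw [← Measure.prod_restrict, Measure.restrict_univ, lintegral_prod _
      ((measurable_fderiv_uncurry v).pow_const 2).ennreal_ofReal.aemeasurable]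
    calc ∫⁻ x in Metric.ball 0 R, ∫⁻ y, ENNReal.ofReal (fderiv ℝ v x y ^ 2) ∂γ ∂γ
        ≤ ∫⁻ x in Metric.ball 0 R, ENNReal.ofReal (8 * c ^ 2 / N) * ENNReal.ofReal (‖x‖ ^ 4) ∂γ := by
          refine setLIntegral_mono (by fun_prop) fun x hx => ?_
          refine (lintegral_gaussianLaw_dual_sq_le hN _).trans ?_
          rw [← ENNReal.ofReal_mul (by positivity)]
          apply ENNReal.ofReal_le_ofReal
          have h3 : ‖fderiv ℝ v x‖ ^ 2 ≤ (c * ‖x‖ ^ 2) ^ 2 :=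
            pow_le_pow_left₀ (norm_nonneg _) (hbd x hx) 2
          calc 8 * ‖fderiv ℝ v x‖ ^ 2 / N ≤ 8 * (c * ‖x‖ ^ 2) ^ 2 / N := by gcongr
            _ = _ := by ring
      _ ≤ ∫⁻ x, ENNReal.ofReal (8 * c ^ 2 / N) * ENNReal.ofReal (‖x‖ ^ 4) ∂γ :=
          lintegral_mono' Measure.restrict_le_self le_rfl
      _ ≤ _ := by
          rw [lintegral_const_mul _ (by fun_prop)]
          exact mul_le_mul_right (lintegral_gaussianLaw_norm_pow_four_le hN hd) _
  refine h1.trans ?_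
  refine (mul_le_mul_right ((lintegral_sq_le_lintegral_fderiv_sq hN hR hv hodd).trans
    (mul_le_mul_right h2 _)) _).trans ?_
  rw [← ENNReal.ofReal_mul (by positivity), ← ENNReal.ofReal_mul (by positivity),
    show (100 : ENNReal) = ENNReal.ofReal 100 by simp, ← ENNReal.ofReal_mul (by norm_num)]
  apply ENNReal.ofReal_le_ofReal
  have hpi : Real.pi ^ 2 ≤ 10 := by nlinarith [Real.pi_lt_d2, Real.pi_pos]
  calc 100 * (Real.pi ^ 2 / 4 * (8 * c ^ 2 / N * (64 * d ^ 2 / N ^ 2)))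
      = 12800 * Real.pi ^ 2 * (c ^ 2 * d ^ 2 / N ^ 3) := by field_simp; ring
    _ ≤ 12800 * 10 * (c ^ 2 * d ^ 2 / N ^ 3) := by gcongr
    _ = _ := by ring

end Poincare

/-! ### Gamma function bounds and tails of radial integrals -/

section GammaBounds

lemma integrableOn_rpow_mul_exp_neg_mul {a r : ℝ} (ha : 0 < a) (hr : 0 < r) :
    IntegrableOn (fun t : ℝ => t ^ (a - 1) * Real.exp (-(r * t))) (Set.Ioi 0) := by
  have h := Real.integral_rpow_mul_exp_neg_mul_Ioi ha hr
  by_contra hcon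
  rw [integral_undef hcon] at h
  have : 0 < (1 / r) ^ a * Real.Gamma a := by have := Real.Gamma_pos_of_pos ha; positivity
  linarith

lemma lintegral_rpow_mul_exp_neg_mul {a r : ℝ} (ha : 0 < a) (hr : 0 < r) :
    ∫⁻ t in Set.Ioi (0 : ℝ), ENNReal.ofReal (t ^ (a - 1) * Real.exp (-(r * t))) =
      ENNReal.ofReal ((1 / r) ^ a * Real.Gamma a) := by
  rw [← Real.integral_rpow_mul_exp_neg_mul_Ioi ha hr, ofReal_integral_eq_lintegral_ofReal]
  · exact integrableOn_rpow_mul_exp_neg_mul ha hr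
  · filter_upwards [ae_restrict_mem measurableSet_Ioi] with t ht
    have : (0 : ℝ) < t := ht
    positivity

/-- A form of Stirling's upper bound with the correct rate up to the factor `(10 / 9) ^ x`; it comes
from bounding `u ^ x * exp (-(9 / 10) * u)` by its maximum. -/
lemma Gamma_add_half_le {x : ℝ} (hx : 0 < x) :
    Real.Gamma (x + 1 / 2) ≤ 4 * Real.sqrt Real.pi * (10 / 9 * x / Real.exp 1) ^ x := by
  rw [Real.Gamma_eq_integral (by positivity)]
  have hint := integrableOn_rpow_mul_exp_neg_mul (a := 1 / 2) (r := 1 / 10) (by norm_num)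
    (by norm_num)
  calc ∫ u in Set.Ioi (0 : ℝ), Real.exp (-u) * u ^ (x + 1 / 2 - 1)
      ≤ ∫ u in Set.Ioi (0 : ℝ), (10 / 9 * x / Real.exp 1) ^ x *
          (u ^ ((1 : ℝ) / 2 - 1) * Real.exp (-(1 / 10 * u))) := by
        refine setIntegral_mono_on (Real.GammaIntegral_convergent (by positivity))
          (hint.const_mul _) measurableSet_Ioi fun u hu => ?_
        have hu0 : (0 : ℝ) < u := hu
        have h1 : 9 / 10 * u / x ≤ Real.exp (9 / 10 * u / x - 1) := by
          have := Real.add_one_le_exp (9 / 10 * u / x - 1); linarith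
        have h2 : u ≤ (10 / 9 * x / Real.exp 1) * Real.exp (9 / 10 * u / x) := by
          rw [Real.exp_sub] at h1
          rw [div_le_iff₀ hx] at h1
          calc u = 10 / 9 * (9 / 10 * u) := by ring
            _ ≤ 10 / 9 * (Real.exp (9 / 10 * u / x) / Real.exp 1 * x) := by gcongr
            _ = _ := by ring
        have h3 : u ^ x ≤ (10 / 9 * x / Real.exp 1) ^ x * Real.exp (9 / 10 * u) := by
          calc u ^ x ≤ ((10 / 9 * x / Real.exp 1) * Real.exp (9 / 10 * u / x)) ^ x :=
                Real.rpow_le_rpow hu0.le h2 hx.le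
            _ = _ := by
                rw [Real.mul_rpow (by positivity) (by positivity), ← Real.exp_mul]
                congr 2; field_simp
        have h4 : u ^ (x + 1 / 2 - 1) = u ^ x * u ^ ((1 : ℝ) / 2 - 1) := by
          rw [← Real.rpow_add hu0]; ring_nf
        rw [h4]
        calc Real.exp (-u) * (u ^ x * u ^ ((1 : ℝ) / 2 - 1))
            ≤ Real.exp (-u) * (((10 / 9 * x / Real.exp 1) ^ x * Real.exp (9 / 10 * u)) *
                u ^ ((1 : ℝ) / 2 - 1)) := by gcongr
          _ = (10 / 9 * x / Real.exp 1) ^ x * (u ^ ((1 : ℝ) / 2 - 1) *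
                (Real.exp (-u) * Real.exp (9 / 10 * u))) := by ring
          _ = _ := by rw [← Real.exp_add]; ring_nf
    _ = (10 / 9 * x / Real.exp 1) ^ x * (Real.sqrt 10 * Real.sqrt Real.pi) := by
        rw [integral_const_mul, Real.integral_rpow_mul_exp_neg_mul_Ioi (by norm_num) (by norm_num),
          Real.Gamma_one_half_eq, ← Real.sqrt_eq_rpow]
        norm_num
    _ ≤ (10 / 9 * x / Real.exp 1) ^ x * (4 * Real.sqrt Real.pi) := by
        have : Real.sqrt 10 ≤ 4 := Real.sqrt_le_iff.mpr ⟨by norm_num, by norm_num⟩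
        gcongr
    _ = _ := by ring

lemma rpow_mul_four (p : ℝ) {a b c e : ℝ} (ha : 0 ≤ a) (hb : 0 ≤ b) (hc : 0 ≤ c) (he : 0 ≤ e) :
    a ^ p * (e ^ p * (4 * b ^ p * c ^ p)) = 4 * (a * (e * (b * c))) ^ p := by
  rw [Real.mul_rpow ha (by positivity), Real.mul_rpow he (by positivity), Real.mul_rpow hb hc]
  ring

lemma pow_mul_Gamma_le {x : ℝ} (hx : 0 < x) (k : ℕ) :
    x ^ k * Real.Gamma x ≤ Real.Gamma (x + k) := by
  induction k with
  | zero => simp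
  | succ k ih =>
    have h0 : 0 < x + k := by positivity
    rw [Nat.cast_succ, ← add_assoc, Real.Gamma_add_one h0.ne']
    calc x ^ (k + 1) * Real.Gamma x = x * (x ^ k * Real.Gamma x) := by ring
      _ ≤ (x + k) * Real.Gamma (x + k) := by
          have : 0 ≤ x ^ k * Real.Gamma x := by have := Real.Gamma_pos_of_pos hx; positivity
          gcongr
          simp

/-- The integral of `exp (-‖t‖)` over `d`-dimensional Euclidean space, as the volume of the unit ball
times `d!`. -/
noncomputable def expNormMass (d : ℕ) : ℝ :=
  Real.sqrt Real.pi ^ d / Real.Gamma (d / 2 + 1) * d.factorial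

lemma expNormMass_pos (d : ℕ) : 0 < expNormMass d := by
  have : 0 < Real.Gamma ((d : ℝ) / 2 + 1) := Real.Gamma_pos_of_pos (by positivity)
  unfold expNormMass; positivity

lemma expNormMass_le {d : ℕ} (hd : 1 ≤ d) :
    expNormMass d ≤ 4 * (2 * Real.pi * (10 / 9 * d / Real.exp 1)) ^ ((d : ℝ) / 2) := by
  have hd0 : (0 : ℝ) < d := by exact_mod_cast hd
  set x : ℝ := (d : ℝ) / 2 with hx
  have hx0 : 0 < x := by positivity
  have hΓ : 0 < Real.Gamma (x + 1) := Real.Gamma_pos_of_pos (by positivity)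
  have hπ : 0 < Real.sqrt Real.pi := Real.sqrt_pos.mpr Real.pi_pos
  -- the duplication formula at `(d + 1) / 2`
  have h1 : (d.factorial : ℝ) / Real.Gamma (x + 1) =
      2 ^ (d : ℝ) * Real.Gamma (x + 1 / 2) / Real.sqrt Real.pi := by
    have h := Real.Gamma_mul_Gamma_add_half (x + 1 / 2)
    rw [show x + 1 / 2 + 1 / 2 = x + 1 by ring, show 2 * (x + 1 / 2) = (d : ℝ) + 1 by rw [hx]; ring,
      Real.Gamma_nat_eq_factorial, show (1 : ℝ) - (d + 1) = -d by ring,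
      Real.rpow_neg (by norm_num)] at h
    rw [div_eq_div_iff hΓ.ne' hπ.ne', mul_assoc, h]
    field_simp
  have h2 : expNormMass d = Real.pi ^ x * (2 ^ (d : ℝ) * Real.Gamma (x + 1 / 2) / Real.sqrt Real.pi) := by
    rw [← h1, expNormMass, Real.sqrt_eq_rpow, ← Real.rpow_mul_natCast Real.pi_pos.le]
    rw [show (1 : ℝ) / 2 * d = x by rw [hx]; ring, ← hx]
    ring
  rw [h2]
  calc Real.pi ^ x * (2 ^ (d : ℝ) * Real.Gamma (x + 1 / 2) / Real.sqrt Real.pi)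
      ≤ Real.pi ^ x * (2 ^ (d : ℝ) * (4 * Real.sqrt Real.pi * (10 / 9 * x / Real.exp 1) ^ x) /
          Real.sqrt Real.pi) := by
        gcongr; exact Gamma_add_half_le hx0
    _ = 4 * (Real.pi ^ x * (4 ^ x * (10 / 9 * x / Real.exp 1) ^ x)) := by
        have : (2 : ℝ) ^ (d : ℝ) = 4 ^ x := by
          rw [show (4 : ℝ) = 2 ^ (2 : ℝ) by norm_num, ← Real.rpow_mul (by norm_num), hx]
          ring_nf
        rw [this]; field_simp
    _ = _ := by
        rw [← Real.mul_rpow (by norm_num) (by positivity),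
          ← Real.mul_rpow (by positivity) (by positivity)]
        congr 2
        rw [hx]; ring

end GammaBounds

section Radial

open Module

variable {E : Type*} [NormedAddCommGroup E] [InnerProductSpace ℝ E] [FiniteDimensional ℝ E]
  [MeasurableSpace E] [BorelSpace E]

lemma lintegral_exp_neg_mul_norm (hd : 1 ≤ finrank ℝ E) {c : ℝ} (hc : 0 < c) :
    ∫⁻ t : E, ENNReal.ofReal (Real.exp (-(c * ‖t‖))) =
      ENNReal.ofReal (expNormMass (finrank ℝ E) * (1 / c) ^ finrank ℝ E) := by
  have hnt : Nontrivial E := Module.nontrivial_of_finrank_pos (R := ℝ) (by omega)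
  have h := integral_fun_norm_addHaar (volume : Measure E) fun y => Real.exp (-(c * y))
  have hΓ : 0 < Real.Gamma ((finrank ℝ E : ℝ) / 2 + 1) := Real.Gamma_pos_of_pos (by positivity)
  have hball : (volume : Measure E).real (Metric.ball 0 1) =
      Real.sqrt Real.pi ^ finrank ℝ E / Real.Gamma (finrank ℝ E / 2 + 1) := by
    rw [Measure.real, InnerProductSpace.volume_ball]
    simp only [ENNReal.ofReal_one, one_pow, one_mul]
    exact ENNReal.toReal_ofReal (by positivity)
  have hrad : ∫ y in Set.Ioi (0 : ℝ), y ^ (finrank ℝ E - 1) • Real.exp (-(c * y)) =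
      (1 / c) ^ finrank ℝ E * Real.Gamma (finrank ℝ E) := by
    rw [← Real.rpow_natCast (1 / c), ← Real.integral_rpow_mul_exp_neg_mul_Ioi
      (by exact_mod_cast hd) hc]
    refine setIntegral_congr_fun measurableSet_Ioi fun y _ => ?_
    simp only [smul_eq_mul]
    rw [← Real.rpow_natCast, Nat.cast_sub hd, Nat.cast_one]
  have hval : ∫ t : E, Real.exp (-(c * ‖t‖)) =
      expNormMass (finrank ℝ E) * (1 / c) ^ finrank ℝ E := by
    rw [h, hball, hrad, expNormMass]
    obtain ⟨k, hk⟩ : ∃ k, finrank ℝ E = k + 1 := ⟨finrank ℝ E - 1, by omega⟩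
    rw [hk, Nat.cast_succ, Real.Gamma_nat_eq_factorial, Nat.factorial_succ]
    simp only [smul_eq_mul, nsmul_eq_mul]
    push_cast
    ring
  have hpos : 0 < expNormMass (finrank ℝ E) * (1 / c) ^ finrank ℝ E := by
    have := expNormMass_pos (finrank ℝ E); positivity
  rw [← hval, ofReal_integral_eq_lintegral_ofReal]
  · by_contra hcon
    rw [integral_undef hcon] at hval
    linarith
  · exact Filter.Eventually.of_forall fun t => by positivity

/-- Writing the power `(1 + ‖t‖) ^ (-m)` as a mixture of the functions `exp (-(u * ‖t‖))` reduces
its integral to the previous one. -/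
lemma lintegral_one_add_norm_rpow_le (hd : 1 ≤ finrank ℝ E) {m : ℝ} (hm : (finrank ℝ E : ℝ) < m) :
    ∫⁻ t : E, ENNReal.ofReal ((1 + ‖t‖) ^ (-m)) ≤
      ENNReal.ofReal (expNormMass (finrank ℝ E) / (m - finrank ℝ E) ^ finrank ℝ E) := by
  set d := finrank ℝ E with hdd
  have hm0 : 0 < m := lt_of_le_of_lt (Nat.cast_nonneg d) hm
  have hmd : 0 < m - d := by linarith
  have hΓm : 0 < Real.Gamma m := Real.Gamma_pos_of_pos hm0
  have hA := expNormMass_pos d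
  have hrep : ∀ t : E, ENNReal.ofReal ((1 + ‖t‖) ^ (-m)) = ENNReal.ofReal (1 / Real.Gamma m) *
      ∫⁻ u in Set.Ioi (0 : ℝ), ENNReal.ofReal (u ^ (m - 1) * Real.exp (-((1 + ‖t‖) * u))) := by
    intro t
    rw [lintegral_rpow_mul_exp_neg_mul hm0 (by positivity), ← ENNReal.ofReal_mul (by positivity)]
    congr 1
    rw [Real.rpow_neg (by positivity), one_div (1 + ‖t‖), Real.inv_rpow (by positivity)]
    field_simp
  simp_rw [hrep]
  rw [lintegral_const_mul' _ _ ENNReal.ofReal_ne_top, lintegral_lintegral_swap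
    (Measurable.aemeasurable (by fun_prop))]
  have hin : ∀ u ∈ Set.Ioi (0 : ℝ),
      ∫⁻ t : E, ENNReal.ofReal (u ^ (m - 1) * Real.exp (-((1 + ‖t‖) * u))) =
        ENNReal.ofReal (expNormMass d) *
          ENNReal.ofReal (u ^ ((m - d) - 1) * Real.exp (-(1 * u))) := by
    intro u hu
    have hu0 : (0 : ℝ) < u := hu
    have h1 : ∀ t : E, ENNReal.ofReal (u ^ (m - 1) * Real.exp (-((1 + ‖t‖) * u))) =
        ENNReal.ofReal (u ^ (m - 1) * Real.exp (-u)) * ENNReal.ofReal (Real.exp (-(u * ‖t‖))) := by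
      intro t
      rw [← ENNReal.ofReal_mul (by positivity), mul_assoc, ← Real.exp_add]
      ring_nf
    simp_rw [h1]
    rw [lintegral_const_mul' _ _ ENNReal.ofReal_ne_top, lintegral_exp_neg_mul_norm hd hu0,
      ← ENNReal.ofReal_mul (by positivity), ← ENNReal.ofReal_mul (by positivity), ← hdd]
    congr 1
    rw [show m - d - 1 = (m - 1) - d by ring, Real.rpow_sub hu0 (m - 1) d, Real.rpow_natCast,
      one_div, inv_pow, one_mul]
    ring
  rw [setLIntegral_congr_fun measurableSet_Ioi hin,
    lintegral_const_mul' _ _ ENNReal.ofReal_ne_top, lintegral_rpow_mul_exp_neg_mul hmd one_pos,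
    ← ENNReal.ofReal_mul (by positivity), ← ENNReal.ofReal_mul (by positivity)]
  apply ENNReal.ofReal_le_ofReal
  have h := pow_mul_Gamma_le hmd d
  rw [sub_add_cancel] at h
  rw [div_one, Real.one_rpow, one_mul, div_mul_eq_mul_div, one_mul, div_le_div_iff₀ hΓm (by positivity)]
  nlinarith

/-- The tail of the integral outside of the ball of radius `5 / 2 * (d / N) ^ (1 / 2)`, for the
exponential bound. -/
lemma lintegral_tail_exp_le {N : ℝ} (hN : 0 < N) (hd : 1 ≤ finrank ℝ E) :
    ENNReal.ofReal ((N / (2 * Real.pi)) ^ ((finrank ℝ E : ℝ) / 2)) *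
      ∫⁻ t in {t : E | 5 / 2 * Real.sqrt (finrank ℝ E / N) ≤ ‖t‖},
        ENNReal.ofReal (Real.exp (-(Real.sqrt (finrank ℝ E / N) * ‖t‖ * N))) ≤
      ENNReal.ofReal (4 * Real.exp (-(finrank ℝ E : ℝ))) := by
  set d := finrank ℝ E with hdd
  have hd0 : (0 : ℝ) < d := by exact_mod_cast hd
  set s := Real.sqrt (d / N) with hs
  have hs0 : 0 < s := Real.sqrt_pos.mpr (by positivity)
  have hsN : s ^ 2 * N = d := by rw [hs, Real.sq_sqrt (by positivity)]; field_simp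
  have hA := expNormMass_pos d
  have hpt : ∀ t ∈ {t : E | 5 / 2 * s ≤ ‖t‖}, ENNReal.ofReal (Real.exp (-(s * ‖t‖ * N))) ≤
      ENNReal.ofReal (Real.exp (-(3 / 2 * d))) *
        ENNReal.ofReal (Real.exp (-((2 / 5 * (s * N)) * ‖t‖))) := by
    intro t ht
    rw [← ENNReal.ofReal_mul (by positivity), ← Real.exp_add]
    apply ENNReal.ofReal_le_ofReal
    apply Real.exp_le_exp.mpr
    have h1 : 5 / 2 * s ≤ ‖t‖ := ht
    have h2 : 5 / 2 * s * (s * N) ≤ ‖t‖ * (s * N) := by gcongr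
    nlinarith
  refine (mul_le_mul_right (setLIntegral_mono (by fun_prop) hpt) _).trans ?_
  refine (mul_le_mul_right (lintegral_mono' Measure.restrict_le_self le_rfl) _).trans ?_
  rw [lintegral_const_mul' _ _ ENNReal.ofReal_ne_top,
    lintegral_exp_neg_mul_norm hd (by positivity), ← hdd, ← ENNReal.ofReal_mul (by positivity),
    ← ENNReal.ofReal_mul (by positivity)]
  apply ENNReal.ofReal_le_ofReal
  have hsq : (1 / (2 / 5 * (s * N))) ^ d = (25 / (4 * d * N)) ^ ((d : ℝ) / 2) := by
    rw [show (25 : ℝ) / (4 * d * N) = (1 / (2 / 5 * (s * N))) ^ (2 : ℝ) by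
      rw [← hsN, Real.rpow_two]; field_simp; norm_num, ← Real.rpow_mul (by positivity),
      ← Real.rpow_natCast]
    ring_nf
  have hexp : Real.exp (-(3 / 2 * d)) = Real.exp (-3) ^ ((d : ℝ) / 2) := by
    rw [← Real.exp_mul]; ring_nf
  have hexp2 : Real.exp (-(d : ℝ)) = Real.exp (-2) ^ ((d : ℝ) / 2) := by
    rw [← Real.exp_mul]; ring_nf
  rw [hsq, hexp, hexp2]
  calc (N / (2 * Real.pi)) ^ ((d : ℝ) / 2) * (Real.exp (-3) ^ ((d : ℝ) / 2) *
        (expNormMass d * (25 / (4 * d * N)) ^ ((d : ℝ) / 2)))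
      ≤ (N / (2 * Real.pi)) ^ ((d : ℝ) / 2) * (Real.exp (-3) ^ ((d : ℝ) / 2) *
        ((4 * (2 * Real.pi * (10 / 9 * d / Real.exp 1)) ^ ((d : ℝ) / 2)) *
          (25 / (4 * d * N)) ^ ((d : ℝ) / 2))) := by
        gcongr; exact expNormMass_le hd
    _ = 4 * ((N / (2 * Real.pi)) * (Real.exp (-3) * ((2 * Real.pi * (10 / 9 * d / Real.exp 1)) *
          (25 / (4 * d * N))))) ^ ((d : ℝ) / 2) := by
        exact rpow_mul_four _ (by positivity) (by positivity) (by positivity) (by positivity)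
    _ ≤ 4 * Real.exp (-2) ^ ((d : ℝ) / 2) := by
        gcongr
        have h1 : N / (2 * Real.pi) * (Real.exp (-3) * ((2 * Real.pi * (10 / 9 * d / Real.exp 1)) *
          (25 / (4 * d * N)))) = 125 / 18 * (Real.exp (-3) / Real.exp 1) := by
          field_simp; norm_num
        rw [h1, ← Real.exp_sub, show (-2 : ℝ) = 2 + (-3 - 1) by norm_num, Real.exp_add]
        gcongr
        have h2 := Real.exp_one_gt_d9
        have h3 : Real.exp 2 = Real.exp 1 ^ 2 := by rw [← Real.exp_nat_mul]; norm_num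
        rw [h3]; nlinarith

/-- The tail of the integral for the polynomial bound. -/
lemma lintegral_tail_pow_le {N κ : ℝ} (hN : 0 < N) (hκ : 0 < κ) (hd : 1 ≤ finrank ℝ E)
    (hε : (finrank ℝ E : ℝ) ^ 2 / N ≤ κ / 4) :
    ENNReal.ofReal ((N / (2 * Real.pi)) ^ ((finrank ℝ E : ℝ) / 2)) *
      ∫⁻ t : E, ENNReal.ofReal ((1 + ‖t‖) ^ (-(κ / Real.sqrt (finrank ℝ E) * N))) ≤
      ENNReal.ofReal (4 * (Real.exp 1 / κ ^ 2 * ((finrank ℝ E : ℝ) ^ 2 / N)) ^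
        ((finrank ℝ E : ℝ) / 2)) := by
  set d := finrank ℝ E with hdd
  have hd1 : (1 : ℝ) ≤ d := by exact_mod_cast hd
  have hd0 : (0 : ℝ) < d := by linarith
  set m := κ / Real.sqrt d * N with hm
  have hsd : 0 < Real.sqrt d := Real.sqrt_pos.mpr hd0
  have hsd2 : Real.sqrt d ^ 2 = d := Real.sq_sqrt hd0.le
  have hm0 : 0 < m := by positivity
  have hdm : (d : ℝ) ≤ m / 4 := by
    have h1 : Real.sqrt d ≤ d := by
      rw [Real.sqrt_le_iff]; exact ⟨hd0.le, by nlinarith⟩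
    rw [div_le_iff₀ hN] at hε
    rw [hm, div_mul_eq_mul_div, div_div, le_div_iff₀ (by positivity)]
    nlinarith
  have hA := expNormMass_pos d
  refine (mul_le_mul_right (lintegral_one_add_norm_rpow_le hd (m := m) (by linarith)) _).trans ?_
  rw [← ENNReal.ofReal_mul (by positivity), ← hdd]
  apply ENNReal.ofReal_le_ofReal
  have hmd : 3 / 4 * m ≤ m - d := by linarith
  have hsq : ((3 / 4 * m) ^ d)⁻¹ = (16 * d / (9 * κ ^ 2 * N ^ 2)) ^ ((d : ℝ) / 2) := by
    rw [show 16 * (d : ℝ) / (9 * κ ^ 2 * N ^ 2) = (3 / 4 * m)⁻¹ ^ (2 : ℝ) by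
      rw [hm, Real.rpow_two]; field_simp; rw [hsd2]; ring, ← Real.rpow_mul (by positivity),
      ← inv_pow, ← Real.rpow_natCast]
    ring_nf
  calc (N / (2 * Real.pi)) ^ ((d : ℝ) / 2) * (expNormMass d / (m - d) ^ d)
      ≤ (N / (2 * Real.pi)) ^ ((d : ℝ) / 2) *
          (4 * (2 * Real.pi * (10 / 9 * d / Real.exp 1)) ^ ((d : ℝ) / 2) / (3 / 4 * m) ^ d) := by
        gcongr
        exact expNormMass_le hd
    _ = 4 * ((N / (2 * Real.pi)) * ((2 * Real.pi * (10 / 9 * d / Real.exp 1)) *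
          (16 * d / (9 * κ ^ 2 * N ^ 2)))) ^ ((d : ℝ) / 2) := by
        rw [div_eq_mul_inv _ ((3 / 4 * m) ^ d), hsq]
        have h := rpow_mul_four ((d : ℝ) / 2) (a := N / (2 * Real.pi)) (e := 1)
          (b := 2 * Real.pi * (10 / 9 * d / Real.exp 1)) (c := 16 * d / (9 * κ ^ 2 * N ^ 2))
          (by positivity) (by positivity) (by positivity) (by positivity)
        simpa only [Real.one_rpow, one_mul] using h
    _ ≤ 4 * (Real.exp 1 / κ ^ 2 * ((d : ℝ) ^ 2 / N)) ^ ((d : ℝ) / 2) := by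
        have h1 : N / (2 * Real.pi) * ((2 * Real.pi * (10 / 9 * d / Real.exp 1)) *
          (16 * d / (9 * κ ^ 2 * N ^ 2))) = 160 / 81 / Real.exp 1 / κ ^ 2 * ((d : ℝ) ^ 2 / N) := by
          field_simp; norm_num
        rw [h1]
        gcongr
        rw [div_le_iff₀ (Real.exp_pos 1)]
        have h2 := Real.exp_one_gt_d9
        nlinarith

end Radial

/-! ### Taylor bounds from parity -/

section Taylor

open Topology

variable {E F : Type*} [NormedAddCommGroup E] [NormedSpace ℝ E]
  [NormedAddCommGroup F] [NormedSpace ℝ F]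

/-- The derivatives at the origin of even functions (`s = 1`) of odd order, and of odd functions
(`s = -1`) of even order, vanish. -/
lemma iteratedFDeriv_zero_eq_of_parity {h : E → F} {s : ℝ} (hs : s = 1 ∨ s = -1)
    (hh : ∀ᶠ t in 𝓝 (0 : E), h (-t) = s • h t) (k : ℕ) (hk : s * (-1) ^ k = -1) :
    iteratedFDeriv ℝ k h 0 = 0 := by
  have hs2 : s * s = 1 := by rcases hs with rfl | rfl <;> norm_num
  let g : E ≃L[ℝ] E := ContinuousLinearEquiv.neg ℝ
  have h1 : (fun t => s • h (g t)) =ᶠ[𝓝 0] h := by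
    filter_upwards [hh] with t ht
    change s • h (-t) = h t
    rw [ht, smul_smul, hs2, one_smul]
  have h2 := (h1.iteratedFDeriv ℝ k).eq_of_nhds
  ext m
  have h3 : iteratedFDeriv ℝ k (fun t => s • h (g t)) 0 m = (s * (-1) ^ k) • iteratedFDeriv ℝ k h 0 m := by
    have h4 : iteratedFDeriv ℝ k (fun t => s • h (g t)) 0 = s • iteratedFDeriv ℝ k (h ∘ g) 0 := by
      rcases hs with rfl | rfl
      · simp only [one_smul]; rfl
      · simp only [neg_smul, one_smul]
        exact iteratedFDeriv_neg_apply (f := h ∘ g)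
    have hcomp : iteratedFDeriv ℝ k (h ∘ g) 0 =
        (iteratedFDeriv ℝ k h (g 0)).compContinuousLinearMap fun _ => g := by
      have h7 := g.iteratedFDerivWithin_comp_right h uniqueDiffOn_univ (x := 0) (by simp) k
      simpa only [Set.preimage_univ, iteratedFDerivWithin_univ] using h7
    rw [h4, hcomp, smul_apply, ContinuousMultilinearMap.compContinuousLinearMap_apply, map_zero]
    have h5 := (iteratedFDeriv ℝ k h 0).map_smul_univ (fun _ => (-1 : ℝ)) m
    rw [Finset.prod_const, Finset.card_univ, Fintype.card_fin] at h5
    rw [mul_smul, ← h5]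
    congr 2
    ext i
    simp [g]
  rw [h2, hk, neg_one_smul] at h3
  have h6 : (2 : ℝ) • iteratedFDeriv ℝ k h 0 m = 0 := by
    rw [two_smul]; nth_rewrite 1 [h3]; simp
  simpa using h6

/-- One step of Taylor's estimate: integrate the next derivative along the segment from `0`. -/
lemma norm_iteratedFDeriv_le_of_succ {R : ℝ} {h : E → F} {n : ℕ}
    (hh : ContDiffOn ℝ n h (Metric.ball 0 R)) {j : ℕ} (hj : j + 1 ≤ n)
    (h0 : iteratedFDeriv ℝ j h 0 = 0) {c : ℝ} (hc : 0 ≤ c) {p : ℕ}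
    (hb : ∀ t ∈ Metric.ball (0 : E) R, ‖iteratedFDeriv ℝ (j + 1) h t‖ ≤ c * ‖t‖ ^ p) :
    ∀ t ∈ Metric.ball (0 : E) R, ‖iteratedFDeriv ℝ j h t‖ ≤ c * ‖t‖ ^ (p + 1) := by
  intro t ht
  rw [mem_ball_zero_iff] at ht
  have hsub : ∀ x ∈ Metric.closedBall (0 : E) ‖t‖, x ∈ Metric.ball (0 : E) R := by
    intro x hx
    rw [mem_closedBall_zero_iff] at hx
    rw [mem_ball_zero_iff]
    linarith
  have h1 := (convex_closedBall (0 : E) ‖t‖).norm_image_sub_le_of_norm_fderiv_le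
    (f := iteratedFDeriv ℝ j h) (C := c * ‖t‖ ^ p) (𝕜 := ℝ) (x := 0) (y := t)
    (fun x hx => (hh.contDiffAt (Metric.isOpen_ball.mem_nhds (hsub x hx))).differentiableAt_iteratedFDeriv
      (by exact_mod_cast hj))
    (fun x hx => by
      rw [norm_fderiv_iteratedFDeriv]
      refine (hb x (hsub x hx)).trans ?_
      rw [mem_closedBall_zero_iff] at hx
      gcongr)
    (by simp) (by simp)
  rw [h0, sub_zero, sub_zero] at h1
  calc _ ≤ _ := h1
    _ = _ := by ring

lemma norm_fderiv_le_of_odd {R : ℝ} (hR : 0 < R) {v : E → F} {c : ℝ} (hc : 0 ≤ c)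
    (hv : ContDiffOn ℝ 3 v (Metric.ball 0 R))
    (hodd : ∀ t ∈ Metric.ball (0 : E) R, v (-t) = -v t) (h0 : fderiv ℝ v 0 = 0)
    (hb : ∀ t ∈ Metric.ball (0 : E) R, ‖iteratedFDeriv ℝ 3 v t‖ ≤ c) :
    ∀ t ∈ Metric.ball (0 : E) R, ‖fderiv ℝ v t‖ ≤ c * ‖t‖ ^ 2 := by
  have hodd' : ∀ᶠ t in 𝓝 (0 : E), v (-t) = (-1 : ℝ) • v t := by
    filter_upwards [Metric.ball_mem_nhds (0 : E) hR] with t ht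
    rw [hodd t ht, neg_one_smul]
  have h1 : iteratedFDeriv ℝ 1 v 0 = 0 := by
    rw [← norm_eq_zero, norm_iteratedFDeriv_one, h0, norm_zero]
  have h2 : iteratedFDeriv ℝ 2 v 0 = 0 :=
    iteratedFDeriv_zero_eq_of_parity (Or.inr rfl) hodd' 2 (by norm_num)
  have hv' : ContDiffOn ℝ (3 : ℕ) v (Metric.ball 0 R) := hv
  have b2 := norm_iteratedFDeriv_le_of_succ hv' (j := 2) (by norm_num) h2 hc (p := 0)
    (by simpa using hb)
  have b1 := norm_iteratedFDeriv_le_of_succ hv' (j := 1) (by norm_num) h1 hc (p := 1) b2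
  intro t ht
  rw [← norm_iteratedFDeriv_one]
  exact b1 t ht

end Taylor

section Quadratic

variable {E : Type*} [NormedAddCommGroup E] [InnerProductSpace ℝ E]

open Topology

lemma iteratedFDeriv_two_half_norm_sq (t : E) (m : Fin 2 → E) :
    iteratedFDeriv ℝ 2 (fun x : E => ‖x‖ ^ 2 / 2) t m = ⟪m 0, m 1⟫ := by
  have h1 : fderiv ℝ (fun x : E => ‖x‖ ^ 2 / 2) = fun x => innerSL ℝ x := by
    ext x y
    have h2 : HasFDerivAt (fun x : E => ‖x‖ ^ 2 / 2) ((2 : ℝ)⁻¹ • (2 • innerSL ℝ x)) x := by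
      have h3 := ((hasStrictFDerivAt_norm_sq x).hasFDerivAt).const_mul (2 : ℝ)⁻¹
      refine h3.congr_of_eventuallyEq (Filter.Eventually.of_forall fun y => ?_)
      simp only; ring
    rw [h2.fderiv]
    simp
  rw [iteratedFDeriv_two_apply, h1]
  have h4 : fderiv ℝ (fun x : E => innerSL ℝ x) t = innerSL ℝ :=
    (innerSL ℝ (E := E)).fderiv
  rw [h4]
  rfl

lemma iteratedFDeriv_four_half_norm_sq (t : E) :
    iteratedFDeriv ℝ 4 (fun x : E => ‖x‖ ^ 2 / 2) t = 0 := by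
  have h2 : iteratedFDeriv ℝ 2 (fun x : E => ‖x‖ ^ 2 / 2) =
      fun _ => iteratedFDeriv ℝ 2 (fun x : E => ‖x‖ ^ 2 / 2) 0 := by
    ext x m
    rw [iteratedFDeriv_two_half_norm_sq, iteratedFDeriv_two_half_norm_sq]
  have h3 : iteratedFDeriv ℝ 3 (fun x : E => ‖x‖ ^ 2 / 2) = fun _ => 0 := by
    ext x m
    rw [iteratedFDeriv_succ_apply_left, h2, fderiv_const_apply]
    rfl
  ext m
  rw [iteratedFDeriv_succ_apply_left, h3, fderiv_const_apply]
  rfl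

lemma abs_add_half_norm_sq_le_of_even {R : ℝ} (hR : 0 < R) {u : E → ℝ} {c : ℝ} (hc : 0 ≤ c)
    (hu : ContDiffOn ℝ 4 u (Metric.ball 0 R))
    (heven : ∀ t ∈ Metric.ball (0 : E) R, u (-t) = u t) (h0 : u 0 = 0)
    (h2 : ∀ m : Fin 2 → E, iteratedFDeriv ℝ 2 u 0 m = -⟪m 0, m 1⟫)
    (hb : ∀ t ∈ Metric.ball (0 : E) R, ‖iteratedFDeriv ℝ 4 u t‖ ≤ c) :
    ∀ t ∈ Metric.ball (0 : E) R, |u t + ‖t‖ ^ 2 / 2| ≤ c * ‖t‖ ^ 4 := by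
  set q : E → ℝ := fun x => ‖x‖ ^ 2 / 2 with hq
  have hqc : ∀ n : ℕ, ContDiff ℝ n q := fun n => (contDiff_norm_sq ℝ).div_const 2
  have hu' : ContDiffOn ℝ (4 : ℕ) u (Metric.ball 0 R) := hu
  have hw : ContDiffOn ℝ (4 : ℕ) (u + q) (Metric.ball 0 R) := hu'.add (hqc 4).contDiffOn
  have hadd : ∀ k : ℕ, k ≤ 4 → ∀ t ∈ Metric.ball (0 : E) R,
      iteratedFDeriv ℝ k (u + q) t = iteratedFDeriv ℝ k u t + iteratedFDeriv ℝ k q t := by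
    intro k hk t ht
    exact iteratedFDeriv_add_apply
      ((hu'.contDiffAt (Metric.isOpen_ball.mem_nhds ht)).of_le (by exact_mod_cast hk))
      (hqc k).contDiffAt
  have h0mem : (0 : E) ∈ Metric.ball (0 : E) R := by simpa using hR
  have heven' : ∀ᶠ t in 𝓝 (0 : E), (u + q) (-t) = (1 : ℝ) • (u + q) t := by
    filter_upwards [Metric.ball_mem_nhds (0 : E) hR] with t ht
    simp [q, heven t ht]
  have w3 : iteratedFDeriv ℝ 3 (u + q) 0 = 0 :=
    iteratedFDeriv_zero_eq_of_parity (Or.inl rfl) heven' 3 (by norm_num)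
  have w1 : iteratedFDeriv ℝ 1 (u + q) 0 = 0 :=
    iteratedFDeriv_zero_eq_of_parity (Or.inl rfl) heven' 1 (by norm_num)
  have w2 : iteratedFDeriv ℝ 2 (u + q) 0 = 0 := by
    ext m
    rw [hadd 2 (by norm_num) 0 h0mem, add_apply, h2,
      iteratedFDeriv_two_half_norm_sq]
    simp
  have w0 : iteratedFDeriv ℝ 0 (u + q) 0 = 0 := by
    rw [← norm_eq_zero, norm_iteratedFDeriv_zero]; simp [q, h0]
  have b4 : ∀ t ∈ Metric.ball (0 : E) R, ‖iteratedFDeriv ℝ 4 (u + q) t‖ ≤ c * ‖t‖ ^ 0 := by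
    intro t ht
    rw [hadd 4 le_rfl t ht, iteratedFDeriv_four_half_norm_sq]
    simpa using hb t ht
  have b3 := norm_iteratedFDeriv_le_of_succ hw (j := 3) (by norm_num) w3 hc b4
  have b2 := norm_iteratedFDeriv_le_of_succ hw (j := 2) (by norm_num) w2 hc b3
  have b1 := norm_iteratedFDeriv_le_of_succ hw (j := 1) (by norm_num) w1 hc b2
  have b0 := norm_iteratedFDeriv_le_of_succ hw (j := 0) (by norm_num) w0 hc b1
  intro t ht
  have := b0 t ht
  rw [norm_iteratedFDeriv_zero, Real.norm_eq_abs] at this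
  exact this

end Quadratic

section LogDerivative

open Topology

variable {E : Type*} [NormedAddCommGroup E] [NormedSpace ℝ E] {𝕜 : Type*} [RCLike 𝕜]

/-- The second derivative of a logarithm, for the real and the complex logarithm. -/
lemma iteratedFDeriv_two_of_logDeriv {L f : E → 𝕜} {f' : E → E →L[ℝ] 𝕜}
    {f'' : E →L[ℝ] E →L[ℝ] 𝕜} {x : E}
    (hL : ∀ᶠ t in 𝓝 x, HasFDerivAt L ((f t)⁻¹ • f' t) t) (hf : HasFDerivAt f (f' x) x)
    (hf' : HasFDerivAt f' f'' x) (hx : f x ≠ 0) (m : Fin 2 → E) :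
    iteratedFDeriv ℝ 2 L x m =
      (f x)⁻¹ * f'' (m 0) (m 1) - (f x)⁻¹ ^ 2 * (f' x (m 0) * f' x (m 1)) := by
  have h1 : fderiv ℝ L =ᶠ[𝓝 x] fun t => (f t)⁻¹ • f' t := hL.mono fun t ht => ht.fderiv
  have hinv : HasFDerivAt (fun t => (f t)⁻¹) (-((f x)⁻¹ ^ 2) • f' x) x := by
    have h2 := (hasFDerivAt_inv (𝕜 := 𝕜) hx).restrictScalars ℝ
    have h3 := h2.comp x hf
    refine h3.congr_fderiv ?_
    ext y
    simp [mul_comm]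
  have h4 : HasFDerivAt (fun t => (f t)⁻¹ • f' t)
      ((f x)⁻¹ • f'' + (-((f x)⁻¹ ^ 2) • f' x).smulRight (f' x)) x := hinv.smul hf'
  rw [iteratedFDeriv_two_apply, h1.fderiv_eq, h4.fderiv]
  simp only [add_apply, smul_apply,
    ContinuousLinearMap.smulRight_apply, smul_eq_mul]
  ring

end LogDerivative

/-! ### The logarithm of a characteristic function -/

section LogCharFun

open Topology

variable {E : Type*} [NormedAddCommGroup E] [InnerProductSpace ℝ E] [MeasurableSpace E]
  {ν : Measure E}

lemma log_charFun_neg {t : E} (ht : charFun ν t ∈ Complex.slitPlane) :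
    Complex.log (charFun ν (-t)) = (starRingEnd ℂ) (Complex.log (charFun ν t)) := by
  rw [charFun_neg, Complex.log_conj _ (Complex.mem_slitPlane_iff_arg.mp ht).1]

lemma im_log_charFun_sub_odd (m : E) {t : E} (ht : charFun ν t ∈ Complex.slitPlane) :
    (Complex.log (charFun ν (-t))).im - ⟪m, -t⟫ = -((Complex.log (charFun ν t)).im - ⟪m, t⟫) := by
  rw [log_charFun_neg ht, Complex.conj_im, inner_neg_right]; ring

variable [BorelSpace E] [SecondCountableTopology E] [IsProbabilityMeasure ν]

lemma contDiffAt_clog {z : ℂ} (hz : z ∈ Complex.slitPlane) {n : WithTop ℕ∞} :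
    ContDiffAt ℝ n Complex.log z :=
  (Complex.contDiffAt_log hz).restrict_scalars ℝ

lemma contDiffOn_log_charFun (hν : MemLp id 4 ν) {U : Set E}
    (hU : ∀ t ∈ U, charFun ν t ∈ Complex.slitPlane) :
    ContDiffOn ℝ 4 (fun t => Complex.log (charFun ν t)) U := by
  have h : ContDiff ℝ (4 : ℕ) (charFun ν) := contDiff_charFun hν
  intro t ht
  exact ((contDiffAt_clog (hU t ht)).comp t h.contDiffAt).contDiffWithinAt

lemma fderiv_charFun_zero (hν : MemLp id 4 ν) {m : E}
    (hm : ∀ s, ∫ y, ⟪y, s⟫ ∂ν = ⟪m, s⟫) (s : E) :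
    fderiv ℝ (charFun ν) 0 s = Complex.I * (⟪m, s⟫ : ℂ) := by
  have hν1 : MemLp id (1 : ℕ) ν := hν.mono_exponent (by norm_num)
  have h := iteratedFDeriv_charFun (t := 0) hν1 fun _ => s
  rw [iteratedFDeriv_one_apply] at h
  rw [h, ← hm, ← integral_complex_ofReal]
  simp

lemma fderiv_fderiv_charFun_zero (hν : MemLp id 4 ν) {m : E}
    (h2 : ∀ s t, ∫ y, ⟪y, s⟫ * ⟪y, t⟫ ∂ν = ⟪s, t⟫ + ⟪m, s⟫ * ⟪m, t⟫) (s t : E) :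
    fderiv ℝ (fderiv ℝ (charFun ν)) 0 s t = -((⟪s, t⟫ + ⟪m, s⟫ * ⟪m, t⟫ : ℝ) : ℂ) := by
  have hν2 : MemLp id (2 : ℕ) ν := hν.mono_exponent (by norm_num)
  have h := iteratedFDeriv_charFun (t := 0) hν2 ![s, t]
  rw [iteratedFDeriv_two_apply] at h
  simp only [Matrix.cons_val_zero, Matrix.cons_val_one] at h
  rw [h, ← h2, ← integral_complex_ofReal]
  simp

lemma hasFDerivAt_log_charFun (hν : MemLp id 4 ν) {t : E}
    (ht : charFun ν t ∈ Complex.slitPlane) :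
    HasFDerivAt (fun t => Complex.log (charFun ν t))
      ((charFun ν t)⁻¹ • fderiv ℝ (charFun ν) t) t := by
  have h : ContDiff ℝ (4 : ℕ) (charFun ν) := contDiff_charFun hν
  have h1 : HasFDerivAt (charFun ν) (fderiv ℝ (charFun ν) t) t :=
    (h.differentiable (by norm_num) t).hasFDerivAt
  have h2 := ((Complex.hasDerivAt_log ht).hasFDerivAt.restrictScalars ℝ).comp t h1
  refine h2.congr_fderiv ?_
  ext x
  simp [mul_comm]

/-- For an isotropic law, the real part of the logarithm of the characteristic function equals
`-‖t‖² / 2` up to fourth order; the cubic term vanishes by symmetry. -/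
lemma abs_re_log_charFun_add_le (hν : MemLp id 4 ν) {m : E}
    (hm : ∀ s, ∫ y, ⟪y, s⟫ ∂ν = ⟪m, s⟫)
    (h2 : ∀ s t, ∫ y, ⟪y, s⟫ * ⟪y, t⟫ ∂ν = ⟪s, t⟫ + ⟪m, s⟫ * ⟪m, t⟫)
    {R : ℝ} (hR : 0 < R) (hU : ∀ t ∈ Metric.ball (0 : E) R, charFun ν t ∈ Complex.slitPlane)
    {c : ℝ} (hc : 0 ≤ c)
    (hb : ∀ t ∈ Metric.ball (0 : E) R,
      ‖iteratedFDeriv ℝ 4 (fun t => (Complex.log (charFun ν t)).re) t‖ ≤ c) :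
    ∀ t ∈ Metric.ball (0 : E) R, |(Complex.log (charFun ν t)).re + ‖t‖ ^ 2 / 2| ≤ c * ‖t‖ ^ 4 := by
  have hL := contDiffOn_log_charFun hν hU
  have h0 : (0 : E) ∈ Metric.ball (0 : E) R := by simpa using hR
  refine abs_add_half_norm_sq_le_of_even hR hc (Complex.reCLM.contDiff.comp_contDiffOn hL)
    (fun t ht => ?_) (by simp [charFun_zero]) (fun x => ?_) hb
  · simp only [log_charFun_neg (hU t ht), Complex.conj_re]
  · have h3 : ContDiff ℝ (4 : ℕ) (charFun ν) := contDiff_charFun hν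
    have h4 : HasFDerivAt (charFun ν) (fderiv ℝ (charFun ν) 0) 0 :=
      (h3.differentiable (by norm_num) 0).hasFDerivAt
    have h5 : HasFDerivAt (fderiv ℝ (charFun ν)) (fderiv ℝ (fderiv ℝ (charFun ν)) 0) 0 :=
      ((h3.fderiv_right (m := 3) (by norm_num)).differentiable (by norm_num) 0).hasFDerivAt
    have h6 := iteratedFDeriv_two_of_logDeriv (L := fun t => Complex.log (charFun ν t))
      (by
        filter_upwards [Metric.ball_mem_nhds (0 : E) hR] with t ht
        exact hasFDerivAt_log_charFun hν (hU t ht)) h4 h5 (by simp [charFun_zero]) x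
    have h7 : iteratedFDeriv ℝ 2 (fun t => (Complex.log (charFun ν t)).re) 0 x =
        (iteratedFDeriv ℝ 2 (fun t => Complex.log (charFun ν t)) 0 x).re := by
      have h8 := Complex.reCLM.iteratedFDeriv_comp_left
        (hL.contDiffAt (Metric.isOpen_ball.mem_nhds h0)) (i := 2) (by norm_num)
      exact congrArg (fun T => T x) h8
    rw [h7, h6, fderiv_fderiv_charFun_zero hν h2, fderiv_charFun_zero hν hm,
      fderiv_charFun_zero hν hm]
    simp [charFun_zero]

lemma contDiffOn_im_log_charFun_sub (hν : MemLp id 4 ν) (m : E) {U : Set E}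
    (hU : ∀ t ∈ U, charFun ν t ∈ Complex.slitPlane) :
    ContDiffOn ℝ 4 (fun t => (Complex.log (charFun ν t)).im - ⟪m, t⟫) U :=
  (Complex.imCLM.contDiff.comp_contDiffOn (contDiffOn_log_charFun hν hU)).sub
    ((innerSL ℝ m).contDiff.contDiffOn)

/-- The gradient of the centred phase of the characteristic function is quadratically small. -/
lemma norm_fderiv_im_log_charFun_sub_le (hν : MemLp id 4 ν) {m : E}
    (hm : ∀ s, ∫ y, ⟪y, s⟫ ∂ν = ⟪m, s⟫)
    {R : ℝ} (hR : 0 < R) (hU : ∀ t ∈ Metric.ball (0 : E) R, charFun ν t ∈ Complex.slitPlane)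
    {c : ℝ} (hc : 0 ≤ c)
    (hb : ∀ t ∈ Metric.ball (0 : E) R,
      ‖iteratedFDeriv ℝ 3 (fun t => (Complex.log (charFun ν t)).im) t‖ ≤ c) :
    ∀ t ∈ Metric.ball (0 : E) R,
      ‖fderiv ℝ (fun t => (Complex.log (charFun ν t)).im - ⟪m, t⟫) t‖ ≤ c * ‖t‖ ^ 2 := by
  have hL := contDiffOn_log_charFun hν hU
  have h0 : (0 : E) ∈ Metric.ball (0 : E) R := by simpa using hR
  refine norm_fderiv_le_of_odd hR hc ((contDiffOn_im_log_charFun_sub hν m hU).of_le (by norm_num))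
    (fun t ht => im_log_charFun_sub_odd m (hU t ht)) ?_ (fun t ht => ?_)
  · have h1 := hasFDerivAt_log_charFun hν (hU 0 h0)
    have h2 : HasFDerivAt (fun t => (Complex.log (charFun ν t)).im - ⟪m, t⟫)
        (Complex.imCLM.comp ((charFun ν 0)⁻¹ • fderiv ℝ (charFun ν) 0) - innerSL ℝ m) 0 :=
      (Complex.imCLM.hasFDerivAt.comp (0 : E) h1).sub (innerSL ℝ m).hasFDerivAt
    rw [h2.fderiv]
    ext s
    simp [fderiv_charFun_zero hν hm, charFun_zero]
  · have h3 : iteratedFDeriv ℝ 3 (fun t => (Complex.log (charFun ν t)).im - ⟪m, t⟫) t =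
        iteratedFDeriv ℝ 3 (fun t => (Complex.log (charFun ν t)).im) t -
          iteratedFDeriv ℝ 3 (innerSL ℝ m) t := by
      have h4 : ContDiffAt ℝ 3 (fun t => (Complex.log (charFun ν t)).im) t :=
        ((Complex.imCLM.contDiff.comp_contDiffOn hL).contDiffAt
          (Metric.isOpen_ball.mem_nhds ht)).of_le (by norm_num)
      exact iteratedFDeriv_sub_apply h4 (innerSL ℝ m).contDiff.contDiffAt
    have h5 : iteratedFDeriv ℝ 3 (innerSL ℝ m) t = 0 := by
      rw [← norm_eq_zero, ← norm_iteratedFDeriv_fderiv,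
        show fderiv ℝ (innerSL ℝ m) = fun _ => innerSL ℝ m from funext fun x =>
          (innerSL ℝ m).fderiv, iteratedFDeriv_const_of_ne (by norm_num), Pi.zero_apply, norm_zero]
    rw [h3, h5, sub_zero]
    exact hb t ht

end LogCharFun

section Bounds

open Topology

/-- On the compact sector `ρ ≤ ‖z‖ ≤ 1`, `|arg z| ≤ π - δ` the derivatives of the logarithm are
bounded. -/
lemma exists_bound_iteratedFDeriv_clog {ρ δ : ℝ} (hρ : 0 < ρ) (hδ : 0 < δ) :
    ∃ C : ℝ, ∀ z : ℂ, ρ ≤ ‖z‖ → ‖z‖ ≤ 1 → |z.arg| ≤ Real.pi - δ → ∀ i ≤ 4,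
      ‖iteratedFDerivWithin ℝ i Complex.log Complex.slitPlane z‖ ≤ C := by
  set g : ℝ × ℝ → ℂ := fun p => p.1 * (Complex.cos p.2 + Complex.sin p.2 * Complex.I) with hg
  set Q : Set (ℝ × ℝ) := Set.Icc ρ 1 ×ˢ Set.Icc (-(Real.pi - δ)) (Real.pi - δ) with hQ
  have hK : IsCompact (g '' Q) :=
    (isCompact_Icc.prod isCompact_Icc).image (by fun_prop)
  have hKs : g '' Q ⊆ Complex.slitPlane := by
    rintro _ ⟨⟨r, θ⟩, ⟨hr, hθ⟩, rfl⟩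
    simp only [Set.mem_Icc] at hr hθ
    have hr0 : 0 < r := by linarith
    have harg := Complex.arg_mul_cos_add_sin_mul_I hr0 (θ := θ) ⟨by linarith, by linarith⟩
    rw [Complex.mem_slitPlane_iff_arg]
    simp only [hg]
    refine ⟨by rw [harg]; linarith, ?_⟩
    rw [← Complex.exp_mul_I]
    exact mul_ne_zero (by exact_mod_cast hr0.ne') (Complex.exp_ne_zero _)
  have hcont : ContDiffOn ℝ 4 Complex.log Complex.slitPlane := fun z hz =>
    (contDiffAt_clog hz).contDiffWithinAt
  have hex : ∀ i : ℕ, ∃ C : ℝ, i ≤ 4 → ∀ z ∈ g '' Q,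
      ‖iteratedFDerivWithin ℝ i Complex.log Complex.slitPlane z‖ ≤ C := by
    intro i
    by_cases hi : i ≤ 4
    · obtain ⟨C, hC⟩ := hK.exists_bound_of_continuousOn
        ((hcont.continuousOn_iteratedFDerivWithin (m := i) (by exact_mod_cast hi)
          Complex.isOpen_slitPlane.uniqueDiffOn).mono hKs)
      exact ⟨C, fun _ => hC⟩
    · exact ⟨0, fun h => absurd h hi⟩
  choose C hC using hex
  refine ⟨∑ i ∈ Finset.range 5, |C i|, fun z hz1 hz2 hz3 i hi => ?_⟩
  have hz : z ∈ g '' Q := by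
    refine ⟨(‖z‖, z.arg), ⟨⟨hz1, hz2⟩, abs_le.mp hz3⟩, ?_⟩
    simp only [hg]
    exact Complex.norm_mul_cos_add_sin_mul_I z
  calc _ ≤ C i := hC i hi z hz
    _ ≤ |C i| := le_abs_self _
    _ ≤ _ := Finset.single_le_sum (f := fun i => |C i|) (fun _ _ => abs_nonneg _)
        (Finset.mem_range.mpr (by omega))

/-- The derivatives up to order four of `log (charFun ν)` are bounded in terms of the fourth moment
of `ν` and of the distance of `charFun ν` to the cut of the logarithm. -/
lemma exists_bound_iteratedFDeriv_log_charFun {ρ δ : ℝ} (hρ : 0 < ρ) (hδ : 0 < δ) (M : ℝ) :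
    ∃ C : ℝ, ∀ (E : Type) [NormedAddCommGroup E] [InnerProductSpace ℝ E] [MeasurableSpace E]
      [BorelSpace E] [SecondCountableTopology E] (ν : Measure E) [IsProbabilityMeasure ν],
      MemLp id 4 ν → ∫ y, ‖y‖ ^ 4 ∂ν ≤ M → ∀ U : Set E, IsOpen U →
      (∀ t ∈ U, charFun ν t ∈ Complex.slitPlane ∧ ρ ≤ ‖charFun ν t‖ ∧
        |(charFun ν t).arg| ≤ Real.pi - δ) →
      ∀ t ∈ U, ∀ k ≤ 4, ‖iteratedFDeriv ℝ k (fun t => Complex.log (charFun ν t)) t‖ ≤ C := by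
  obtain ⟨C, hC⟩ := exists_bound_iteratedFDeriv_clog hρ hδ
  refine ⟨24 * |C| * (1 + |M|) ^ 4, ?_⟩
  intro E _ _ _ _ _ ν _ hν hM U hU hUs t ht k hk
  have hk4 : (k : ENNReal) ≤ 4 := by exact_mod_cast hk
  have hcont : ContDiff ℝ (4 : ℕ) (charFun ν) := contDiff_charFun hν
  have hclog : ContDiffOn ℝ (4 : ℕ) Complex.log Complex.slitPlane := fun z hz =>
    (contDiffAt_clog hz).contDiffWithinAt
  have hint4 : Integrable (fun y : E => ‖y‖ ^ 4) ν := MemLp.integrable_norm_pow' (p := 4) hν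
  set D := 1 + |M| with hD
  have hD1 : 1 ≤ D := by simp [hD]
  have hder : ∀ i, 1 ≤ i → i ≤ k → ‖iteratedFDerivWithin ℝ i (charFun ν) U t‖ ≤ D ^ i := by
    intro i hi hik
    have hi4 : i ≤ 4 := hik.trans hk
    have hνi : MemLp id i ν := hν.mono_exponent (by exact_mod_cast hi4)
    have hinti : Integrable (fun y : E => ‖y‖ ^ i) ν := MemLp.integrable_norm_pow' (p := i) hνi
    have hmom : ∫ y, ‖y‖ ^ i ∂ν ≤ D := by
      calc ∫ y, ‖y‖ ^ i ∂ν ≤ ∫ y, (1 + ‖y‖ ^ 4) ∂ν := by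
            refine integral_mono hinti ((integrable_const 1).add hint4) fun y => ?_
            simp only
            rcases le_total ‖y‖ 1 with h | h
            · have := pow_le_one₀ (n := i) (norm_nonneg y) h
              have : 0 ≤ ‖y‖ ^ 4 := by positivity
              linarith
            · have := pow_le_pow_right₀ h hi4
              linarith
        _ = 1 + ∫ y, ‖y‖ ^ 4 ∂ν := by
            rw [integral_add (integrable_const 1) hint4]; simp
        _ ≤ D := by rw [hD]; have := le_abs_self M; linarith
    rw [iteratedFDerivWithin_of_isOpen i hU ht]
    refine le_trans ?_ (hmom.trans (le_self_pow₀ hD1 (by omega)))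
    refine ContinuousMultilinearMap.opNorm_le_bound
      (integral_nonneg fun y => by positivity) fun x => ?_
    rw [iteratedFDeriv_charFun hνi, norm_mul, norm_pow, Complex.norm_I, one_pow, one_mul,
      ← integral_mul_const]
    refine norm_integral_le_of_norm_le (hinti.mul_const _) (Filter.Eventually.of_forall fun y => ?_)
    rw [norm_mul, Complex.norm_exp_ofReal_mul_I, mul_one, Complex.norm_real,
      norm_prod]
    calc ∏ j, ‖⟪y, x j⟫‖ ≤ ∏ j, (‖y‖ * ‖x j‖) := by
          refine Finset.prod_le_prod (fun _ _ => norm_nonneg _) fun j _ => ?_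
          exact norm_inner_le_norm _ _
      _ = ‖y‖ ^ i * ∏ j, ‖x j‖ := by simp [Finset.prod_mul_distrib]
  have h := norm_iteratedFDerivWithin_comp_le (n := k) (C := |C|) (D := D) hclog
    (hcont.contDiffOn (s := U)) (by exact_mod_cast hk) Complex.isOpen_slitPlane.uniqueDiffOn
    hU.uniqueDiffOn (fun x hx => (hUs x hx).1) ht
    (fun i hi => (hC _ (hUs t ht).2.1 (norm_charFun_le_one t) (hUs t ht).2.2 i
      (hi.trans hk)).trans (le_abs_self C)) hder
  rw [iteratedFDerivWithin_of_isOpen k hU ht] at h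
  refine h.trans ?_
  have hfac : (k.factorial : ℝ) ≤ 24 := by
    have := Nat.factorial_le hk
    exact_mod_cast this
  have hpow : D ^ k ≤ D ^ 4 := pow_le_pow_right₀ hD1 hk
  gcongr

end Bounds

/-! ### The inverse square root and exponential moments -/

section Whitening

variable {d : ℕ}

lemma isSelfAdjoint_invSqrt (A : Matrix (Fin d) (Fin d) ℝ) : IsSelfAdjoint (invSqrt A) :=
  cfc_predicate _ _

lemma spectrum_pos_of_posDef {A : Matrix (Fin d) (Fin d) ℝ} (hA : A.PosDef) {x : ℝ}
    (hx : x ∈ spectrum ℝ A) : 0 < x := by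
  rw [hA.isHermitian.spectrum_real_eq_range_eigenvalues] at hx
  obtain ⟨i, rfl⟩ := hx
  exact hA.eigenvalues_pos i

lemma invSqrt_mul_mul_invSqrt {A : Matrix (Fin d) (Fin d) ℝ} (hA : A.PosDef) :
    invSqrt A * A * invSqrt A = 1 := by
  have hsa : IsSelfAdjoint A := hA.isHermitian
  have hf : ContinuousOn (fun x : ℝ => (Real.sqrt x)⁻¹) (spectrum ℝ A) :=
    Real.continuous_sqrt.continuousOn.inv₀ fun x hx =>
      (Real.sqrt_pos.mpr (spectrum_pos_of_posDef hA hx)).ne'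
  unfold invSqrt
  conv_lhs => enter [1, 2]; rw [← cfc_id ℝ A]
  rw [← cfc_mul _ _ A hf continuousOn_id,
    ← cfc_mul (fun x : ℝ => (Real.sqrt x)⁻¹ * id x) _ A (hf.mul continuousOn_id) hf,
    ← cfc_one ℝ A]
  refine cfc_congr fun x hx => ?_
  have hx0 := spectrum_pos_of_posDef hA hx
  have := Real.sqrt_pos.mpr hx0
  simp only [Pi.one_apply, id]
  field_simp
  exact (Real.sq_sqrt hx0.le).symm

/-- The operator `A ^ (-1/2)` on Euclidean space. -/
noncomputable def invSqrtCLM (A : Matrix (Fin d) (Fin d) ℝ) : Vec d →L[ℝ] Vec d :=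
  Matrix.toEuclideanCLM (n := Fin d) (𝕜 := ℝ) (invSqrt A)

lemma isSelfAdjoint_invSqrtCLM (A : Matrix (Fin d) (Fin d) ℝ) : IsSelfAdjoint (invSqrtCLM A) := by
  unfold invSqrtCLM IsSelfAdjoint
  rw [← map_star, (isSelfAdjoint_invSqrt A).star_eq]

lemma inner_invSqrtCLM (A : Matrix (Fin d) (Fin d) ℝ) (s t : Vec d) :
    ⟪invSqrtCLM A s, t⟫ = ⟪s, invSqrtCLM A t⟫ := by
  have h := (isSelfAdjoint_invSqrtCLM A)
  rw [ContinuousLinearMap.isSelfAdjoint_iff'] at h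
  rw [← ContinuousLinearMap.adjoint_inner_right, h]

lemma inner_invSqrtCLM_apply_invSqrtCLM {A : Matrix (Fin d) (Fin d) ℝ} (hA : A.PosDef) (s t : Vec d) :
    ⟪invSqrtCLM A s, Matrix.toEuclideanCLM (n := Fin d) (𝕜 := ℝ) A (invSqrtCLM A t)⟫ =
      ⟪s, t⟫ := by
  rw [inner_invSqrtCLM]
  have h : invSqrtCLM A * Matrix.toEuclideanCLM (n := Fin d) (𝕜 := ℝ) A * invSqrtCLM A = 1 := by
    unfold invSqrtCLM
    rw [← map_mul, ← map_mul, invSqrt_mul_mul_invSqrt hA, map_one]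
  have h2 : invSqrtCLM A (Matrix.toEuclideanCLM (n := Fin d) (𝕜 := ℝ) A (invSqrtCLM A t)) = t :=
    congrArg (fun T : Vec d →L[ℝ] Vec d => T t) h
  rw [h2]

lemma norm_invSqrtCLM_sq {A : Matrix (Fin d) (Fin d) ℝ} (hA : A.PosDef) :
    ‖invSqrtCLM A‖ ^ 2 = ‖Matrix.toEuclideanCLM (n := Fin d) (𝕜 := ℝ) A⁻¹‖ := by
  have h1 : invSqrt A * invSqrt A = A⁻¹ := by
    have h := invSqrt_mul_mul_invSqrt hA
    have h2 : (invSqrt A * invSqrt A) * A = 1 := by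
      have h3 : A * invSqrt A * invSqrt A = 1 := by
        rw [mul_assoc] at h
        exact mul_eq_one_comm.mp h
      rw [mul_assoc] at h3
      exact mul_eq_one_comm.mp h3
    exact (Matrix.inv_eq_left_inv h2).symm
  rw [← h1, map_mul, sq]
  have h4 := CStarRing.norm_star_mul_self (x := invSqrtCLM A)
  rw [(isSelfAdjoint_invSqrtCLM A).star_eq] at h4
  exact h4.symm

end Whitening

section Mgf

open Topology

variable {d : ℕ} {μ : Measure (Vec d)}

lemma norm_le_natCast_mul_abs_coord (hd : 1 ≤ d) (x : Vec d) : ∃ i, ‖x‖ ≤ d * |x i| := by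
  have : Nonempty (Fin d) := ⟨⟨0, by omega⟩⟩
  obtain ⟨i, hi⟩ := Finite.exists_max fun i => |x i|
  refine ⟨i, ?_⟩
  have hd1 : (1 : ℝ) ≤ d := by exact_mod_cast hd
  have h : ‖x‖ ^ 2 ≤ (d * |x i|) ^ 2 := by
    rw [EuclideanSpace.real_norm_sq_eq]
    calc ∑ j, x j ^ 2 ≤ ∑ _j : Fin d, |x i| ^ 2 := by
          refine Finset.sum_le_sum fun j _ => ?_
          rw [← sq_abs]
          exact pow_le_pow_left₀ (abs_nonneg _) (hi j) 2
      _ = d * |x i| ^ 2 := by simp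
      _ ≤ (d * |x i|) ^ 2 := by
          rw [mul_pow]; nlinarith [mul_nonneg (sub_nonneg.mpr hd1) (sq_nonneg |x i|)]
  exact (pow_le_pow_iff_left₀ (norm_nonneg _) (by positivity) two_ne_zero).mp h

lemma exp_mul_norm_le (hd : 1 ≤ d) {ρ : ℝ} (hρ : 0 ≤ ρ) (x : Vec d) :
    Real.exp (ρ * ‖x‖) ≤ ∑ i, (Real.exp ⟪EuclideanSpace.single i (ρ * d), x⟫ +
      Real.exp ⟪EuclideanSpace.single i (-(ρ * d)), x⟫) := by
  obtain ⟨i, hi⟩ := norm_le_natCast_mul_abs_coord hd x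
  refine le_trans ?_ (Finset.single_le_sum (f := fun i => Real.exp ⟪EuclideanSpace.single i (ρ * d), x⟫ +
      Real.exp ⟪EuclideanSpace.single i (-(ρ * d)), x⟫) (fun i _ => by positivity)
      (Finset.mem_univ i))
  simp only [EuclideanSpace.inner_single_left, conj_trivial]
  have h1 : ρ * ‖x‖ ≤ ρ * d * |x i| := by rw [mul_assoc]; gcongr
  have h2 : Real.exp (ρ * ‖x‖) ≤ Real.exp (ρ * d * |x i|) := Real.exp_le_exp.mpr h1
  rcases abs_cases (x i) with ⟨h, _⟩ | ⟨h, _⟩ <;> rw [h] at h2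
  · have := Real.exp_pos (-(ρ * d) * x i); linarith
  · rw [mul_neg, ← neg_mul] at h2
    have := Real.exp_pos (ρ * d * x i); linarith

/-- Differentiation of a weighted moment generating function under the integral sign. -/
lemma hasFDerivAt_integral_exp_smul {F : Type*} [NormedAddCommGroup F] [NormedSpace ℝ F]
    [CompleteSpace F] {g : Vec d → F} (hg : Continuous g) {k : ℕ} (hgb : ∀ x, ‖g x‖ ≤ ‖x‖ ^ k)
    {τ : Vec d} {ρ : ℝ} (hρ : 0 < ρ)
    (hk : Integrable (fun x => ‖x‖ ^ k * Real.exp (⟪τ, x⟫ + ρ * ‖x‖)) μ)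
    (hk1 : Integrable (fun x => ‖x‖ ^ (k + 1) * Real.exp (⟪τ, x⟫ + ρ * ‖x‖)) μ) :
    HasFDerivAt (fun σ : Vec d => ∫ x, Real.exp ⟪σ, x⟫ • g x ∂μ)
      (∫ x, Real.exp ⟪τ, x⟫ • (innerSL ℝ x).smulRight (g x) ∂μ) τ := by
  have hexp : ∀ σ ∈ Metric.ball τ ρ, ∀ x : Vec d,
      Real.exp ⟪σ, x⟫ ≤ Real.exp (⟪τ, x⟫ + ρ * ‖x‖) := by
    intro σ hσ x
    apply Real.exp_le_exp.mpr
    have h1 : ⟪σ, x⟫ = ⟪τ, x⟫ + ⟪σ - τ, x⟫ := by rw [← inner_add_left]; simp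
    have h2 : ⟪σ - τ, x⟫ ≤ ρ * ‖x‖ := by
      refine (real_inner_le_norm _ _).trans ?_
      have : ‖σ - τ‖ ≤ ρ := by rw [← dist_eq_norm]; exact (Metric.mem_ball.mp hσ).le
      gcongr
    linarith
  have hcont : Continuous fun x : Vec d => (innerSL ℝ x).smulRight (g x) := by
    exact (ContinuousLinearMap.smulRightL ℝ (Vec d) F).continuous₂.comp
      ((innerSL ℝ).continuous.prodMk hg)
  have hτmem : τ ∈ Metric.ball τ ρ := Metric.mem_ball_self hρ
  refine hasFDerivAt_integral_of_dominated_of_fderiv_le (𝕜 := ℝ)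
    (F' := fun σ x => Real.exp ⟪σ, x⟫ • (innerSL ℝ x).smulRight (g x))
    (bound := fun x => ‖x‖ ^ (k + 1) * Real.exp (⟪τ, x⟫ + ρ * ‖x‖)) (Metric.ball_mem_nhds τ hρ)
    (Filter.Eventually.of_forall fun σ => Continuous.aestronglyMeasurable (by fun_prop))
    ?_ (Continuous.aestronglyMeasurable (by fun_prop)) ?_ hk1 ?_
  · refine hk.mono' (Continuous.aestronglyMeasurable (by fun_prop))
      (Filter.Eventually.of_forall fun x => ?_)
    rw [norm_smul, Real.norm_of_nonneg (Real.exp_nonneg _), mul_comm]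
    gcongr
    · exact hgb x
    · exact Real.exp_le_exp.mp (hexp τ hτmem x)
  · refine Filter.Eventually.of_forall fun x σ hσ => ?_
    rw [norm_smul, Real.norm_of_nonneg (Real.exp_nonneg _), ContinuousLinearMap.norm_smulRight_apply,
      innerSL_apply_norm, mul_comm, pow_succ, mul_comm (‖x‖ ^ k)]
    gcongr
    · exact hgb x
    · exact Real.exp_le_exp.mp (hexp σ hσ x)
  · refine Filter.Eventually.of_forall fun x σ _ => ?_
    have h1 : HasFDerivAt (fun σ : Vec d => ⟪σ, x⟫) (innerSL ℝ x) σ := by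
      refine ((innerSL ℝ x).hasFDerivAt (x := σ)).congr_of_eventuallyEq
        (Filter.Eventually.of_forall fun y => ?_)
      exact real_inner_comm _ _
    refine (h1.exp.smul_const (g x)).congr_fderiv ?_
    ext y
    simp [smul_smul]

variable [IsFiniteMeasure μ]

lemma integrable_norm_pow_mul_exp_of_four {τ : Vec d}
    (h4 : Integrable (fun x => ‖x‖ ^ 4 * Real.exp ⟪τ, x⟫) μ) {k : ℕ} (hk : k ≤ 4) :
    Integrable (fun x => ‖x‖ ^ k * Real.exp ⟪τ, x⟫) μ := by
  refine ((integrable_const (Real.exp ‖τ‖)).add h4).mono' (by fun_prop)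
    (Filter.Eventually.of_forall fun x => ?_)
  rw [Real.norm_of_nonneg (by positivity)]
  simp only [Pi.add_apply]
  rcases le_total ‖x‖ 1 with h | h
  · have h1 : Real.exp ⟪τ, x⟫ ≤ Real.exp ‖τ‖ := by
      apply Real.exp_le_exp.mpr
      calc ⟪τ, x⟫ ≤ ‖τ‖ * ‖x‖ := real_inner_le_norm _ _
        _ ≤ ‖τ‖ * 1 := by gcongr
        _ = ‖τ‖ := mul_one _
    have h2 : ‖x‖ ^ k ≤ 1 := pow_le_one₀ (norm_nonneg x) h
    have h3 : 0 ≤ ‖x‖ ^ 4 * Real.exp ⟪τ, x⟫ := by positivity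
    nlinarith [Real.exp_pos ⟪τ, x⟫]
  · have h2 : ‖x‖ ^ k ≤ ‖x‖ ^ 4 := pow_le_pow_right₀ h hk
    have h3 : ‖x‖ ^ k * Real.exp ⟪τ, x⟫ ≤ ‖x‖ ^ 4 * Real.exp ⟪τ, x⟫ := by gcongr
    have := Real.exp_pos ‖τ‖
    linarith

/-- On an open set, finiteness of the exponential moments improves to an exponential weight
`exp (⟪τ, x⟫ + ρ * ‖x‖)`, since `exp (ρ * ‖x‖)` is at most a finite sum of exponentials of linear
forms. -/
lemma exists_integrable_norm_pow_mul_exp_add (hd : 1 ≤ d) {V : Set (Vec d)} (hV : IsOpen V)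
    (h4 : ∀ τ ∈ V, Integrable (fun x => ‖x‖ ^ 4 * Real.exp ⟪τ, x⟫) μ) {τ : Vec d} (hτ : τ ∈ V) :
    ∃ ρ > 0, Metric.ball τ ρ ⊆ V ∧ ∀ k ≤ 4,
      Integrable (fun x => ‖x‖ ^ k * Real.exp (⟪τ, x⟫ + ρ * ‖x‖)) μ := by
  obtain ⟨r, hr, hrV⟩ := Metric.isOpen_iff.mp hV τ hτ
  have hd0 : (0 : ℝ) < d := by exact_mod_cast hd
  have hd1 : (1 : ℝ) ≤ d := by exact_mod_cast hd
  set ρ := r / (2 * d) with hρ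
  have hρ0 : 0 < ρ := by positivity
  have hρd : ρ * d = r / 2 := by rw [hρ]; field_simp
  refine ⟨ρ, hρ0, (Metric.ball_subset_ball ?_).trans hrV, fun k hk => ?_⟩
  · rw [hρ, div_le_iff₀ (by positivity)]; nlinarith
  have hmem : ∀ i : Fin d, ∀ c : ℝ, |c| = r / 2 → τ + EuclideanSpace.single i c ∈ V := by
    intro i c hc
    apply hrV
    rw [Metric.mem_ball, dist_self_add_left, PiLp.norm_single, Real.norm_eq_abs, hc]
    linarith
  have hint : Integrable (fun x : Vec d => ∑ i : Fin d,
      (‖x‖ ^ k * Real.exp ⟪τ + EuclideanSpace.single i (ρ * d), x⟫ +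
        ‖x‖ ^ k * Real.exp ⟪τ + EuclideanSpace.single i (-(ρ * d)), x⟫)) μ := by
    refine integrable_finsetSum _ fun i _ => ?_
    refine (integrable_norm_pow_mul_exp_of_four (h4 _ (hmem i _ ?_)) hk).add
      (integrable_norm_pow_mul_exp_of_four (h4 _ (hmem i _ ?_)) hk)
    · rw [hρd, abs_of_pos (by positivity)]
    · rw [hρd, abs_neg, abs_of_pos (by positivity)]
  refine hint.mono' (by fun_prop) (Filter.Eventually.of_forall fun x => ?_)
  rw [Real.norm_of_nonneg (by positivity), Real.exp_add]
  calc ‖x‖ ^ k * (Real.exp ⟪τ, x⟫ * Real.exp (ρ * ‖x‖))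
      ≤ ‖x‖ ^ k * (Real.exp ⟪τ, x⟫ * ∑ i, (Real.exp ⟪EuclideanSpace.single i (ρ * d), x⟫ +
      Real.exp ⟪EuclideanSpace.single i (-(ρ * d)), x⟫)) := by
        gcongr; exact exp_mul_norm_le hd hρ0.le x
    _ = _ := by
        rw [Finset.mul_sum, Finset.mul_sum]
        refine Finset.sum_congr rfl fun i _ => ?_
        rw [inner_add_left, inner_add_left, Real.exp_add, Real.exp_add]
        ring

end Mgf

/-! ### Tilted and whitened laws -/

section Cumulants

open Topology

variable {d : ℕ} {μ : Measure (Vec d)}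

/-- The exponentially tilted law, with density `exp ⟪τ, x⟫ / φ(τ)` with respect to `μ`. -/
noncomputable def tiltedLaw (μ : Measure (Vec d)) (τ : Vec d) : Measure (Vec d) :=
  μ.tilted fun x => ⟪τ, x⟫

lemma integral_tiltedLaw {F : Type*} [NormedAddCommGroup F] [NormedSpace ℝ F] (τ : Vec d)
    (g : Vec d → F) :
    ∫ x, g x ∂(tiltedLaw μ τ) = (mgf μ τ)⁻¹ • ∫ x, Real.exp ⟪τ, x⟫ • g x ∂μ := by
  rw [tiltedLaw, integral_tilted, ← integral_smul]
  refine integral_congr_ae (Filter.Eventually.of_forall fun x => ?_)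
  simp only [smul_smul]
  rw [div_eq_inv_mul]
  rfl

variable [IsProbabilityMeasure μ]

lemma integrable_exp_of_four {τ : Vec d}
    (h4 : Integrable (fun x => ‖x‖ ^ 4 * Real.exp ⟪τ, x⟫) μ) :
    Integrable (fun x => Real.exp ⟪τ, x⟫) μ := by
  simpa using integrable_norm_pow_mul_exp_of_four h4 (k := 0) (by norm_num)

lemma mgf_pos {τ : Vec d} (h4 : Integrable (fun x => ‖x‖ ^ 4 * Real.exp ⟪τ, x⟫) μ) :
    0 < mgf μ τ :=
  integral_exp_pos (integrable_exp_of_four h4)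

lemma isProbabilityMeasure_tiltedLaw {τ : Vec d}
    (h4 : Integrable (fun x => ‖x‖ ^ 4 * Real.exp ⟪τ, x⟫) μ) :
    IsProbabilityMeasure (tiltedLaw μ τ) :=
  isProbabilityMeasure_tilted (integrable_exp_of_four h4)

lemma integrable_norm_pow_four_tiltedLaw {τ : Vec d}
    (h4 : Integrable (fun x => ‖x‖ ^ 4 * Real.exp ⟪τ, x⟫) μ) :
    Integrable (fun x => ‖x‖ ^ 4) (tiltedLaw μ τ) := by
  rw [tiltedLaw, integrable_tilted_iff (integrable_exp_of_four h4)]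
  exact h4.congr (Filter.Eventually.of_forall fun x => by simp [mul_comm])

lemma memLp_four_tiltedLaw {τ : Vec d}
    (h4 : Integrable (fun x => ‖x‖ ^ 4 * Real.exp ⟪τ, x⟫) μ) : MemLp id 4 (tiltedLaw μ τ) := by
  rw [← integrable_norm_rpow_iff (by fun_prop) (by norm_num) (by norm_num)]
  refine (integrable_norm_pow_four_tiltedLaw h4).congr (Filter.Eventually.of_forall fun x => ?_)
  simp only [id]
  rw [show (4 : ENNReal).toReal = ((4 : ℕ) : ℝ) by simp, Real.rpow_natCast]

lemma mgfC_eq (τ s : Vec d) (h4 : Integrable (fun x => ‖x‖ ^ 4 * Real.exp ⟪τ, x⟫) μ) :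
    mgfC μ τ s = mgf μ τ * charFun (tiltedLaw μ τ) s := by
  rw [charFun_apply, integral_tiltedLaw, Complex.real_smul, ← mul_assoc, ← Complex.ofReal_mul,
    mul_inv_cancel₀ (mgf_pos h4).ne', Complex.ofReal_one, one_mul, mgfC]
  refine integral_congr_ae (Filter.Eventually.of_forall fun x => ?_)
  simp only [Complex.exp_add, Complex.real_smul, Complex.ofReal_exp]
  rw [real_inner_comm s x, mul_comm Complex.I]

section Derivatives

variable {V : Set (Vec d)}

lemma hasFDerivAt_mgf (hd : 1 ≤ d) (hV : IsOpen V)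
    (h4 : ∀ τ ∈ V, Integrable (fun x => ‖x‖ ^ 4 * Real.exp ⟪τ, x⟫) μ) {τ : Vec d} (hτ : τ ∈ V) :
    HasFDerivAt (mgf μ) (∫ x, Real.exp ⟪τ, x⟫ • innerSL ℝ x ∂μ) τ := by
  obtain ⟨ρ, hρ, _, hint⟩ := exists_integrable_norm_pow_mul_exp_add hd hV h4 hτ
  have h := hasFDerivAt_integral_exp_smul (g := fun _ : Vec d => (1 : ℝ)) continuous_const (k := 0)
    (fun x => by simp) hρ (hint 0 (by norm_num)) (hint 1 (by norm_num))
  have h1 : (fun σ : Vec d => ∫ x, Real.exp ⟪σ, x⟫ • (1 : ℝ) ∂μ) = mgf μ := by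
    funext σ; simp [mgf]
  have h2 : ∀ x : Vec d, (innerSL ℝ x).smulRight (1 : ℝ) = innerSL ℝ x := by
    intro x; ext y; simp
  simp only [h2] at h
  rwa [h1] at h

lemma hasFDerivAt_fderiv_mgf (hd : 1 ≤ d) (hV : IsOpen V)
    (h4 : ∀ τ ∈ V, Integrable (fun x => ‖x‖ ^ 4 * Real.exp ⟪τ, x⟫) μ) {τ : Vec d} (hτ : τ ∈ V) :
    HasFDerivAt (fun σ : Vec d => ∫ x, Real.exp ⟪σ, x⟫ • innerSL ℝ x ∂μ)
      (∫ x, Real.exp ⟪τ, x⟫ • (innerSL ℝ x).smulRight (innerSL ℝ x) ∂μ) τ := by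
  obtain ⟨ρ, hρ, _, hint⟩ := exists_integrable_norm_pow_mul_exp_add hd hV h4 hτ
  exact hasFDerivAt_integral_exp_smul (g := fun x : Vec d => innerSL ℝ x) (innerSL ℝ).continuous
    (k := 1) (fun x => by simp) hρ (hint 1 (by norm_num)) (hint 2 (by norm_num))

lemma integral_exp_smul_innerSL_apply {τ : Vec d}
    (h4 : Integrable (fun x => ‖x‖ ^ 4 * Real.exp ⟪τ, x⟫) μ) (s : Vec d) :
    (∫ x, Real.exp ⟪τ, x⟫ • innerSL ℝ x ∂μ) s = mgf μ τ * ∫ x, ⟪x, s⟫ ∂(tiltedLaw μ τ) := by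
  have hint : Integrable (fun x => Real.exp ⟪τ, x⟫ • innerSL ℝ x) μ := by
    refine (integrable_norm_pow_mul_exp_of_four h4 (k := 1) (by norm_num)).mono'
      (Continuous.aestronglyMeasurable (by fun_prop)) (Filter.Eventually.of_forall fun x => ?_)
    rw [norm_smul, innerSL_apply_norm, Real.norm_of_nonneg (Real.exp_nonneg _), mul_comm, pow_one]
  rw [ContinuousLinearMap.integral_apply hint, integral_tiltedLaw, smul_eq_mul, ← mul_assoc,
    mul_inv_cancel₀ (mgf_pos h4).ne', one_mul]
  rfl

lemma integral_exp_smul_smulRight_apply_left {F : Type*} [NormedAddCommGroup F] [NormedSpace ℝ F]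
    [CompleteSpace F] [SecondCountableTopology F] {g : Vec d → F} (hg : Continuous g)
    (hgb : ∀ x, ‖g x‖ = ‖x‖) {τ : Vec d}
    (h4 : Integrable (fun x => ‖x‖ ^ 4 * Real.exp ⟪τ, x⟫) μ) (s : Vec d) :
    (∫ x, Real.exp ⟪τ, x⟫ • (innerSL ℝ x).smulRight (g x) ∂μ) s =
      ∫ x, Real.exp ⟪τ, x⟫ • (⟪x, s⟫ • g x) ∂μ := by
  have hcont : Continuous fun x : Vec d => (innerSL ℝ x).smulRight (g x) :=
    (ContinuousLinearMap.smulRightL ℝ (Vec d) F).continuous₂.comp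
      ((innerSL ℝ).continuous.prodMk hg)
  have hint : Integrable (fun x => Real.exp ⟪τ, x⟫ • (innerSL ℝ x).smulRight (g x)) μ := by
    refine (integrable_norm_pow_mul_exp_of_four h4 (k := 2) (by norm_num)).mono'
      (Continuous.aestronglyMeasurable (by fun_prop)) (Filter.Eventually.of_forall fun x => ?_)
    rw [norm_smul, ContinuousLinearMap.norm_smulRight_apply, innerSL_apply_norm, hgb,
      Real.norm_of_nonneg (Real.exp_nonneg _), mul_comm, sq]
  rw [ContinuousLinearMap.integral_apply hint]
  rfl

lemma integral_exp_smul_smulRight_apply {τ : Vec d}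
    (h4 : Integrable (fun x => ‖x‖ ^ 4 * Real.exp ⟪τ, x⟫) μ) (s t : Vec d) :
    (∫ x, Real.exp ⟪τ, x⟫ • (innerSL ℝ x).smulRight (innerSL ℝ x) ∂μ) s t =
      mgf μ τ * ∫ x, ⟪x, s⟫ * ⟪x, t⟫ ∂(tiltedLaw μ τ) := by
  rw [integral_exp_smul_smulRight_apply_left (g := fun x : Vec d => innerSL ℝ x)
    (innerSL ℝ).continuous (fun x => by simp) h4 s]
  have hint : Integrable (fun x => Real.exp ⟪τ, x⟫ • (⟪x, s⟫ • innerSL ℝ x)) μ := by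
    refine ((integrable_norm_pow_mul_exp_of_four h4 (k := 2) (by norm_num)).const_mul ‖s‖).mono'
      (Continuous.aestronglyMeasurable (by fun_prop)) (Filter.Eventually.of_forall fun x => ?_)
    rw [norm_smul, norm_smul, innerSL_apply_norm, Real.norm_of_nonneg (Real.exp_nonneg _)]
    have h := norm_inner_le_norm (𝕜 := ℝ) x s
    calc Real.exp ⟪τ, x⟫ * (‖⟪x, s⟫‖ * ‖x‖) ≤ Real.exp ⟪τ, x⟫ * (‖x‖ * ‖s‖ * ‖x‖) := by gcongr
      _ = _ := by ring
  rw [ContinuousLinearMap.integral_apply hint, integral_tiltedLaw, smul_eq_mul, ← mul_assoc,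
    mul_inv_cancel₀ (mgf_pos h4).ne', one_mul]
  rfl

lemma hasFDerivAt_cgf (hd : 1 ≤ d) (hV : IsOpen V)
    (h4 : ∀ τ ∈ V, Integrable (fun x => ‖x‖ ^ 4 * Real.exp ⟪τ, x⟫) μ) {τ : Vec d} (hτ : τ ∈ V) :
    HasFDerivAt (cgf μ) ((mgf μ τ)⁻¹ • ∫ x, Real.exp ⟪τ, x⟫ • innerSL ℝ x ∂μ) τ :=
  (hasFDerivAt_mgf hd hV h4 hτ).log (mgf_pos (h4 τ hτ)).ne'

/-- The gradient of the cumulant generating function is the mean of the tilted law. -/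
lemma integral_inner_tiltedLaw (hd : 1 ≤ d) (hV : IsOpen V)
    (h4 : ∀ τ ∈ V, Integrable (fun x => ‖x‖ ^ 4 * Real.exp ⟪τ, x⟫) μ) {τ : Vec d} (hτ : τ ∈ V)
    (s : Vec d) : ∫ x, ⟪x, s⟫ ∂(tiltedLaw μ τ) = ⟪gradient (cgf μ) τ, s⟫ := by
  have h := (hasFDerivAt_cgf hd hV h4 hτ).fderiv
  rw [gradient, InnerProductSpace.toDual_symm_apply, h, smul_apply,
    integral_exp_smul_innerSL_apply (h4 τ hτ), smul_eq_mul, ← mul_assoc,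
    inv_mul_cancel₀ (mgf_pos (h4 τ hτ)).ne', one_mul]

/-- The Hessian of the cumulant generating function is the covariance of the tilted law. -/
lemma iteratedFDeriv_two_cgf (hd : 1 ≤ d) (hV : IsOpen V)
    (h4 : ∀ τ ∈ V, Integrable (fun x => ‖x‖ ^ 4 * Real.exp ⟪τ, x⟫) μ) {τ : Vec d} (hτ : τ ∈ V)
    (m : Fin 2 → Vec d) :
    iteratedFDeriv ℝ 2 (cgf μ) τ m = (∫ x, ⟪x, m 0⟫ * ⟪x, m 1⟫ ∂(tiltedLaw μ τ)) -
      (∫ x, ⟪x, m 0⟫ ∂(tiltedLaw μ τ)) * ∫ x, ⟪x, m 1⟫ ∂(tiltedLaw μ τ) := by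
  have hpos := mgf_pos (h4 τ hτ)
  rw [iteratedFDeriv_two_of_logDeriv (𝕜 := ℝ)
    (by filter_upwards [hV.mem_nhds hτ] with σ hσ using hasFDerivAt_cgf hd hV h4 hσ)
    (hasFDerivAt_mgf hd hV h4 hτ) (hasFDerivAt_fderiv_mgf hd hV h4 hτ) hpos.ne',
    integral_exp_smul_smulRight_apply (h4 τ hτ), integral_exp_smul_innerSL_apply (h4 τ hτ),
    integral_exp_smul_innerSL_apply (h4 τ hτ)]
  field_simp

/-- The Hessian matrix represents the second derivative as a bilinear form. -/
lemma inner_toEuclideanCLM_hess (s t : Vec d) (τ : Vec d) :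
    ⟪s, Matrix.toEuclideanCLM (n := Fin d) (𝕜 := ℝ) (hess μ τ) t⟫ =
      iteratedFDeriv ℝ 2 (cgf μ) τ ![s, t] := by
  set B := fderiv ℝ (fderiv ℝ (cgf μ)) τ with hB
  have hBapp : ∀ u v : Vec d, iteratedFDeriv ℝ 2 (cgf μ) τ ![u, v] = B u v := by
    intro u v; rw [iteratedFDeriv_two_apply]; simp [hB]
  have hexp : ∀ u : Vec d, u = ∑ i, u i • EuclideanSpace.single i (1 : ℝ) := by
    intro u
    have h := (EuclideanSpace.basisFun (Fin d) ℝ).sum_repr u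
    simpa using h.symm
  rw [hBapp]
  conv_rhs => rw [hexp s, hexp t]
  rw [Matrix.inner_toEuclideanCLM]
  simp only [map_sum, map_smul, sum_apply, smul_apply, smul_eq_mul,
    dotProduct, Matrix.mulVec, hess, Matrix.of_apply, hBapp]
  simp only [Finset.mul_sum]
  rw [Finset.sum_comm]
  refine Finset.sum_congr rfl fun j _ => Finset.sum_congr rfl fun i _ => ?_
  ring

end Derivatives

section WhitenedLaw

/-- The tilted law after the linear change of variables `x ↦ H(τ) ^ (-1/2) x`; its covariance is
the identity. -/
noncomputable def whitenedLaw (μ : Measure (Vec d)) (τ : Vec d) : Measure (Vec d) :=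
  (tiltedLaw μ τ).map (invSqrtCLM (hess μ τ))

variable {V : Set (Vec d)} {τ : Vec d}

lemma isProbabilityMeasure_whitenedLaw
    (h4 : Integrable (fun x => ‖x‖ ^ 4 * Real.exp ⟪τ, x⟫) μ) :
    IsProbabilityMeasure (whitenedLaw μ τ) :=
  have := isProbabilityMeasure_tiltedLaw h4
  Measure.isProbabilityMeasure_map (by fun_prop)

lemma memLp_four_whitenedLaw (h4 : Integrable (fun x => ‖x‖ ^ 4 * Real.exp ⟪τ, x⟫) μ) :
    MemLp id 4 (whitenedLaw μ τ) := by
  rw [whitenedLaw, memLp_map_measure_iff (by fun_prop) (by fun_prop)]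
  exact (invSqrtCLM (hess μ τ)).comp_memLp' (memLp_four_tiltedLaw h4)

/-- In the whitened variable, the moment generating function on the imaginary line through `τ` is a
multiple of the characteristic function of the whitened law. -/
lemma mgfC_whiten_eq (h4 : Integrable (fun x => ‖x‖ ^ 4 * Real.exp ⟪τ, x⟫) μ) (t : Vec d) :
    mgfC μ τ (whiten μ τ t) = mgf μ τ * charFun (whitenedLaw μ τ) t := by
  rw [mgfC_eq _ _ h4, whitenedLaw, charFun_apply, charFun_apply,
    integral_map (by fun_prop) (by fun_prop)]
  simp_rw [inner_invSqrtCLM]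
  rfl

lemma integral_inner_whitenedLaw (hd : 1 ≤ d) (hV : IsOpen V)
    (h4 : ∀ τ ∈ V, Integrable (fun x => ‖x‖ ^ 4 * Real.exp ⟪τ, x⟫) μ) (hτ : τ ∈ V) (s : Vec d) :
    ∫ y, ⟪y, s⟫ ∂(whitenedLaw μ τ) = ⟪invSqrtCLM (hess μ τ) (gradient (cgf μ) τ), s⟫ := by
  rw [whitenedLaw, integral_map (by fun_prop) (by fun_prop)]
  simp_rw [inner_invSqrtCLM]
  rw [integral_inner_tiltedLaw hd hV h4 hτ]

lemma integral_inner_mul_inner_whitenedLaw (hd : 1 ≤ d) (hV : IsOpen V)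
    (h4 : ∀ τ ∈ V, Integrable (fun x => ‖x‖ ^ 4 * Real.exp ⟪τ, x⟫) μ) (hτ : τ ∈ V)
    (hH : (hess μ τ).PosDef) (s t : Vec d) :
    ∫ y, ⟪y, s⟫ * ⟪y, t⟫ ∂(whitenedLaw μ τ) = ⟪s, t⟫ +
      ⟪invSqrtCLM (hess μ τ) (gradient (cgf μ) τ), s⟫ *
        ⟪invSqrtCLM (hess μ τ) (gradient (cgf μ) τ), t⟫ := by
  rw [whitenedLaw, integral_map (by fun_prop) (by fun_prop)]
  simp_rw [inner_invSqrtCLM]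
  rw [← inner_invSqrtCLM_apply_invSqrtCLM hH s t, inner_toEuclideanCLM_hess, iteratedFDeriv_two_cgf hd hV h4 hτ]
  simp only [Matrix.cons_val_zero, Matrix.cons_val_one]
  rw [integral_inner_tiltedLaw hd hV h4 hτ, integral_inner_tiltedLaw hd hV h4 hτ]
  ring

lemma integral_norm_pow_four_whitenedLaw_le
    (h4 : Integrable (fun x => ‖x‖ ^ 4 * Real.exp ⟪τ, x⟫) μ) :
    ∫ y, ‖y‖ ^ 4 ∂(whitenedLaw μ τ) ≤
      ‖invSqrtCLM (hess μ τ)‖ ^ 4 * ((∫ x, ‖x‖ ^ 4 * Real.exp ⟪τ, x⟫ ∂μ) / mgf μ τ) := by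
  rw [whitenedLaw, integral_map (by fun_prop) (by fun_prop)]
  have h := integrable_norm_pow_four_tiltedLaw h4
  calc ∫ x, ‖invSqrtCLM (hess μ τ) x‖ ^ 4 ∂(tiltedLaw μ τ)
      ≤ ∫ x, ‖invSqrtCLM (hess μ τ)‖ ^ 4 * ‖x‖ ^ 4 ∂(tiltedLaw μ τ) := by
        refine integral_mono_of_nonneg (Filter.Eventually.of_forall fun x => by positivity)
          (h.const_mul _) (Filter.Eventually.of_forall fun x => ?_)
        simp only
        rw [← mul_pow]
        gcongr
        exact (invSqrtCLM (hess μ τ)).le_opNorm x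
    _ = _ := by
        rw [integral_const_mul, integral_tiltedLaw τ (fun x : Vec d => ‖x‖ ^ 4), smul_eq_mul,
          div_eq_inv_mul]
        simp only [smul_eq_mul, mul_comm]

/-- The fourth moment of the whitened law is at least one, as its second moment in a fixed direction
is. -/
lemma one_le_integral_norm_pow_four_whitenedLaw (hd : 1 ≤ d) (hV : IsOpen V)
    (h4 : ∀ τ ∈ V, Integrable (fun x => ‖x‖ ^ 4 * Real.exp ⟪τ, x⟫) μ) (hτ : τ ∈ V)
    (hH : (hess μ τ).PosDef) : 1 ≤ ∫ y, ‖y‖ ^ 4 ∂(whitenedLaw μ τ) := by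
  have := isProbabilityMeasure_whitenedLaw (h4 τ hτ)
  -- any unit vector serves as the direction
  set e : Vec d := EuclideanSpace.single ⟨0, by omega⟩ 1 with he
  have hen : ‖e‖ = 1 := by simp [he]
  have h2 := integral_inner_mul_inner_whitenedLaw hd hV h4 hτ hH e e
  have hint : Integrable (fun y : Vec d => ‖y‖ ^ 4) (whitenedLaw μ τ) :=
    MemLp.integrable_norm_pow' (p := 4) (memLp_four_whitenedLaw (h4 τ hτ))
  have h5 : ∫ y, ⟪y, e⟫ * ⟪y, e⟫ ∂(whitenedLaw μ τ) ≤
      ∫ y, (1 / 2 + ‖y‖ ^ 4 / 2) ∂(whitenedLaw μ τ) := by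
    refine integral_mono_of_nonneg (Filter.Eventually.of_forall fun y => mul_self_nonneg _)
      ((integrable_const _).add (hint.div_const 2)) (Filter.Eventually.of_forall fun y => ?_)
    simp only
    have h6 : |⟪y, e⟫| ≤ ‖y‖ := by simpa [hen] using abs_real_inner_le_norm y e
    have h7 : ⟪y, e⟫ * ⟪y, e⟫ ≤ ‖y‖ ^ 2 := by
      rw [← sq, ← sq_abs]; exact pow_le_pow_left₀ (abs_nonneg _) h6 2
    nlinarith [sq_nonneg (‖y‖ ^ 2 - 1)]
  have h8 : ∫ y, ‖y‖ ^ 4 / 2 ∂(whitenedLaw μ τ) = (∫ y, ‖y‖ ^ 4 ∂(whitenedLaw μ τ)) / 2 :=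
    integral_div _ _
  rw [integral_add (integrable_const _) (hint.div_const 2), h8] at h5
  simp only [integral_const, probReal_univ, one_smul] at h5
  rw [h2, real_inner_self_eq_norm_sq, hen] at h5
  nlinarith [mul_self_nonneg ⟪invSqrtCLM (hess μ τ) (gradient (cgf μ) τ), e⟫]

end WhitenedLaw

end Cumulants

/-! ### Consequences of the regularity assumptions -/

section Regularity

open Topology

variable {d n : ℕ} {μ : Measure (Vec d)} {V : Set (Vec d)} {κ δ : ℝ} {τ : Vec d}

lemma exists_moment_bound (h : Regular μ V n κ δ) :
    ∃ M : ℝ, ∀ τ ∈ V, Integrable (fun x => ‖x‖ ^ 4 * Real.exp ⟪τ, x⟫) μ ∧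
      ∫ x, ‖x‖ ^ 4 * Real.exp ⟪τ, x⟫ ∂μ ≤ M := by
  refine ⟨(⨆ τ ∈ V, ∫⁻ x, ENNReal.ofReal (‖x‖ ^ 4 * Real.exp ⟪τ, x⟫) ∂μ).toReal,
    fun τ hτ => ?_⟩
  have hle : ∫⁻ x, ENNReal.ofReal (‖x‖ ^ 4 * Real.exp ⟪τ, x⟫) ∂μ ≤
      ⨆ τ ∈ V, ∫⁻ x, ENNReal.ofReal (‖x‖ ^ 4 * Real.exp ⟪τ, x⟫) ∂μ :=
    le_iSup₂ (f := fun τ (_ : τ ∈ V) =>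
      ∫⁻ x, ENNReal.ofReal (‖x‖ ^ 4 * Real.exp ⟪τ, x⟫) ∂μ) τ hτ
  have hnn : 0 ≤ᵐ[μ] fun x => ‖x‖ ^ 4 * Real.exp ⟪τ, x⟫ :=
    Filter.Eventually.of_forall fun x => by positivity
  have hm : AEStronglyMeasurable (fun x => ‖x‖ ^ 4 * Real.exp ⟪τ, x⟫) μ :=
    Continuous.aestronglyMeasurable (by fun_prop)
  refine ⟨⟨hm, ?_⟩, ?_⟩
  · rw [hasFiniteIntegral_iff_ofReal hnn]
    exact hle.trans_lt h.moments
  · rw [integral_eq_lintegral_of_nonneg_ae hnn hm]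
    exact ENNReal.toReal_mono h.moments.ne hle

lemma integrable_moment (h : Regular μ V n κ δ) (τ : Vec d) (hτ : τ ∈ V) :
    Integrable (fun x => ‖x‖ ^ 4 * Real.exp ⟪τ, x⟫) μ :=
  have ⟨_, hM⟩ := exists_moment_bound h
  (hM τ hτ).1

lemma radius_pos (hd : 1 ≤ d) (hn : 1 ≤ n) : 0 < radius d n := by
  have h1 : (0 : ℝ) < d := by exact_mod_cast hd
  have h2 : (0 : ℝ) < n := by exact_mod_cast hn
  unfold radius
  positivity

variable [IsProbabilityMeasure μ]

/-- The phase and modulus conditions keep the characteristic function of the whitened law away from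
the cut of the logarithm. -/
lemma charFun_whitenedLaw_mem (h : Regular μ V n κ δ) (hδ : 0 < δ) (hτ : τ ∈ V) {t : Vec d}
    (ht : ‖t‖ ≤ radius d n) :
    charFun (whitenedLaw μ τ) t ∈ Complex.slitPlane ∧
      δ / mgf μ τ ≤ ‖charFun (whitenedLaw μ τ) t‖ ∧
      |(charFun (whitenedLaw μ τ) t).arg| ≤ Real.pi - δ := by
  have h4 := integrable_moment h τ hτ
  have hpos := mgf_pos h4
  have h1 := h.modulus τ hτ t ht
  have h2 := h.phase τ hτ t ht
  rw [mgfC_whiten_eq h4] at h1 h2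
  rw [Complex.arg_real_mul _ hpos] at h2
  rw [norm_mul, Complex.norm_real, Real.norm_of_nonneg hpos.le] at h1
  have h3 : δ / mgf μ τ ≤ ‖charFun (whitenedLaw μ τ) t‖ := by
    rw [div_le_iff₀ hpos, mul_comm]; exact h1
  refine ⟨?_, h3, h2⟩
  rw [Complex.mem_slitPlane_iff_arg]
  refine ⟨fun h5 => ?_, fun h5 => ?_⟩
  · rw [h5, abs_of_pos Real.pi_pos] at h2
    linarith
  · rw [h5, norm_zero] at h3
    have : 0 < δ / mgf μ τ := by positivity
    linarith

/-- The lower bound on the modulus, at the origin. -/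
lemma le_mgf (h : Regular μ V n κ δ) (hτ : τ ∈ V) : δ ≤ mgf μ τ := by
  have h4 := integrable_moment h τ hτ
  have := isProbabilityMeasure_whitenedLaw h4
  have h1 := h.modulus τ hτ 0 (by rw [norm_zero]; unfold radius; positivity)
  rwa [mgfC_whiten_eq h4, charFun_zero, probReal_univ, Complex.ofReal_one, mul_one,
    Complex.norm_real, Real.norm_of_nonneg (mgf_pos h4).le] at h1

/-- The regularity assumptions bound, uniformly over `V`, all derivatives of order at most four of
the logarithm of the characteristic function of the whitened law. -/
lemma exists_bound_iteratedFDeriv (hd : 1 ≤ d) (h : Regular μ V n κ δ) (hδ : 0 < δ) :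
    ∃ C : ℝ, ∀ τ ∈ V, ∀ t ∈ Metric.ball (0 : Vec d) (radius d n), ∀ k ≤ 4,
      ‖iteratedFDeriv ℝ k (fun t => Complex.log (charFun (whitenedLaw μ τ) t)) t‖ ≤ C := by
  obtain ⟨M, hM⟩ := exists_moment_bound h
  obtain ⟨K, hK⟩ := h.inv_bdd
  have h4 := integrable_moment h
  have hW : ∀ τ ∈ V, ‖invSqrtCLM (hess μ τ)‖ ^ 4 ≤ K ^ 2 := by
    intro τ hτ
    have h1 : ‖invSqrtCLM (hess μ τ)‖ ^ 2 ≤ K := by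
      rw [norm_invSqrtCLM_sq (h.posDef τ hτ)]
      exact hK (Set.mem_image_of_mem _ hτ)
    calc ‖invSqrtCLM (hess μ τ)‖ ^ 4 = (‖invSqrtCLM (hess μ τ)‖ ^ 2) ^ 2 := by ring
      _ ≤ K ^ 2 := by gcongr
  have hM0 : 0 ≤ M :=
    le_trans (integral_nonneg fun x => by positivity) (hM 0 h.zero_mem).2
  have hI : ∀ τ ∈ V, ∫ y, ‖y‖ ^ 4 ∂(whitenedLaw μ τ) ≤ K ^ 2 * (M / mgf μ τ) := by
    intro τ hτ
    refine (integral_norm_pow_four_whitenedLaw_le (h4 τ hτ)).trans ?_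
    have := mgf_pos (h4 τ hτ)
    have h3 : 0 ≤ (∫ x, ‖x‖ ^ 4 * Real.exp ⟪τ, x⟫ ∂μ) / mgf μ τ :=
      div_nonneg (integral_nonneg fun x => by positivity) this.le
    gcongr
    · exact hW τ hτ
    · exact (hM τ hτ).2
  -- a large value of the moment generating function would make the whitened fourth moment less
  -- than one
  have hmgf : ∀ τ ∈ V, mgf μ τ ≤ K ^ 2 * M := by
    intro τ hτ
    have h1 := (one_le_integral_norm_pow_four_whitenedLaw hd h.isOpen h4 hτ
      (h.posDef τ hτ)).trans (hI τ hτ)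
    rwa [← mul_div_assoc, le_div_iff₀ (mgf_pos (h4 τ hτ)), one_mul] at h1
  have hKM : 0 < K ^ 2 * M := (mgf_pos (h4 0 h.zero_mem)).trans_le (hmgf 0 h.zero_mem)
  obtain ⟨C, hC⟩ := exists_bound_iteratedFDeriv_log_charFun (ρ := δ / (K ^ 2 * M))
    (by positivity) hδ (K ^ 2 * (M / δ))
  refine ⟨C, fun τ hτ => ?_⟩
  have := isProbabilityMeasure_whitenedLaw (h4 τ hτ)
  have hpos := mgf_pos (h4 τ hτ)
  refine hC (Vec d) (whitenedLaw μ τ) (memLp_four_whitenedLaw (h4 τ hτ)) ((hI τ hτ).trans ?_)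
    _ Metric.isOpen_ball fun t ht => ?_
  · gcongr
    exact le_mgf h hτ
  · obtain ⟨h1, h2, h3⟩ := charFun_whitenedLaw_mem h hδ hτ (mem_ball_zero_iff.mp ht).le
    refine ⟨h1, le_trans ?_ h2, h3⟩
    gcongr
    exact hmgf τ hτ

lemma cgfC_whiten_eq (h : Regular μ V n κ δ) (hδ : 0 < δ) (hτ : τ ∈ V) {t : Vec d}
    (ht : ‖t‖ ≤ radius d n) :
    cgfC μ τ (whiten μ τ t) =
      Real.log (mgf μ τ) + Complex.log (charFun (whitenedLaw μ τ) t) := by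
  have h4 := integrable_moment h τ hτ
  rw [cgfC, mgfC_whiten_eq h4, Complex.log_ofReal_mul (mgf_pos h4)
    (Complex.slitPlane_ne_zero (charFun_whitenedLaw_mem h hδ hτ ht).1)]

lemma iteratedFDeriv_im_cgfC_whiten (h : Regular μ V n κ δ) (hδ : 0 < δ) (hτ : τ ∈ V) {t : Vec d}
    (ht : t ∈ Metric.ball (0 : Vec d) (radius d n)) (k : ℕ) :
    iteratedFDeriv ℝ k (fun u => (cgfC μ τ (whiten μ τ u)).im) t =
      iteratedFDeriv ℝ k (fun u => (Complex.log (charFun (whitenedLaw μ τ) u)).im) t := by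
  refine (Filter.EventuallyEq.iteratedFDeriv ℝ ?_ k).self_of_nhds
  filter_upwards [Metric.isOpen_ball.mem_nhds ht] with u hu
  rw [cgfC_whiten_eq h hδ hτ (mem_ball_zero_iff.mp hu).le]
  simp

lemma contDiffOn_log_charFun_whitenedLaw (h : Regular μ V n κ δ) (hδ : 0 < δ) (hτ : τ ∈ V) :
    ContDiffOn ℝ 4 (fun t => Complex.log (charFun (whitenedLaw μ τ) t))
      (Metric.ball (0 : Vec d) (radius d n)) := by
  have h4 := integrable_moment h τ hτ
  have := isProbabilityMeasure_whitenedLaw h4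
  exact contDiffOn_log_charFun (memLp_four_whitenedLaw h4) fun t ht =>
    (charFun_whitenedLaw_mem h hδ hτ (mem_ball_zero_iff.mp ht).le).1

lemma iteratedFDeriv_re_cgfC_whiten (h : Regular μ V n κ δ) (hδ : 0 < δ) (hτ : τ ∈ V) {t : Vec d}
    (ht : t ∈ Metric.ball (0 : Vec d) (radius d n)) :
    iteratedFDeriv ℝ 4 (fun u => (cgfC μ τ (whiten μ τ u)).re) t =
      iteratedFDeriv ℝ 4 (fun u => (Complex.log (charFun (whitenedLaw μ τ) u)).re) t := by
  have h1 : (fun u => (cgfC μ τ (whiten μ τ u)).re) =ᶠ[𝓝 t]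
      (fun _ => Real.log (mgf μ τ)) +
        fun u => (Complex.log (charFun (whitenedLaw μ τ) u)).re := by
    filter_upwards [Metric.isOpen_ball.mem_nhds ht] with u hu
    rw [cgfC_whiten_eq h hδ hτ (mem_ball_zero_iff.mp hu).le]
    simp
  have h2 : ContDiffAt ℝ (4 : ℕ) (fun u => (Complex.log (charFun (whitenedLaw μ τ) u)).re) t :=
    Complex.reCLM.contDiff.contDiffAt.comp t
      ((contDiffOn_log_charFun_whitenedLaw h hδ hτ).contDiffAt (Metric.isOpen_ball.mem_nhds ht))
  rw [(Filter.EventuallyEq.iteratedFDeriv ℝ h1 4).self_of_nhds,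
    iteratedFDeriv_add_apply contDiffAt_const h2, iteratedFDeriv_const_of_ne (by norm_num)]
  simp

lemma bddAbove_thirdDerivNorms (hd : 1 ≤ d) (h : Regular μ V n κ δ) (hδ : 0 < δ) :
    BddAbove (thirdDerivNorms μ V n) := by
  obtain ⟨C, hC⟩ := exists_bound_iteratedFDeriv hd h hδ
  refine ⟨C, ?_⟩
  rintro r ⟨τ, hτ, t, ht, rfl⟩
  have htb : t ∈ Metric.ball (0 : Vec d) (radius d n) := mem_ball_zero_iff.mpr ht
  rw [iteratedFDeriv_im_cgfC_whiten h hδ hτ htb]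
  refine le_trans ?_ (hC τ hτ t htb 3 (by norm_num))
  have h1 := Complex.imCLM.norm_iteratedFDeriv_comp_left (n := 3)
    ((contDiffOn_log_charFun_whitenedLaw h hδ hτ).contDiffAt (Metric.isOpen_ball.mem_nhds htb))
    (by norm_cast)
  rwa [Complex.imCLM_norm, one_mul] at h1

lemma bddAbove_fourthDerivNorms (hd : 1 ≤ d) (h : Regular μ V n κ δ) (hδ : 0 < δ) :
    BddAbove (fourthDerivNorms μ V n) := by
  obtain ⟨C, hC⟩ := exists_bound_iteratedFDeriv hd h hδ
  refine ⟨C, ?_⟩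
  rintro r ⟨τ, hτ, t, ht, rfl⟩
  have htb : t ∈ Metric.ball (0 : Vec d) (radius d n) := mem_ball_zero_iff.mpr ht
  rw [iteratedFDeriv_re_cgfC_whiten h hδ hτ htb]
  refine le_trans ?_ (hC τ hτ t htb 4 le_rfl)
  have h1 := Complex.reCLM.norm_iteratedFDeriv_comp_left (n := 4)
    ((contDiffOn_log_charFun_whitenedLaw h hδ hτ).contDiffAt (Metric.isOpen_ball.mem_nhds htb))
    le_rfl
  rwa [Complex.reCLM_norm, one_mul] at h1

lemma c3_nonneg (μ : Measure (Vec d)) (V : Set (Vec d)) (n : ℕ) : 0 ≤ c3 μ V n :=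
  Real.sSup_nonneg (by rintro r ⟨_, _, _, _, rfl⟩; positivity)

lemma c4_nonneg (μ : Measure (Vec d)) (V : Set (Vec d)) (n : ℕ) : 0 ≤ c4 μ V n :=
  Real.sSup_nonneg (by rintro r ⟨_, _, _, _, rfl⟩; positivity)

lemma norm_iteratedFDeriv_im_le_c3 (hd : 1 ≤ d) (h : Regular μ V n κ δ) (hδ : 0 < δ) (hτ : τ ∈ V)
    {t : Vec d} (ht : t ∈ Metric.ball (0 : Vec d) (radius d n)) :
    ‖iteratedFDeriv ℝ 3 (fun u => (Complex.log (charFun (whitenedLaw μ τ) u)).im) t‖ ≤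
      c3 μ V n := by
  rw [← iteratedFDeriv_im_cgfC_whiten h hδ hτ ht]
  exact le_csSup (bddAbove_thirdDerivNorms hd h hδ) ⟨τ, hτ, t, mem_ball_zero_iff.mp ht, rfl⟩

lemma norm_iteratedFDeriv_re_le_c4 (hd : 1 ≤ d) (h : Regular μ V n κ δ) (hδ : 0 < δ) (hτ : τ ∈ V)
    {t : Vec d} (ht : t ∈ Metric.ball (0 : Vec d) (radius d n)) :
    ‖iteratedFDeriv ℝ 4 (fun u => (Complex.log (charFun (whitenedLaw μ τ) u)).re) t‖ ≤
      c4 μ V n := by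
  rw [← iteratedFDeriv_re_cgfC_whiten h hδ hτ ht]
  exact le_csSup (bddAbove_fourthDerivNorms hd h hδ) ⟨τ, hτ, t, mem_ball_zero_iff.mp ht, rfl⟩

end Regularity

/-! ### Laplace estimate for a perturbed Gaussian integrand -/

section LaplaceEstimate

lemma abs_exp_mul_cos_sub_one_le {x y b : ℝ} (hx : |x| ≤ b) :
    |Real.exp x * Real.cos y - 1| ≤ Real.exp b * (|x| + y ^ 2 / 2) := by
  have h1 : |Real.cos y - 1| ≤ y ^ 2 / 2 := by
    rw [abs_sub_comm, abs_of_nonneg (by linarith [Real.cos_le_one y])]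
    linarith [Real.one_sub_sq_div_two_le_cos (x := y)]
  have h2 : |Real.exp x - 1| ≤ |x| * Real.exp b := by
    have hb0 : 1 ≤ Real.exp b := Real.one_le_exp ((abs_nonneg x).trans hx)
    have h3 := Real.add_one_le_exp x
    have h4 := Real.add_one_le_exp (-x)
    have h5 : Real.exp x ≤ Real.exp b := Real.exp_le_exp.mpr ((le_abs_self x).trans hx)
    have h6 : Real.exp x * Real.exp (-x) = 1 := by rw [← Real.exp_add]; simp
    rw [abs_le]
    constructor
    · nlinarith [neg_abs_le x, abs_nonneg x]
    · have h7 : Real.exp x - 1 ≤ x * Real.exp x := by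
        nlinarith [Real.exp_pos x]
      have h8 : x * Real.exp x ≤ |x| * Real.exp b :=
        mul_le_mul (le_abs_self x) h5 (Real.exp_nonneg x) (abs_nonneg x)
      linarith
  have h3 : Real.exp x ≤ Real.exp b := Real.exp_le_exp.mpr ((le_abs_self x).trans hx)
  calc |Real.exp x * Real.cos y - 1|
      = |Real.exp x * (Real.cos y - 1) + (Real.exp x - 1)| := by ring_nf
    _ ≤ |Real.exp x * (Real.cos y - 1)| + |Real.exp x - 1| := abs_add_le _ _
    _ = Real.exp x * |Real.cos y - 1| + |Real.exp x - 1| := by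
        rw [abs_mul, abs_of_pos (Real.exp_pos x)]
    _ ≤ Real.exp b * (y ^ 2 / 2) + |x| * Real.exp b := by gcongr
    _ = _ := by ring

variable {E : Type*} [NormedAddCommGroup E] [InnerProductSpace ℝ E] [FiniteDimensional ℝ E]
  [MeasurableSpace E] [BorelSpace E]

open Module

lemma setLIntegral_gaussianLaw (N : ℝ) {s : Set E} (hs : MeasurableSet s) {g : E → ENNReal}
    (hg : Measurable g) :
    ∫⁻ t in s, g t ∂(gaussianLaw E N) = ∫⁻ t in s, ENNReal.ofReal (gaussianWeight N t) * g t := by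
  rw [gaussianLaw, setLIntegral_withDensity_eq_setLIntegral_mul _ ?_ hg hs]
  · rfl
  · exact (continuous_gaussianWeight N).measurable.ennreal_ofReal

lemma gaussianLaw_apply (N : ℝ) {s : Set E} (hs : MeasurableSet s) :
    gaussianLaw E N s = ∫⁻ t in s, ENNReal.ofReal (gaussianWeight N t) := by
  rw [gaussianLaw, withDensity_apply _ hs]

lemma measurableSet_norm_sq_lt (a : ℝ) : MeasurableSet {t : E | ‖t‖ ^ 2 < a} :=
  (isOpen_lt (by fun_prop) continuous_const).measurableSet

/-- The integral of a Hermitian function over a centred ball is real. -/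
lemma integral_symm_eq_ofReal {f : E → ℂ} (hsymm : ∀ t, f (-t) = (starRingEnd ℂ) (f t)) (a : ℝ)
    (hf : Integrable f) :
    ∫ t in {t : E | ‖t‖ ^ 2 < a}, f t = ((∫ t in {t : E | ‖t‖ ^ 2 < a}, (f t).re : ℝ) : ℂ) := by
  set S := {t : E | ‖t‖ ^ 2 < a} with hS
  have hSm : MeasurableSet S := measurableSet_norm_sq_lt a
  have h1 : ∫ t in S, f t = (starRingEnd ℂ) (∫ t in S, f t) := by
    rw [← integral_conj, ← integral_indicator hSm, ← integral_indicator hSm,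
      ← integral_neg_eq_self (S.indicator f)]
    congr 1
    funext t
    by_cases ht : t ∈ S
    · rw [Set.indicator_of_mem (by simpa [hS] using ht), Set.indicator_of_mem ht, hsymm]
    · rw [Set.indicator_of_notMem (by simpa [hS] using ht), Set.indicator_of_notMem ht]
  obtain ⟨x, hx⟩ := Complex.conj_eq_iff_real.mp h1.symm
  have h2 : ∫ t in S, (f t).re = x := by
    have h3 : ∫ t in S, (f t).re = (∫ t in S, f t).re := integral_re (𝕜 := ℂ) hf.integrableOn
    rw [h3, hx, Complex.ofReal_re]
  rw [h2, hx]

section Estimate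

variable {N κ c₃ c₄ : ℝ} {f : E → ℂ} {r v : E → ℝ}

/-- The remainder of the Gaussian approximation stays bounded on the ball of radius
`5 / 2 * √(d / N)`. -/
lemma mul_abs_le_of_mem_ball (hN : 0 < N) (hc₄ : 0 ≤ c₄)
    (hr : ∀ t ∈ Metric.ball (0 : E) (5 / 2 * √(finrank ℝ E / N)), |r t| ≤ c₄ * ‖t‖ ^ 4) {t : E}
    (ht : t ∈ Metric.ball (0 : E) (5 / 2 * √(finrank ℝ E / N))) :
    |N * r t| ≤ 40 * c₄ * ((finrank ℝ E : ℝ) ^ 2 / N) := by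
  set D : ℝ := (finrank ℝ E : ℝ)
  have hD : 0 ≤ D := Nat.cast_nonneg _
  have h1 : ‖t‖ ^ 4 ≤ (5 / 2 * √(D / N)) ^ 4 := by
    gcongr; exact (mem_ball_zero_iff.mp ht).le
  have h2 : (5 / 2 * √(D / N)) ^ 4 = 625 / 16 * (D ^ 2 / N ^ 2) := by
    rw [mul_pow, show √(D / N) ^ 4 = (√(D / N) ^ 2) ^ 2 by ring, Real.sq_sqrt (by positivity)]
    ring
  rw [abs_mul, abs_of_pos hN]
  calc N * |r t| ≤ N * (c₄ * (625 / 16 * (D ^ 2 / N ^ 2))) := by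
        gcongr
        exact (hr t ht).trans (by rw [← h2]; gcongr)
    _ = 625 / 16 * c₄ * (D ^ 2 / N) := by field_simp
    _ ≤ 40 * c₄ * (D ^ 2 / N) := by gcongr; norm_num

lemma mem_ball_of_norm_sq_lt (hN : 0 < N) {t : E} (ht : ‖t‖ ^ 2 < 5 * finrank ℝ E / N) :
    t ∈ Metric.ball (0 : E) (5 / 2 * √(finrank ℝ E / N)) := by
  rw [mem_ball_zero_iff]
  refine lt_of_pow_lt_pow_left₀ 2 (by positivity) (ht.trans_le ?_)
  rw [mul_pow, Real.sq_sqrt (by positivity), mul_div_assoc]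
  gcongr
  norm_num

/-- A function `f` on a Euclidean space of dimension `d` which is Hermitian, is the exponential
`exp (-N / 2 * ‖t‖ ^ 2 + N * r t + I * N * v t)` with a small remainder `r` and a small odd phase `v`
on the ball of radius `5 / 2 * √(d / N)`, and decays outside of this ball. -/
structure NearGaussian (N κ c₃ c₄ : ℝ) (f : E → ℂ) (r v : E → ℝ) : Prop where
  continuous : Continuous f
  symm : ∀ t, f (-t) = (starRingEnd ℂ) (f t)
  eq_exp : ∀ t ∈ Metric.ball (0 : E) (5 / 2 * √(finrank ℝ E / N)), f t =
    Complex.exp (((-(N / 2) * ‖t‖ ^ 2 + N * r t : ℝ) : ℂ) + ((N * v t : ℝ) : ℂ) * Complex.I)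
  abs_le : ∀ t ∈ Metric.ball (0 : E) (5 / 2 * √(finrank ℝ E / N)), |r t| ≤ c₄ * ‖t‖ ^ 4
  measurable : Measurable v
  contDiffOn : ContDiffOn ℝ 1 v (Metric.ball (0 : E) (5 / 2 * √(finrank ℝ E / N)))
  odd : ∀ t ∈ Metric.ball (0 : E) (5 / 2 * √(finrank ℝ E / N)), v (-t) = -v t
  norm_fderiv_le : ∀ t ∈ Metric.ball (0 : E) (5 / 2 * √(finrank ℝ E / N)),
    ‖fderiv ℝ v t‖ ≤ c₃ * ‖t‖ ^ 2
  norm_le : ∀ t : E, 5 / 2 * √(finrank ℝ E / N) ≤ ‖t‖ →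
    ‖f t‖ ≤ Real.exp (-(√(finrank ℝ E / N) * ‖t‖ * N)) +
      (1 + ‖t‖) ^ (-(κ / √(finrank ℝ E) * N))

namespace NearGaussian

lemma mul_norm_le_of_mem_ball (hf : NearGaussian N κ c₃ c₄ f r v) (hN : 0 < N) (hc₄ : 0 ≤ c₄)
    {t : E} (ht : t ∈ Metric.ball (0 : E) (5 / 2 * √(finrank ℝ E / N))) :
    (N / (2 * Real.pi)) ^ ((finrank ℝ E : ℝ) / 2) * ‖f t‖ ≤
      Real.exp (40 * c₄ * ((finrank ℝ E : ℝ) ^ 2 / N)) * gaussianWeight N t := by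
  have h1 := Real.exp_le_exp.mpr
    (_root_.abs_le.mp (mul_abs_le_of_mem_ball hN hc₄ hf.abs_le ht)).2
  rw [hf.eq_exp t ht, Complex.norm_exp, gaussianWeight, Complex.add_re, Complex.re_ofReal_mul,
    Complex.I_re, mul_zero, add_zero, Complex.ofReal_re, Real.exp_add, ← mul_assoc, mul_comm]
  gcongr

lemma abs_mul_re_sub_gaussianWeight_le (hf : NearGaussian N κ c₃ c₄ f r v) (hN : 0 < N)
    (hc₄ : 0 ≤ c₄) {t : E} (ht : t ∈ Metric.ball (0 : E) (5 / 2 * √(finrank ℝ E / N))) :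
    |(N / (2 * Real.pi)) ^ ((finrank ℝ E : ℝ) / 2) * (f t).re - gaussianWeight N t| ≤
      gaussianWeight N t * (Real.exp (40 * c₄ * ((finrank ℝ E : ℝ) ^ 2 / N)) *
        (N * c₄ * ‖t‖ ^ 4 + N ^ 2 / 2 * v t ^ 2)) := by
  have h1 := mul_abs_le_of_mem_ball hN hc₄ hf.abs_le ht
  have h2 : (f t).re = Real.exp (-(N / 2) * ‖t‖ ^ 2) *
      (Real.exp (N * r t) * Real.cos (N * v t)) := by
    rw [hf.eq_exp t ht, Complex.exp_re]
    simp only [Complex.add_re, Complex.re_ofReal_mul, Complex.I_re, mul_zero, add_zero,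
      Complex.ofReal_re, Complex.add_im, Complex.ofReal_im, Complex.im_ofReal_mul, Complex.I_im,
      mul_one, zero_add]
    rw [Real.exp_add, mul_assoc]
  have h3 : (N / (2 * Real.pi)) ^ ((finrank ℝ E : ℝ) / 2) * (f t).re - gaussianWeight N t =
      gaussianWeight N t * (Real.exp (N * r t) * Real.cos (N * v t) - 1) := by
    rw [h2, gaussianWeight]; ring
  rw [h3, abs_mul, abs_of_nonneg (gaussianWeight_nonneg hN t)]
  refine mul_le_mul_of_nonneg_left ((abs_exp_mul_cos_sub_one_le h1).trans ?_)
    (gaussianWeight_nonneg hN t)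
  gcongr ?_ * (?_ + ?_)
  · rw [abs_mul, abs_of_pos hN, mul_assoc]
    gcongr
    exact hf.abs_le t ht
  · rw [mul_pow]; exact le_of_eq (by ring)

/-- Contribution of the ball of radius `√(5 d / N)`: the odd phase only enters through its square,
and the remainder through its absolute value. -/
lemma lintegral_abs_mul_re_sub_gaussianWeight_le (hf : NearGaussian N κ c₃ c₄ f r v) (hN : 0 < N)
    (hc₄ : 0 ≤ c₄) (hd : 1 ≤ finrank ℝ E) :
    ∫⁻ t in {t : E | ‖t‖ ^ 2 < 5 * finrank ℝ E / N}, ENNReal.ofReal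
      |(N / (2 * Real.pi)) ^ ((finrank ℝ E : ℝ) / 2) * (f t).re - gaussianWeight N t| ≤
    ENNReal.ofReal (64000 * (Real.exp (40 * c₄ * ((finrank ℝ E : ℝ) ^ 2 / N)) * (c₃ ^ 2 + c₄) *
      ((finrank ℝ E : ℝ) ^ 2 / N))) := by
  set D : ℝ := (finrank ℝ E : ℝ) with hD
  have hDpos : 0 < D := by rw [hD]; exact_mod_cast hd
  set L := Real.exp (40 * c₄ * (D ^ 2 / N)) with hL
  have hLpos : 0 < L := Real.exp_pos _
  set S := {t : E | ‖t‖ ^ 2 < 5 * D / N} with hS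
  have hSm : MeasurableSet S := measurableSet_norm_sq_lt _
  have hvm := hf.measurable
  have hm1 : Measurable fun t : E => ENNReal.ofReal (L * (N * c₄ * ‖t‖ ^ 4)) := by fun_prop
  have hm2 : Measurable fun t : E => ENNReal.ofReal (L * (N ^ 2 / 2 * v t ^ 2)) := by fun_prop
  calc ∫⁻ t in S, ENNReal.ofReal |(N / (2 * Real.pi)) ^ (D / 2) * (f t).re - gaussianWeight N t|
      ≤ ∫⁻ t in S, ENNReal.ofReal (gaussianWeight N t) *
          (ENNReal.ofReal (L * (N * c₄ * ‖t‖ ^ 4)) +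
            ENNReal.ofReal (L * (N ^ 2 / 2 * v t ^ 2))) := by
        refine setLIntegral_mono' hSm fun t ht => ?_
        rw [← ENNReal.ofReal_add (by positivity) (by positivity),
          ← ENNReal.ofReal_mul (gaussianWeight_nonneg hN t), ← mul_add]
        exact ENNReal.ofReal_le_ofReal
          (hf.abs_mul_re_sub_gaussianWeight_le hN hc₄ (mem_ball_of_norm_sq_lt hN ht))
    _ = (∫⁻ t in S, ENNReal.ofReal (L * (N * c₄ * ‖t‖ ^ 4)) ∂(gaussianLaw E N)) +
          ∫⁻ t in S, ENNReal.ofReal (L * (N ^ 2 / 2 * v t ^ 2)) ∂(gaussianLaw E N) := by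
        rw [← lintegral_add_left hm1]
        exact (setLIntegral_gaussianLaw N hSm (hm1.add hm2)).symm
    _ ≤ ENNReal.ofReal (L * (N * c₄)) * ENNReal.ofReal (64 * D ^ 2 / N ^ 2) +
          ENNReal.ofReal (L * (N ^ 2 / 2)) * ENNReal.ofReal (128000 * c₃ ^ 2 * D ^ 2 / N ^ 3) := by
        gcongr
        · refine (setLIntegral_le_lintegral _ _).trans ?_
          simp_rw [← mul_assoc]
          simp_rw [ENNReal.ofReal_mul (show 0 ≤ L * N * c₄ by positivity)]
          rw [lintegral_const_mul _ (by fun_prop)]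
          gcongr
          exact lintegral_gaussianLaw_norm_pow_four_le hN hd
        · simp_rw [← mul_assoc]
          simp_rw [ENNReal.ofReal_mul (show 0 ≤ L * (N ^ 2 / 2) by positivity)]
          rw [lintegral_const_mul _ (by fun_prop)]
          gcongr
          refine lintegral_sq_le_of_odd hN hd (R := 5 / 2 * √(D / N)) (by positivity) ?_
            hf.contDiffOn hvm hf.odd hf.norm_fderiv_le
          rw [mul_pow, Real.sq_sqrt (by positivity)]
          ring
    _ ≤ _ := by
        rw [← ENNReal.ofReal_mul (by positivity), ← ENNReal.ofReal_mul (by positivity),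
          ← ENNReal.ofReal_add (by positivity) (by positivity)]
        apply ENNReal.ofReal_le_ofReal
        have h1 : L * (N * c₄) * (64 * D ^ 2 / N ^ 2) = 64 * (L * c₄ * (D ^ 2 / N)) := by
          field_simp
        have h2 : L * (N ^ 2 / 2) * (128000 * c₃ ^ 2 * D ^ 2 / N ^ 3) =
            64000 * (L * c₃ ^ 2 * (D ^ 2 / N)) := by
          field_simp; ring
        rw [h1, h2]
        have h3 : 0 ≤ L * c₄ * (D ^ 2 / N) := by positivity
        nlinarith

/-- Contribution of the complement of the ball of radius `√(5 d / N)`. -/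
lemma lintegral_compl_le (hf : NearGaussian N κ c₃ c₄ f r v) (hN : 0 < N) (hκ : 0 < κ)
    (hc₄ : 0 ≤ c₄) (hd : 1 ≤ finrank ℝ E) (hε : (finrank ℝ E : ℝ) ^ 2 / N ≤ κ / 4) :
    ENNReal.ofReal ((N / (2 * Real.pi)) ^ ((finrank ℝ E : ℝ) / 2)) *
      ∫⁻ t in {t : E | ‖t‖ ^ 2 < 5 * finrank ℝ E / N}ᶜ, ‖f t‖ₑ ≤
    ENNReal.ofReal (Real.exp (40 * c₄ * ((finrank ℝ E : ℝ) ^ 2 / N)) *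
        Real.exp (-(finrank ℝ E : ℝ)) + 4 * Real.exp (-(finrank ℝ E : ℝ)) +
      4 * (Real.exp 1 / κ ^ 2 * ((finrank ℝ E : ℝ) ^ 2 / N)) ^ ((finrank ℝ E : ℝ) / 2)) := by
  have htail1 := lintegral_tail_exp_le (E := E) hN hd
  have htail2 := lintegral_tail_pow_le (E := E) hN hκ hd hε
  have hfive := gaussianLaw_five_le (E := E) hN
  have hball := fun t ht => hf.mul_norm_le_of_mem_ball hN hc₄ (t := t) ht
  have hout := hf.norm_le
  set D : ℝ := (finrank ℝ E : ℝ) with hD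
  have hDpos : 0 < D := by rw [hD]; exact_mod_cast hd
  set L := Real.exp (40 * c₄ * (D ^ 2 / N)) with hL
  set A := (N / (2 * Real.pi)) ^ (D / 2) with hA
  have hApos : 0 < A := by positivity
  set S := {t : E | ‖t‖ ^ 2 < 5 * D / N} with hS
  have hSm : MeasurableSet S := measurableSet_norm_sq_lt _
  set T := {t : E | 5 / 2 * √(D / N) ≤ ‖t‖} with hT
  have hTm : MeasurableSet T := (isClosed_le continuous_const continuous_norm).measurableSet
  have hcompl : Sᶜ = {t : E | 5 * D / N ≤ ‖t‖ ^ 2} := by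
    ext t; simp [hS]
  set g1 : E → ENNReal := fun t => ENNReal.ofReal (Real.exp (-(√(D / N) * ‖t‖ * N))) with hg1
  set g2 : E → ENNReal := fun t => ENNReal.ofReal ((1 + ‖t‖) ^ (-(κ / √D * N))) with hg2
  have hm1 : Measurable g1 := by
    apply Measurable.ennreal_ofReal
    exact Continuous.measurable (by fun_prop)
  have hm2 : Measurable g2 := by
    apply Measurable.ennreal_ofReal
    exact (measurable_const.add measurable_norm).pow_const _
  have hmw : Measurable fun t : E => ENNReal.ofReal (gaussianWeight N t) :=
    (continuous_gaussianWeight N).measurable.ennreal_ofReal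
  have hpt : ∀ t ∈ Sᶜ, ENNReal.ofReal A * ‖f t‖ₑ ≤ ENNReal.ofReal L *
      ENNReal.ofReal (gaussianWeight N t) +
        (ENNReal.ofReal A * T.indicator g1 t + ENNReal.ofReal A * g2 t) := by
    intro t _
    rw [← ofReal_norm]
    by_cases ht : t ∈ T
    · refine le_trans ?_ le_add_self
      rw [Set.indicator_of_mem ht, ← mul_add]
      gcongr
      rw [← ENNReal.ofReal_add (by positivity) (by positivity)]
      exact ENNReal.ofReal_le_ofReal (hout t ht)
    · refine le_trans ?_ le_self_add
      rw [← ENNReal.ofReal_mul hApos.le, ← ENNReal.ofReal_mul (Real.exp_nonneg _)]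
      refine ENNReal.ofReal_le_ofReal (hball t ?_)
      rw [mem_ball_zero_iff]
      exact not_le.mp ht
  calc ENNReal.ofReal A * ∫⁻ t in Sᶜ, ‖f t‖ₑ
      = ∫⁻ t in Sᶜ, ENNReal.ofReal A * ‖f t‖ₑ :=
        (lintegral_const_mul _ hf.continuous.measurable.enorm).symm
    _ ≤ ∫⁻ t in Sᶜ, (ENNReal.ofReal L * ENNReal.ofReal (gaussianWeight N t) +
        (ENNReal.ofReal A * T.indicator g1 t + ENNReal.ofReal A * g2 t)) :=
        setLIntegral_mono' hSm.compl hpt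
    _ = ENNReal.ofReal L * gaussianLaw E N Sᶜ +
        (ENNReal.ofReal A * (∫⁻ t in Sᶜ, T.indicator g1 t) +
          ENNReal.ofReal A * ∫⁻ t in Sᶜ, g2 t) := by
        rw [lintegral_add_left (hmw.const_mul _), lintegral_add_right _ (hm2.const_mul _),
          lintegral_const_mul _ hmw, lintegral_const_mul _ (hm1.indicator hTm),
          lintegral_const_mul _ hm2, gaussianLaw_apply N hSm.compl]
    _ ≤ ENNReal.ofReal L * ENNReal.ofReal (Real.exp (-D)) +
        (ENNReal.ofReal (4 * Real.exp (-D)) +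
          ENNReal.ofReal (4 * (Real.exp 1 / κ ^ 2 * (D ^ 2 / N)) ^ (D / 2))) := by
        gcongr
        · rw [hcompl]; exact hfive
        · refine le_trans ?_ htail1
          rw [← lintegral_indicator hTm]
          exact mul_le_mul_right (setLIntegral_le_lintegral _ _) _
        · refine le_trans ?_ htail2
          exact mul_le_mul_right (setLIntegral_le_lintegral _ _) _
    _ = _ := by
        rw [← ENNReal.ofReal_mul (Real.exp_nonneg _), ← ENNReal.ofReal_add (by positivity)
          (by positivity), ← ENNReal.ofReal_add (by positivity) (by positivity), add_assoc]

lemma integrable (hf : NearGaussian N κ c₃ c₄ f r v) (hN : 0 < N) (hκ : 0 < κ)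
    (hc₄ : 0 ≤ c₄) (hd : 1 ≤ finrank ℝ E) (hε : (finrank ℝ E : ℝ) ^ 2 / N ≤ κ / 4) :
    Integrable f := by
  have hcompl := hf.lintegral_compl_le hN hκ hc₄ hd hε
  set D : ℝ := (finrank ℝ E : ℝ) with hD
  set S := {t : E | ‖t‖ ^ 2 < 5 * D / N} with hS
  have hSm : MeasurableSet S := measurableSet_norm_sq_lt _
  have := isProbabilityMeasure_gaussianLaw (E := E) hN
  set A := (N / (2 * Real.pi)) ^ (D / 2) with hA
  have hApos : 0 < A := by positivity
  refine ⟨hf.continuous.aestronglyMeasurable, ?_⟩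
  rw [hasFiniteIntegral_iff_enorm, ← lintegral_add_compl _ hSm]
  refine ENNReal.add_lt_top.mpr ⟨?_, ?_⟩
  · have h1 : ENNReal.ofReal A * ∫⁻ t in S, ‖f t‖ₑ ≤
        ENNReal.ofReal (Real.exp (40 * c₄ * (D ^ 2 / N))) * gaussianLaw E N S := by
      rw [gaussianLaw_apply N hSm, ← lintegral_const_mul _ hf.continuous.measurable.enorm,
        ← lintegral_const_mul _ (continuous_gaussianWeight N).measurable.ennreal_ofReal]
      refine setLIntegral_mono' hSm fun t ht => ?_
      rw [← ofReal_norm, ← ENNReal.ofReal_mul hApos.le,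
        ← ENNReal.ofReal_mul (Real.exp_nonneg _)]
      exact ENNReal.ofReal_le_ofReal
        (hf.mul_norm_le_of_mem_ball hN hc₄ (mem_ball_of_norm_sq_lt hN ht))
    exact ENNReal.lt_top_of_mul_ne_top_right
      (h1.trans_lt (ENNReal.mul_lt_top ENNReal.ofReal_lt_top (measure_lt_top _ _))).ne
      (ENNReal.ofReal_pos.mpr hApos).ne'
  · exact ENNReal.lt_top_of_mul_ne_top_right
      (hcompl.trans_lt ENNReal.ofReal_lt_top).ne (ENNReal.ofReal_pos.mpr hApos).ne'

/-- The normalized integral of `f` is close to one: compare with the Gaussian law on the ball of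
radius `√(5 d / N)`, and bound both integrals on the complement. -/
theorem norm_integral_sub_one_le (hf : NearGaussian N κ c₃ c₄ f r v) (hN : 0 < N) (hκ : 0 < κ)
    (hc₄ : 0 ≤ c₄) (hd : 1 ≤ finrank ℝ E) (hε : (finrank ℝ E : ℝ) ^ 2 / N ≤ κ / 4) :
    ‖(((N / (2 * Real.pi)) ^ ((finrank ℝ E : ℝ) / 2) : ℝ) : ℂ) * (∫ t, f t) - 1‖ ≤
      64040 * (Real.exp (40 * c₄ * ((finrank ℝ E : ℝ) ^ 2 / N)) * (c₃ ^ 2 + c₄) *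
          ((finrank ℝ E : ℝ) ^ 2 / N) + Real.exp (-(finrank ℝ E : ℝ)) +
        (Real.exp 1 / κ ^ 2 * ((finrank ℝ E : ℝ) ^ 2 / N)) ^ ((finrank ℝ E : ℝ) / 2)) := by
  have hint := hf.integrable hN hκ hc₄ hd hε
  have hcompl := hf.lintegral_compl_le hN hκ hc₄ hd hε
  have hmain := hf.lintegral_abs_mul_re_sub_gaussianWeight_le hN hc₄ hd
  have hfive := gaussianLaw_five_le (E := E) hN
  have := isProbabilityMeasure_gaussianLaw (E := E) hN
  set D : ℝ := (finrank ℝ E : ℝ) with hD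
  set L := Real.exp (40 * c₄ * (D ^ 2 / N)) with hL
  set A := (N / (2 * Real.pi)) ^ (D / 2) with hA
  have hApos : 0 < A := by positivity
  set S := {t : E | ‖t‖ ^ 2 < 5 * D / N} with hS
  have hSm : MeasurableSet S := measurableSet_norm_sq_lt _
  have hcompl' : Sᶜ = {t : E | 5 * D / N ≤ ‖t‖ ^ 2} := by
    ext t; simp [hS]
  set Q := (Real.exp 1 / κ ^ 2 * (D ^ 2 / N)) ^ (D / 2) with hQ
  have hQ0 : 0 ≤ Q := by positivity
  -- the mass of the Gaussian law in the small ball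
  have hwm : AEStronglyMeasurable (gaussianWeight N : E → ℝ) (volume.restrict S) :=
    (continuous_gaussianWeight N).aestronglyMeasurable
  have hwi : IntegrableOn (gaussianWeight N : E → ℝ) S := by
    refine ⟨hwm, ?_⟩
    rw [hasFiniteIntegral_iff_ofReal (Filter.Eventually.of_forall (gaussianWeight_nonneg hN)),
      ← gaussianLaw_apply N hSm]
    exact measure_lt_top _ _
  have hw : ∫ t in S, gaussianWeight N t = (gaussianLaw E N).real S := by
    rw [integral_eq_lintegral_of_nonneg_ae
      (Filter.Eventually.of_forall (gaussianWeight_nonneg hN)) hwm, ← gaussianLaw_apply N hSm]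
    rfl
  have hmass : 1 - (gaussianLaw E N).real S ≤ Real.exp (-D) := by
    rw [← probReal_compl_eq_one_sub hSm, hcompl']
    exact ENNReal.toReal_le_of_le_ofReal (Real.exp_nonneg _) hfive
  have hmass' : (gaussianLaw E N).real S ≤ 1 := measureReal_le_one
  -- the three parts of the error
  have h1 : ‖(A : ℂ) * (∫ t in S, f t) - ((gaussianLaw E N).real S : ℝ)‖ ≤
      64000 * (L * (c₃ ^ 2 + c₄) * (D ^ 2 / N)) := by
    have hre : IntegrableOn (fun t => A * (f t).re) S := hint.re.integrableOn.const_mul A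
    rw [integral_symm_eq_ofReal hf.symm _ hint, ← hw, ← Complex.ofReal_mul, ← Complex.ofReal_sub,
      Complex.norm_real, ← integral_const_mul, ← hS, ← integral_sub hre hwi]
    refine (norm_integral_le_lintegral_norm _).trans ?_
    exact ENNReal.toReal_le_of_le_ofReal (by positivity) hmain
  have h2 : ‖(A : ℂ) * ∫ t in Sᶜ, f t‖ ≤ L * Real.exp (-D) + 4 * Real.exp (-D) + 4 * Q := by
    rw [norm_mul, Complex.norm_real, Real.norm_of_nonneg hApos.le]
    have h3 := ENNReal.toReal_le_of_le_ofReal (by positivity) hcompl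
    rw [ENNReal.toReal_mul, ENNReal.toReal_ofReal hApos.le] at h3
    refine le_trans ?_ h3
    gcongr
    simpa only [ofReal_norm] using
      norm_integral_le_lintegral_norm (μ := volume.restrict Sᶜ) f
  have h3 : L * Real.exp (-D) ≤ Real.exp (-D) + 40 * (L * (c₃ ^ 2 + c₄) * (D ^ 2 / N)) := by
    set x := 40 * c₄ * (D ^ 2 / N) with hx
    have hx0 : 0 ≤ x := by positivity
    -- `exp x ≤ 1 + x * exp x` trades the factor `L` for a term of the first kind
    have hL1 : L ≤ 1 + x * L := by
      have h4 := Real.add_one_le_exp (-x)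
      have h5 : L * Real.exp (-x) = 1 := by rw [hL, ← Real.exp_add]; simp
      nlinarith [Real.exp_pos x]
    have hD1 : Real.exp (-D) ≤ 1 := Real.exp_le_one_iff.mpr (by simp [hD])
    have hL0 : 0 < L := Real.exp_pos _
    have h6 : x * L ≤ 40 * (L * (c₃ ^ 2 + c₄) * (D ^ 2 / N)) := by
      have : 0 ≤ L * c₃ ^ 2 * (D ^ 2 / N) := by positivity
      rw [hx]; nlinarith
    have h7 : x * L * Real.exp (-D) ≤ x * L := mul_le_of_le_one_right (by positivity) hD1
    nlinarith [Real.exp_pos (-D)]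
  rw [← integral_add_compl hSm hint]
  calc ‖(A : ℂ) * ((∫ t in S, f t) + ∫ t in Sᶜ, f t) - 1‖
      = ‖((A : ℂ) * (∫ t in S, f t) - ((gaussianLaw E N).real S : ℝ)) +
          (A : ℂ) * (∫ t in Sᶜ, f t) - ((1 - (gaussianLaw E N).real S : ℝ) : ℂ)‖ := by
        congr 1; push_cast; ring
    _ ≤ ‖(A : ℂ) * (∫ t in S, f t) - ((gaussianLaw E N).real S : ℝ)‖ +
          ‖(A : ℂ) * (∫ t in Sᶜ, f t)‖ + ‖((1 - (gaussianLaw E N).real S : ℝ) : ℂ)‖ :=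
        (norm_sub_le _ _).trans (by gcongr; exact norm_add_le _ _)
    _ ≤ 64000 * (L * (c₃ ^ 2 + c₄) * (D ^ 2 / N)) +
          (L * Real.exp (-D) + 4 * Real.exp (-D) + 4 * Q) + Real.exp (-D) := by
        gcongr
        rw [Complex.norm_real, Real.norm_of_nonneg (by linarith)]
        exact hmass
    _ ≤ _ := by
        have := Real.exp_pos (-D)
        nlinarith

end NearGaussian

end Estimate

end LaplaceEstimate

/-! ### The saddle point integral -/

section Saddle

open Module

variable {d n : ℕ} {μ : Measure (Vec d)} [IsProbabilityMeasure μ] {V : Set (Vec d)} {κ δ : ℝ}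
  {τ : Vec d}

lemma integrand_eq (h4 : Integrable (fun x => ‖x‖ ^ 4 * Real.exp ⟪τ, x⟫) μ) (n : ℕ)
    (a t : Vec d) :
    integrand μ n τ a t = charFun (whitenedLaw μ τ) t ^ n *
      Complex.exp (-(Complex.I * n * (⟪invSqrtCLM (hess μ τ) a, t⟫ : ℝ))) := by
  have hpos : (mgf μ τ : ℂ) ≠ 0 := Complex.ofReal_ne_zero.mpr (mgf_pos h4).ne'
  have h1 : ⟪whiten μ τ t, a⟫ = ⟪invSqrtCLM (hess μ τ) a, t⟫ := by
    rw [inner_invSqrtCLM, real_inner_comm]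
    rfl
  rw [integrand, mgfC_whiten_eq h4, mul_div_cancel_left₀ _ hpos, h1]

/-- At the saddle point the tilt by `a` removes the linear part of the phase, and the whitening turns
the quadratic part of the modulus into `-‖t‖² / 2`. -/
lemma nearGaussian_integrand (hd : 1 ≤ d) (hn : 1 ≤ n) (h : Regular μ V n κ δ) (hδ : 0 < δ)
    (hτ : τ ∈ V) :
    NearGaussian n κ (c3 μ V n) (c4 μ V n) (integrand μ n τ (gradient (cgf μ) τ))
      (fun t => (Complex.log (charFun (whitenedLaw μ τ) t)).re + ‖t‖ ^ 2 / 2)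
      (fun t => (Complex.log (charFun (whitenedLaw μ τ) t)).im -
        ⟪invSqrtCLM (hess μ τ) (gradient (cgf μ) τ), t⟫) := by
  have hI := integrable_moment h
  have h4 := hI τ hτ
  have := isProbabilityMeasure_whitenedLaw h4
  have hn0 : (0 : ℝ) < n := by exact_mod_cast hn
  have hcont : Continuous (charFun (whitenedLaw μ τ)) := continuous_charFun
  have hR : (5 / 2 * √((finrank ℝ (Vec d) : ℝ) / n)) = radius d n := by
    rw [finrank_euclideanSpace_fin]; rfl
  have hslit : ∀ t ∈ Metric.ball (0 : Vec d) (radius d n),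
      charFun (whitenedLaw μ τ) t ∈ Complex.slitPlane := fun t ht =>
    (charFun_whitenedLaw_mem h hδ hτ (mem_ball_zero_iff.mp ht).le).1
  have hmem := memLp_four_whitenedLaw h4
  have hmean := integral_inner_whitenedLaw hd h.isOpen hI hτ
  have hcov := integral_inner_mul_inner_whitenedLaw hd h.isOpen hI hτ (h.posDef τ hτ)
  set ν := whitenedLaw μ τ with hν
  set m := invSqrtCLM (hess μ τ) (gradient (cgf μ) τ) with hm
  constructor
  · refine Continuous.congr ?_ fun t => (integrand_eq h4 n (gradient (cgf μ) τ) t).symm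
    fun_prop
  · intro t
    rw [integrand_eq h4, integrand_eq h4, map_mul, map_pow, ← Complex.exp_conj, charFun_neg,
      inner_neg_right]
    simp
  · rw [hR]
    intro t ht
    have h1 : charFun ν t = Complex.exp (Complex.log (charFun ν t)) :=
      (Complex.exp_log (Complex.slitPlane_ne_zero (hslit t ht))).symm
    rw [integrand_eq h4, ← hν, ← hm, h1, ← Complex.exp_nat_mul, ← Complex.exp_add, ← h1]
    congr 1
    conv_lhs => rw [← Complex.re_add_im (Complex.log (charFun ν t))]
    push_cast
    ring
  · rw [hR]
    exact abs_re_log_charFun_add_le hmem hmean hcov (radius_pos hd hn) hslit (c4_nonneg μ V n)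
      fun t ht => norm_iteratedFDeriv_re_le_c4 hd h hδ hτ ht
  · have := hcont.measurable
    exact (Complex.measurable_im.comp (Complex.measurable_log.comp this)).sub (by fun_prop)
  · rw [hR]
    exact (contDiffOn_im_log_charFun_sub hmem m hslit).of_le (by norm_cast)
  · rw [hR]
    exact fun t ht => im_log_charFun_sub_odd m (hslit t ht)
  · rw [hR]
    exact norm_fderiv_im_log_charFun_sub_le hmem hmean (radius_pos hd hn) hslit (c3_nonneg μ V n)
      fun t ht => norm_iteratedFDeriv_im_le_c3 hd h hδ hτ ht
  · rw [hR]
    intro t ht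
    have h1 := h.decay τ hτ t ht
    rw [integrand, norm_mul, norm_pow, Complex.norm_exp, finrank_euclideanSpace_fin]
    have h2 : (-(Complex.I * n * (⟪whiten μ τ t, gradient (cgf μ) τ⟫ : ℂ))).re = 0 := by
      simp
    rw [h2, Real.exp_zero, mul_one]
    have h3 : Real.exp (-(√((d : ℝ) / n) * ‖t‖)) ^ n =
        Real.exp (-(√((d : ℝ) / n) * ‖t‖ * n)) := by
      rw [← Real.exp_nat_mul]; ring_nf
    have h5 : ((1 + ‖t‖) ^ (-(κ / √(d : ℝ)))) ^ n = (1 + ‖t‖) ^ (-(κ / √(d : ℝ) * n)) := by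
      rw [← Real.rpow_natCast, ← Real.rpow_mul (by positivity), neg_mul]
    calc ‖mgfC μ τ (whiten μ τ t) / (mgf μ τ : ℂ)‖ ^ n
        ≤ (max (Real.exp (-(√((d : ℝ) / n) * ‖t‖))) ((1 + ‖t‖) ^ (-(κ / √(d : ℝ))))) ^ n := by
          gcongr
      _ ≤ Real.exp (-(√((d : ℝ) / n) * ‖t‖)) ^ n + ((1 + ‖t‖) ^ (-(κ / √(d : ℝ)))) ^ n := by
          rcases max_choice (Real.exp (-(√((d : ℝ) / n) * ‖t‖)))
            ((1 + ‖t‖) ^ (-(κ / √(d : ℝ)))) with hc | hc <;> rw [hc]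
          · exact le_add_of_nonneg_right (by positivity)
          · exact le_add_of_nonneg_left (by positivity)
      _ = _ := by rw [h3, h5]

end Saddle

end SPA

theorem theorem3p1 :
    ∃ C : ℝ, 0 < C ∧
      ∀ κ : ℝ, 0 < κ →
        ∃ ε₀ : ℝ, 0 < ε₀ ∧
          ∀ (d n : ℕ), 1 ≤ d → 1 ≤ n →
          ∀ (μ : MeasureTheory.Measure (SPA.Vec d)) [MeasureTheory.IsProbabilityMeasure μ]
            (V : Set (SPA.Vec d)) (δ : ℝ), 0 < δ → SPA.Regular μ V n κ δ →
          ∀ ε : ℝ, ε = (d : ℝ) ^ 2 / (n : ℝ) → ε ≤ ε₀ →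
            BddAbove (SPA.thirdDerivNorms μ V n) ∧
            BddAbove (SPA.fourthDerivNorms μ V n) ∧
            ∀ a ∈ gradient (SPA.cgf μ) '' V, ∀ τ ∈ V, gradient (SPA.cgf μ) τ = a →
              MeasureTheory.Integrable (SPA.integrand μ n τ a) ∧
              ‖SPA.saddleIntegral μ n τ a - 1‖ ≤
                C * (Real.exp (40 * SPA.c4 μ V n * ε) *
                      (SPA.c3 μ V n ^ 2 + SPA.c4 μ V n) * ε
                    + Real.exp (-(d : ℝ))
                    + (Real.exp 1 / κ ^ 2 * ε) ^ ((d : ℝ) / 2)) := by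
  refine ⟨64040, by norm_num, fun κ hκ => ⟨κ / 4, by positivity, ?_⟩⟩
  intro d n hd hn μ _ V δ hδ h ε hε hε₀
  refine ⟨SPA.bddAbove_thirdDerivNorms hd h hδ, SPA.bddAbove_fourthDerivNorms hd h hδ, ?_⟩
  rintro a - τ hτ rfl
  have hf := SPA.nearGaussian_integrand hd hn h hδ hτ
  have hn0 : (0 : ℝ) < n := by exact_mod_cast hn
  have hfin : Module.finrank ℝ (SPA.Vec d) = d := finrank_euclideanSpace_fin
  have hd' : 1 ≤ Module.finrank ℝ (SPA.Vec d) := by rw [hfin]; exact hd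
  have hε' : (Module.finrank ℝ (SPA.Vec d) : ℝ) ^ 2 / n ≤ κ / 4 := by rw [hfin, ← hε]; exact hε₀
  refine ⟨hf.integrable hn0 hκ (SPA.c4_nonneg μ V n) hd' hε', ?_⟩
  have hbound := hf.norm_integral_sub_one_le hn0 hκ (SPA.c4_nonneg μ V n) hd' hε'
  rw [hfin, ← hε, Real.div_rpow (by positivity) (by positivity)] at hbound
  exact hbound
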